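/- Let $G=\mathrm{PSL}_n(\mathbb R)$ and $\mathfrak g=\mathfrak{sl}_n(\mathbb R)$. Let $\Sigma$ be a compact connected oriented hyperbolic surface with boundary components $\zeta_1,\dots,\zeta_b$, and let $\xi_1,\dots,\xi_m$ be pairwise disjoint, pairwise non-isotopic essential simple closed curves in the interior of $\Sigma$ (cores of disjoint embedded annuli) which divide $\Sigma$ into hyperbolic pieces $\Sigma_1,\dots,\Sigma_l$. Let $\mathcal G$ be the dual graph, with vertices $\Sigma_1,\dots,\Sigma_l$ and edges $\xi_1,\dots,\xi_m$, the edge $\xi_i$ being directed from a piece $\mathrm o(\xi_i)$ on one side of $\xi_i$ to the piece $\mathrm t(\xi_i)$ on the other side. Fix a maximal tree $\mathcal D$ of $\mathcal G$ with a base vertex, a base point in each piece, and arcs in the pieces from the base points to the boundary curves (including both sides of each $\xi_i$). These choices determine, with $\Gamma=\pi_1(\Sigma)$ based at the base point of the base vertex: the subgroups $\Gamma_{\Sigma_v}\subset\Gamma$ (images of the groups $\pi_1(\Sigma_v)$); cyclic subgroups $\Gamma_{\xi_i}^{-}\subset\Gamma_{\Sigma_v}$, $\Sigma_v=\mathrm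 o(\xi_i)$, and $\Gamma_{\xi_i}^{+}\subset\Gamma_{\Sigma_w}$, $\Sigma_w=\mathrm t(\xi_i)$, generated by $\xi_i$ seen from its two sides, $\gamma^\pm$ denoting corresponding elements of $\Gamma_{\xi_i}^\pm$; cyclic subgroups $\langle\zeta_j\rangle$; and, for $\xi_i\notin\mathcal D$, the element $\xi_i^\perp\in\Gamma$ of a loop that leaves the tree only by crossing $\xi_i$ once, with $\xi_i^\perp\gamma^+(\xi_i^\perp)^{-1}=\gamma^-$. For $\xi_i\in\mathcal D$ one has $\gamma^+=\gamma^-$ in $\Gamma$. Write $\Sigma_q\le\Sigma_v$ if the path in $\mathcal D$ from the base vertex to $\Sigma_v$ goes through $\Sigma_q$. Let $\mathcal S=\{\Gamma_{\xi_1}^+,\dots,\Gamma_{\xi_m}^+,\langle\zeta_1\rangle,\dots,\langle\zeta_b\rangle\}$, and let $\mathcal S_v$ be the collection of the subgroups of $\Gamma_{\Sigma_v}$ generated by the boundary components of the completion $\overline{\Sigma_v}$ (the $\zeta_j$ in $\Sigma_v$ and the sides of curves $\xi_i$ that face $\Sigma_v$). For a group system $(\Delta,\mathcal T)$, $H^1_{\mathrm{par}}(\Delta,\mathcal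 T;\mathfrak g)\subset H^1(\Delta;\mathfrak g)$ is the image of the relative cohomology $H^1(\Delta,\mathcal T;\mathfrak g)$, i.e. the space of classes of cocycles whose restriction to each member of $\mathcal T$ is a coboundary. Let $\rho:\Gamma\to G$ be a representation such that $\rho$ and all its restrictions $\rho_v=\rho|_{\Gamma_{\Sigma_v}}$ are irreducible with trivial centralizer in $G$; let $\Gamma$ act on $\mathfrak g$ by $\mathrm{Ad}\,\rho$, and let $H^0(\Gamma_{\xi_i};\mathfrak g)\subset\mathfrak g$ be the subspace fixed by $\Gamma_{\xi_i}^+$. **Proposition.** There is a short exact sequence of real vector spaces $$0\to\bigoplus_{i=1}^m H^0(\Gamma_{\xi_i};\mathfrak g)\xrightarrow{\ \delta\ }H^1_{\mathrm{par}}(\Gamma,\mathcal S;\mathfrak g_\rho)\xrightarrow{\ \iota^*\ }\bigoplus_{v=1}^l H^1_{\mathrm{par}}(\Gamma_{\Sigma_v},\mathcal S_v;\mathfrak g_{\rho_v})\to0$$ in which: * $\iota^*$ is restriction: the component of $\iota^*[\alpha]$ at $v$ is $[\alpha|_{\Gamma_{\Sigma_v}}]$. * $\delta$ is the Mayer–Vietoris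 connecting homomorphism: for $(X_i)\in\bigoplus_iH^0(\Gamma_{\xi_i};\mathfrak g)$ and a cocycle $\alpha$ of $\Gamma$, $\delta((X_i))=[\alpha]$ if and only if there are $Y_1,\dots,Y_l\in\mathfrak g$ with $\alpha(x)=\mathrm{Ad}_{\rho(x)}Y_v-Y_v$ for all $x\in\Gamma_{\Sigma_v}$ and all $v$; with $X_i=Y_p-Y_q$ whenever $\xi_i\in\mathcal D$ joins $\Sigma_p<\Sigma_q$; and with $X_i=\mathrm{Ad}_{\rho(\xi_i^\perp)^{-1}}\big(\alpha(\xi_i^\perp)+Y_v\big)-Y_w$ whenever $\xi_i\notin\mathcal D$, $\Sigma_v=\mathrm o(\xi_i)$, $\Sigma_w=\mathrm t(\xi_i)$. * For $X\in H^0(\Gamma_{\xi_i};\mathfrak g)$, in the $i$-th summand, $\delta(X)$ is the class of the tangent cocycle $x\mapsto\frac{d}{ds}\big|_{s=0}\Phi^s(x)\Phi^0(x)^{-1}$ of the algebraic bending $\Phi^s$, $\Phi^0=\rho$, of $\rho$ by $X$ along $\xi_i$, i.e. of the unique family of representations $\Phi^s:\Gamma\to G$, $s\in\mathbb R$, with the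 following values. * If $\xi_i\in\mathcal D$ joins $\Sigma_p<\Sigma_q$: for $x\in\Gamma_{\Sigma_v}$, $\Phi^s(x)=\exp(sX)\rho(x)\exp(-sX)$ if $\Sigma_q\le\Sigma_v$ and $\Phi^s(x)=\rho(x)$ otherwise; for $x=\xi_k^\perp$, $\xi_k\notin\mathcal D$, $\Phi^s(x)$ is $\rho(x)$ multiplied from the left by $\exp(sX)$ if $\Sigma_q\le\mathrm o(\xi_k)$ and from the right by $\exp(-sX)$ if $\Sigma_q\le\mathrm t(\xi_k)$. * If $\xi_i\notin\mathcal D$: $\Phi^s(\xi_i^\perp)=\rho(\xi_i^\perp)\exp(sX)$, and $\Phi^s=\rho$ on all $\Gamma_{\Sigma_v}$ and on all $\xi_k^\perp$, $\xi_k\notin\mathcal D$, $k\ne i$. -/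

import Mathlib

noncomputable section

open CategoryTheory

/-! ### The group `PSL_n(ℝ)`, its Lie algebra and the adjoint representation -/

/-- The Lie group `G = PSL_n(ℝ)`. -/
abbrev PSLn (n : ℕ) : Type := Matrix.ProjectiveSpecialLinearGroup (Fin n) ℝ

/-- The Lie algebra `𝔤 = 𝔰𝔩_n(ℝ)` of traceless matrices. -/
abbrev sln (n : ℕ) : Type := LieAlgebra.SpecialLinear.sl (Fin n) ℝ

/-- The class in `PSL_n(ℝ)` of an element of `SL_n(ℝ)`. -/
def toPSL (n : ℕ) : Matrix.SpecialLinearGroup (Fin n) ℝ →* PSLn n :=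
  QuotientGroup.mk' _

/-- The adjoint action `X ↦ A X A⁻¹` of `SL_n(ℝ)` on `𝔰𝔩_n(ℝ)`. -/
def adSL (n : ℕ) : Representation ℝ (Matrix.SpecialLinearGroup (Fin n) ℝ) (sln n) where
  toFun A :=
    { toFun := fun X => ⟨(A : Matrix (Fin n) (Fin n) ℝ) * X.1 *
          ((A⁻¹ : Matrix.SpecialLinearGroup (Fin n) ℝ) : Matrix (Fin n) (Fin n) ℝ), by
          have hX : Matrix.trace X.1 = 0 := X.2
          change Matrix.trace (_ : Matrix (Fin n) (Fin n) ℝ) = 0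
          rw [Matrix.trace_mul_comm, ← mul_assoc, ← Matrix.SpecialLinearGroup.coe_mul,
            inv_mul_cancel, Matrix.SpecialLinearGroup.coe_one, one_mul, hX]⟩
      map_add' := fun X Y => by
        apply Subtype.ext
        simp [mul_add, add_mul]
      map_smul' := fun c X => by
        apply Subtype.ext
        simp }
  map_one' := by
    ext X : 2
    simp
  map_mul' A B := by
    ext X : 2
    simp only [LinearMap.coe_mk, AddHom.coe_mk, Module.End.mul_apply, mul_inv_rev,
      Matrix.SpecialLinearGroup.coe_mul, mul_assoc]

theorem adSL_center (n : ℕ) :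
    Subgroup.center (Matrix.SpecialLinearGroup (Fin n) ℝ) ≤ (adSL n).ker := by
  intro A hA
  obtain ⟨r, -, hr⟩ := Matrix.SpecialLinearGroup.mem_center_iff.mp hA
  rw [MonoidHom.mem_ker]
  ext X : 2
  change (A : Matrix (Fin n) (Fin n) ℝ) * X.1 *
    ((A⁻¹ : Matrix.SpecialLinearGroup (Fin n) ℝ) : Matrix (Fin n) (Fin n) ℝ) = X.1
  have hc : (A : Matrix (Fin n) (Fin n) ℝ) * X.1 = X.1 * (A : Matrix (Fin n) (Fin n) ℝ) := by
    rw [← hr]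
    exact (Matrix.scalar_commute r (fun s => mul_comm r s) X.1).eq
  rw [hc, mul_assoc, ← Matrix.SpecialLinearGroup.coe_mul, mul_inv_cancel,
    Matrix.SpecialLinearGroup.coe_one, mul_one]

/-- The adjoint representation of `PSL_n(ℝ)` on `𝔰𝔩_n(ℝ)`. -/
def adPSL (n : ℕ) : Representation ℝ (PSLn n) (sln n) :=
  QuotientGroup.lift _ (adSL n) (adSL_center n)

theorem det_exp_of_trace_eq_zero {n : ℕ} (X : Matrix (Fin n) (Fin n) ℝ)
    (hX : Matrix.trace X = 0) : (NormedSpace.exp X).det = 1 := by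
  let _ : NormedRing (Matrix (Fin n) (Fin n) ℝ) := Matrix.linftyOpNormedRing
  let _ : NormedAlgebra ℝ (Matrix (Fin n) (Fin n) ℝ) := Matrix.linftyOpNormedAlgebra
  have hdet : Differentiable ℝ (fun M : Matrix (Fin n) (Fin n) ℝ => M.det) := by
    have hent : ∀ i j, Differentiable ℝ (fun M : Matrix (Fin n) (Fin n) ℝ => M i j) :=
      fun i j => (LinearMap.toContinuousLinearMap
        (Matrix.entryLinearMap ℝ ℝ i j : Matrix (Fin n) (Fin n) ℝ →ₗ[ℝ] ℝ)).differentiable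
    simp only [Matrix.det_apply]
    fun_prop
  have hexp : ∀ s : ℝ, HasDerivAt (fun t : ℝ => NormedSpace.exp (t • X))
      (NormedSpace.exp (s • X) * X) s := fun s => hasDerivAt_exp_smul_const X s
  -- the derivative of the determinant at `1` in the direction `X` is the trace of `X`
  have h1 : HasDerivAt (fun t : ℝ => (1 + t • X).det) 0 0 := by
    have h := (Matrix.det (1 + (Polynomial.X : Polynomial ℝ) • X.map Polynomial.C)).hasDerivAt 0
    rw [Matrix.derivative_det_one_add_X_smul, hX] at h
    refine h.congr_of_eventuallyEq (Filter.Eventually.of_forall fun t => ?_)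
    simp only
    rw [← Polynomial.coe_evalRingHom, RingHom.map_det]
    congr 1
    ext i j
    by_cases hij : i = j <;> simp [hij, mul_comm t]
  have hline : HasDerivAt (fun t : ℝ => (1 + t • X : Matrix (Fin n) (Fin n) ℝ)) X 0 := by
    have h := ((hasDerivAt_id (0 : ℝ)).smul_const X).const_add (1 : Matrix (Fin n) (Fin n) ℝ)
    rw [one_smul] at h
    exact h
  have hD : fderiv ℝ (fun M : Matrix (Fin n) (Fin n) ℝ => M.det) 1 X = 0 := by
    have hd : HasFDerivAt (fun M : Matrix (Fin n) (Fin n) ℝ => M.det)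
        (fderiv ℝ (fun M : Matrix (Fin n) (Fin n) ℝ => M.det) 1) (1 + (0 : ℝ) • X) := by
      simpa using (hdet 1).hasFDerivAt
    exact (hd.comp_hasDerivAt 0 hline).unique h1
  have h0 : HasDerivAt (fun t : ℝ => (NormedSpace.exp (t • X)).det) 0 0 := by
    have hd : HasFDerivAt (fun M : Matrix (Fin n) (Fin n) ℝ => M.det)
        (fderiv ℝ (fun M : Matrix (Fin n) (Fin n) ℝ => M.det) 1)
        (NormedSpace.exp ((0 : ℝ) • X)) := by
      simpa using (hdet 1).hasFDerivAt
    have h := hd.comp_hasDerivAt 0 (hexp 0)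
    rw [zero_smul, NormedSpace.exp_zero, one_mul] at h
    have h' : HasDerivAt (fun t : ℝ => (NormedSpace.exp (t • X)).det)
        (fderiv ℝ (fun M : Matrix (Fin n) (Fin n) ℝ => M.det) 1 X) 0 := h
    rwa [hD] at h'
  have hadd : ∀ s t : ℝ, (NormedSpace.exp ((s + t) • X)).det =
      (NormedSpace.exp (s • X)).det * (NormedSpace.exp (t • X)).det := by
    intro s t
    rw [add_smul, ← Matrix.det_mul, Matrix.exp_add_of_commute]
    exact ((Commute.refl X).smul_left s).smul_right t
  have hs : ∀ s : ℝ, HasDerivAt (fun t : ℝ => (NormedSpace.exp (t • X)).det) 0 s := by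
    intro s
    have h0' : HasDerivAt (fun t : ℝ => (NormedSpace.exp (t • X)).det) 0 (s + -s) := by
      simpa using h0
    have h := (h0'.comp_add_const s (-s)).const_mul (NormedSpace.exp (s • X)).det
    rw [mul_zero] at h
    refine h.congr_of_eventuallyEq (Filter.Eventually.of_forall fun t => ?_)
    simp only
    rw [← hadd]
    congr 3
    ring
  have hc := is_const_of_deriv_eq_zero (fun s => (hs s).differentiableAt)
    (fun s => (hs s).deriv) 1 0
  simpa using hc

/-- The exponential map `exp : 𝔰𝔩_n(ℝ) → PSL_n(ℝ)`. -/
def expPSL {n : ℕ} (X : sln n) : PSLn n :=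
  toPSL n ⟨NormedSpace.exp X.1, det_exp_of_trace_eq_zero X.1 X.2⟩

/-- `ρ` is irreducible: no proper nonzero linear subspace of `ℝⁿ` is invariant. -/
def IsIrreduciblePSL {Γ : Type} [Group Γ] {n : ℕ} (ρ : Γ →* PSLn n) : Prop :=
  0 < n ∧ ∀ W : Submodule ℝ (Fin n → ℝ),
    (∀ A : Matrix.SpecialLinearGroup (Fin n) ℝ, toPSL n A ∈ ρ.range →
      ∀ w ∈ W, (A : Matrix (Fin n) (Fin n) ℝ).mulVec w ∈ W) → W = ⊥ ∨ W = ⊤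

/-- The good representations: `ρ` is irreducible and its centralizer `Z_G(ρ)` is trivial. -/
def IsGoodRep {Γ : Type} [Group Γ] {n : ℕ} (ρ : Γ →* PSLn n) : Prop :=
  IsIrreduciblePSL ρ ∧ Subgroup.centralizer (ρ.range : Set (PSLn n)) = ⊥

/-- The `Γ`-module `𝔤_ρ`, i.e. `𝔤` with the action `Ad ∘ ρ`. -/
abbrev gRep {Γ : Type} [Group Γ] {n : ℕ} (ρ : Γ →* PSLn n) : Rep ℝ Γ :=
  Rep.of ((adPSL n).comp ρ)

/-- `u : Γ → 𝔤` is tangent at `t = 0` to the path `Φ t` of representations into `PSL_n(ℝ)`: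
for all `γ` the path `Φ t γ (Φ 0 γ)⁻¹` lifts to a path in `SL_n(ℝ)` starting at `1` whose
derivative at `0` is `u γ`, that is `u γ = d/dt|₀ Φ t γ (Φ 0 γ)⁻¹`. -/
def IsTangentTo {Γ : Type} [Group Γ] {n : ℕ} (Φ : ℝ → Γ →* PSLn n) (u : Γ → sln n) : Prop :=
  ∀ γ : Γ, ∃ A : ℝ → Matrix.SpecialLinearGroup (Fin n) ℝ, A 0 = 1 ∧
    (∀ t, Φ t γ * (Φ 0 γ)⁻¹ = toPSL n (A t)) ∧
    HasDerivAt (fun t => (A t : Matrix (Fin n) (Fin n) ℝ)) (u γ).1 0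

/-! ### Parabolic cohomology of a group system -/

/-- The parabolic cocycles `Z¹_par(Γ, 𝒮; A)`: those whose restriction to each `H ∈ 𝒮` is a
coboundary.  (A relative 1-cocycle is a cocycle `α` of `Γ` with a choice, for every `H ∈ 𝒮`, of a
0-cochain `X` of `H` such that `dX` is the restriction of `α`.) -/
def parCocycles {Γ : Type} [Group Γ] (A : Rep.{0} ℝ Γ) (𝒮 : Set (Subgroup Γ)) :
    Submodule ℝ (groupCohomology.cocycles₁ A) where
  carrier := {α | ∀ H ∈ 𝒮, ∃ X : A, ∀ h ∈ H, α h = A.ρ h X - X}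
  zero_mem' := fun H _ => ⟨0, fun h _ => by simp; rfl⟩
  add_mem' := fun {α β} hα hβ H hH => by
    obtain ⟨X, hX⟩ := hα H hH
    obtain ⟨Y, hY⟩ := hβ H hH
    refine ⟨X + Y, fun h hh => ?_⟩
    have e : (α + β) h = α h + β h := rfl
    rw [e, hX h hh, hY h hh, map_add]
    abel
  smul_mem' := fun c α hα H hH => by
    obtain ⟨X, hX⟩ := hα H hH
    refine ⟨c • X, fun h hh => ?_⟩
    have e : (c • α) h = c • α h := rfl
    rw [e, hX h hh, map_smul, smul_sub]

/-- The parabolic cohomology `H¹_par(Γ, 𝒮; A)`, the image of `H¹(Γ, 𝒮; A)` in `H¹(Γ; A)`: the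
classes which are represented by parabolic cocycles. -/
def parH1 {Γ : Type} [Group Γ] (A : Rep.{0} ℝ Γ) (𝒮 : Set (Subgroup Γ)) :
    Submodule ℝ (groupCohomology.H1 A) :=
  (parCocycles A 𝒮).map (groupCohomology.H1π A).hom

/-- The restriction `H¹(Γ; 𝔤_ρ) → H¹(Δ; 𝔤_{ρ|Δ})` to a subgroup. -/
def resH1 {Γ : Type} [Group Γ] {n : ℕ} (ρ : Γ →* PSLn n) (Δ : Subgroup Γ) :
    groupCohomology.H1 (gRep ρ) →ₗ[ℝ] groupCohomology.H1 (gRep (ρ.comp Δ.subtype)) :=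
  (groupCohomology.map (A := gRep ρ) (B := gRep (ρ.comp Δ.subtype)) Δ.subtype
    (𝟙 (gRep (ρ.comp Δ.subtype))) 1).hom

/-! ### Compact oriented hyperbolic surfaces -/

/-- The model of a hyperbolic surface with geodesic boundary: the closed half `0 ≤ Re z` of the
hyperbolic plane, which is bounded by the geodesic `Re z = 0`. -/
abbrev HypHalf : Type := {z : UpperHalfPlane // 0 ≤ z.re}

/-- `Y` is a compact connected oriented hyperbolic surface with (possibly empty) geodesic
boundary: the coordinate changes are locally orientation preserving isometries of the hyperbolic
plane, i.e. restrictions of elements of `SL₂(ℝ)`. -/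
structure IsHyperbolicSurface (Y : Type) [TopologicalSpace Y] [ChartedSpace HypHalf Y] : Prop where
  compact : CompactSpace Y
  hausdorff : T2Space Y
  connected : ConnectedSpace Y
  isometric : ∀ e ∈ atlas HypHalf Y, ∀ e' ∈ atlas HypHalf Y, ∀ x ∈ e.source ∩ e'.source,
    ∃ g : Matrix.SpecialLinearGroup (Fin 2) ℝ,
      ∀ᶠ y in nhds x, (e' y : UpperHalfPlane) = g • (e y : UpperHalfPlane)

/-- The boundary of a hyperbolic surface. -/
def hypBoundary (Y : Type) [TopologicalSpace Y] [ChartedSpace HypHalf Y] : Set Y :=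
  {y | (chartAt HypHalf y y : UpperHalfPlane).re = 0}

/-- The open piece `U` of a surface is hyperbolic: its completion is (homeomorphic to) a compact
hyperbolic surface, out of which `U` is obtained by leaving out some boundary components. -/
def IsHyperbolicPiece {X : Type} [TopologicalSpace X] (U : Set X) : Prop :=
  ∃ (Y : Type) (_ : TopologicalSpace Y) (_ : ChartedSpace HypHalf Y), IsHyperbolicSurface Y ∧
    ∃ h : U → Y, Topology.IsOpenEmbedding h ∧ (Set.range h)ᶜ ⊆ hypBoundary Y

/-- The (unoriented, unparametrized) simple closed curves `c` and `c'` are isotopic. -/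
def CurvesIsotopic {X : Type} [TopologicalSpace X] (c c' : C(Circle, X)) : Prop :=
  ∃ H : C(unitInterval × Circle, X), (∀ z, H (0, z) = c z) ∧
    Set.range (fun z => H (1, z)) = Set.range c' ∧ ∀ s, Function.Injective (fun z => H (s, z))

/-- A parametrized closed curve as a loop based at the image of `1`. -/
def circleLoop {X : Type} [TopologicalSpace X] (c : C(Circle, X)) : Path (c 1) (c 1) where
  toFun s := c (Circle.exp (2 * Real.pi * (s : ℝ)))
  continuous_toFun := by fun_prop
  source' := by simp
  target' := by simp

/-- A surface `X` with boundary components `ζ_1, …, ζ_b`, and pairwise disjoint simple closed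
curves `ξ_1, …, ξ_m` that divide `X` into `Σ_1, …, Σ_l`.  The simple closed curve `ξ_i` is the core
`collar i (·, 0)` of an embedded open annulus; the annulus has the two sides `s < 0` and `s > 0`,
and `ξ_i`, as an edge of the dual graph, goes from the piece `o i` on the first side to the piece
`t i` on the second one. -/
structure CutSurface (X : Type) [TopologicalSpace X] [ChartedSpace HypHalf X] (b m l : ℕ) where
  /-- the boundary components `ζ_j` -/
  bdry : Fin b → C(Circle, X)
  bdry_injective : ∀ j, Function.Injective (bdry j)
  bdry_disjoint : Pairwise fun j k => Disjoint (Set.range (bdry j)) (Set.range (bdry k))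
  bdry_range : ⋃ j, Set.range (bdry j) = hypBoundary X
  /-- the annular neighbourhoods of the curves `ξ_i` -/
  collar : Fin m → C(Circle × ℝ, X)
  collar_open : ∀ i, Topology.IsOpenEmbedding (collar i)
  collar_disjoint : Pairwise fun i k => Disjoint (Set.range (collar i)) (Set.range (collar k))
  collar_interior : ∀ i, Disjoint (Set.range (collar i)) (hypBoundary X)
  /-- the pieces `Σ_v`, i.e. the connected components of the complement of the curves -/
  piece : Fin l → Set X
  piece_open : ∀ v, IsOpen (piece v)
  piece_connected : ∀ v, IsConnected (piece v)
  piece_disjoint : Pairwise fun v w => Disjoint (piece v) (piece w)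
  piece_union : ⋃ v, piece v = (⋃ i, Set.range fun z : Circle => collar i (z, 0))ᶜ
  piece_hyperbolic : ∀ v, IsHyperbolicPiece (piece v)
  /-- the origin of the edge `ξ_i` -/
  o : Fin m → Fin l
  /-- the terminal of the edge `ξ_i` -/
  t : Fin m → Fin l
  collar_neg : ∀ i z s, s < 0 → collar i (z, s) ∈ piece (o i)
  collar_pos : ∀ i z s, 0 < s → collar i (z, s) ∈ piece (t i)

/-- The homotopy class of the loop that runs along the arc `a`, then along the loop `c`, and back
along `a`. -/
def lasso {X : Type} [TopologicalSpace X] {p q : X} (a : Path p q) (c : Path q q) :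
    Path.Homotopic.Quotient p p :=
  Path.Homotopic.Quotient.mk ((a.trans c).trans a.symm)

namespace CutSurface

variable {X : Type} [TopologicalSpace X] [ChartedSpace HypHalf X] {b m l : ℕ}

/-- The curve `collar i (·, s)` parallel to `ξ_i`.  For `s = 0` it is `ξ_i`, and the curves for
`s = 1` and `s = -1` represent the boundary components of the completed pieces that come from the
two sides of `ξ_i`. -/
def level (C : CutSurface X b m l) (i : Fin m) (s : ℝ) : C(Circle, X) where
  toFun z := C.collar i (z, s)
  continuous_toFun := by fun_prop

/-- The curves `ξ_i` are essential (neither null-homotopic nor boundary parallel) and pairwise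
non-isotopic. -/
structure IsEssential (C : CutSurface X b m l) : Prop where
  not_nullhomotopic : ∀ i, ¬ (C.level i 0).Nullhomotopic
  not_peripheral : ∀ i j, ¬ CurvesIsotopic (C.level i 0) (C.bdry j)
  not_isotopic : Pairwise fun i k => ¬ CurvesIsotopic (C.level i 0) (C.level k 0)

/-- The segment of the annulus that crosses `ξ_i` from the side of `o i` to the side of `t i`. -/
def segment (C : CutSurface X b m l) (i : Fin m) : Path (C.level i (-1) 1) (C.level i 1 1) where
  toFun s := C.collar i (1, 2 * (s : ℝ) - 1)
  continuous_toFun := by fun_prop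
  source' := by simp [level]
  target' := by
    simp only [level, ContinuousMap.coe_mk, Set.Icc.coe_one]
    norm_num

end CutSurface

/-- Walks from the vertex `r`, along the edges in `D`, in the graph with vertices `Fin l` and
edges `Fin m`, the edge `e` having origin `o e` and terminal `t e`. -/
inductive TreeWalk {m l : ℕ} (o t : Fin m → Fin l) (D : Set (Fin m)) (r : Fin l) : Fin l → Type
  | nil : TreeWalk o t D r r
  | fwd (e : Fin m) (he : e ∈ D) (w : TreeWalk o t D r (o e)) : TreeWalk o t D r (t e)
  | bwd (e : Fin m) (he : e ∈ D) (w : TreeWalk o t D r (t e)) : TreeWalk o t D r (o e)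

namespace TreeWalk

variable {m l : ℕ} {o t : Fin m → Fin l} {D : Set (Fin m)} {r : Fin l}

/-- The edges of a walk. -/
def edges : {v : Fin l} → TreeWalk o t D r v → List (Fin m)
  | _, nil => []
  | _, fwd e _ w => e :: w.edges
  | _, bwd e _ w => e :: w.edges

/-- The vertices of a walk. -/
def support : {v : Fin l} → TreeWalk o t D r v → List (Fin l)
  | _, nil => [r]
  | _, fwd e _ w => t e :: w.support
  | _, bwd e _ w => o e :: w.support

end TreeWalk

/-- The choices that present `π₁(X)` as the fundamental group of a graph of groups: base points
in the pieces, arcs in the pieces from the base points to the boundary curves, and a maximal tree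
`D` of the dual graph with a base vertex `root`.  The set `D` is a maximal tree if every vertex is
reached from `root` by exactly one walk in `D` without repeated edges. -/
structure CutSurface.Marking {X : Type} [TopologicalSpace X] [ChartedSpace HypHalf X] {b m l : ℕ}
    (C : CutSurface X b m l) where
  /-- the base points of the pieces -/
  pt : Fin l → X
  pt_mem : ∀ v, pt v ∈ C.piece v
  /-- arcs to the two sides of the curve `ξ_i` -/
  armO : ∀ i, Path (pt (C.o i)) (C.level i (-1) 1)
  armO_mem : ∀ i s, armO i s ∈ C.piece (C.o i)
  armT : ∀ i, Path (pt (C.t i)) (C.level i 1 1)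
  armT_mem : ∀ i s, armT i s ∈ C.piece (C.t i)
  /-- the piece containing `ζ_j` -/
  side : Fin b → Fin l
  side_mem : ∀ j z, C.bdry j z ∈ C.piece (side j)
  /-- arcs to the boundary components -/
  armB : ∀ j, Path (pt (side j)) (C.bdry j 1)
  armB_mem : ∀ j s, armB j s ∈ C.piece (side j)
  /-- the edges of the maximal tree -/
  D : Set (Fin m)
  root : Fin l
  path : ∀ v, TreeWalk C.o C.t D root v
  path_nodup : ∀ v, (path v).edges.Nodup
  path_unique : ∀ v (w : TreeWalk C.o C.t D root v), w.edges.Nodup → w = path v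

namespace CutSurface.Marking

variable {X : Type} [TopologicalSpace X] [ChartedSpace HypHalf X] {b m l : ℕ}
  {C : CutSurface X b m l} (M : C.Marking)

/-- `Γ = π₁(X)`.  In Mathlib the product `x * y` of two loops runs through `y` first. -/
abbrev Γ : Type := FundamentalGroup X (M.pt M.root)

/-- The path which crosses `ξ_i` once, from the base point of `o i` to that of `t i`. -/
def cross (i : Fin m) : Path.Homotopic.Quotient (M.pt (C.o i)) (M.pt (C.t i)) :=
  Path.Homotopic.Quotient.mk (((M.armO i).trans (C.segment i)).trans (M.armT i).symm)

/-- The path that follows a walk in the tree. -/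
def walkPath : {v : Fin l} → TreeWalk C.o C.t M.D M.root v →
    Path.Homotopic.Quotient (M.pt M.root) (M.pt v)
  | _, .nil => Path.Homotopic.Quotient.refl _
  | _, .fwd e _ w => (walkPath w).trans (M.cross e)
  | _, .bwd e _ w => (walkPath w).trans (M.cross e).symm

/-- The path from the base point to the base point of `Σ_v` along the tree. -/
def treePath (v : Fin l) : Path.Homotopic.Quotient (M.pt M.root) (M.pt v) :=
  M.walkPath (M.path v)

/-- A loop at the base point of `Σ_v` as an element of `Γ`. -/
def conj (v : Fin l) (γ : Path.Homotopic.Quotient (M.pt v) (M.pt v)) : M.Γ :=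
  FundamentalGroup.fromPath (((M.treePath v).trans γ).trans (M.treePath v).symm)

theorem conj_trans (v : Fin l) (γ δ : Path.Homotopic.Quotient (M.pt v) (M.pt v)) :
    M.conj v (γ.trans δ) = M.conj v δ * M.conj v γ := by
  change _ = Path.Homotopic.Quotient.trans (M.conj v γ) (M.conj v δ)
  simp only [conj, Path.Homotopic.Quotient.trans_assoc]
  rw [← Path.Homotopic.Quotient.trans_assoc (M.treePath v).symm,
    Path.Homotopic.Quotient.symm_trans, Path.Homotopic.Quotient.refl_trans]

theorem conj_refl (v : Fin l) : M.conj v (Path.Homotopic.Quotient.refl _) = 1 := by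
  simp only [conj, Path.Homotopic.Quotient.trans_refl, Path.Homotopic.Quotient.trans_symm]
  rfl

/-- The vertex group `Γ_{Σ_v} ⊆ Γ`: the classes of the loops in `Σ_v`. -/
def vertexGroup (v : Fin l) : Subgroup M.Γ where
  carrier := {γ | ∃ p : Path (M.pt v) (M.pt v), (∀ s, p s ∈ C.piece v) ∧
    γ = M.conj v (Path.Homotopic.Quotient.mk p)}
  one_mem' := ⟨Path.refl _, fun _ => M.pt_mem v, by
    rw [Path.Homotopic.Quotient.mk_refl, conj_refl]⟩
  mul_mem' := by
    rintro _ _ ⟨p, hp, rfl⟩ ⟨q, hq, rfl⟩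
    refine ⟨q.trans p, fun s => ?_, by rw [Path.Homotopic.Quotient.mk_trans, conj_trans]⟩
    have h : q.trans p s ∈ Set.range (q.trans p) := ⟨s, rfl⟩
    rw [Path.trans_range] at h
    rcases h with ⟨s', h⟩ | ⟨s', h⟩
    · exact h ▸ hq s'
    · exact h ▸ hp s'
  inv_mem' := by
    rintro _ ⟨p, hp, rfl⟩
    refine ⟨p.symm, fun s => hp _, ?_⟩
    rw [inv_eq_iff_mul_eq_one, ← conj_trans, Path.Homotopic.Quotient.mk_symm,
      Path.Homotopic.Quotient.symm_trans, conj_refl]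

/-- The generator of the edge group `Γ_{ξ_i}^+`, in the vertex group of the terminal `t i`. -/
def gammaPlus (i : Fin m) : M.Γ :=
  M.conj (C.t i) (lasso (M.armT i) (circleLoop (C.level i 1)))

/-- The generator of the edge group `Γ_{ξ_i}^-`, in the vertex group of the origin `o i`. -/
def gammaMinus (i : Fin m) : M.Γ :=
  M.conj (C.o i) (lasso (M.armO i) (circleLoop (C.level i (-1))))

/-- The boundary component `ζ_j` as an element of `Γ`. -/
def zeta (j : Fin b) : M.Γ :=
  M.conj (M.side j) (lasso (M.armB j) (circleLoop (C.bdry j)))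

/-- The element `ξ_i^⊥` dual to `ξ_i`; it satisfies `ξ_i^⊥ γ⁺ (ξ_i^⊥)⁻¹ = γ⁻`. -/
def perp (i : Fin m) : M.Γ :=
  FundamentalGroup.fromPath
    (((M.treePath (C.t i)).trans (M.cross i).symm).trans (M.treePath (C.o i)).symm)

/-- The collection `𝒮 = {Γ_{ξ_1}^+, …, Γ_{ξ_m}^+, ⟨ζ_1⟩, …, ⟨ζ_b⟩}` of subgroups of `Γ`. -/
def peripheral : Set (Subgroup M.Γ) :=
  (Set.range fun i => Subgroup.zpowers (M.gammaPlus i)) ∪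
    Set.range fun j => Subgroup.zpowers (M.zeta j)

/-- The collection `𝒮_v` of the subgroups of `Γ_{Σ_v}` that are generated by the components of the
boundary of the completion of `Σ_v`. -/
def vertexPeripheral (v : Fin l) : Set (Subgroup (M.vertexGroup v)) :=
  {H | (∃ i, C.t i = v ∧ H = (Subgroup.zpowers (M.gammaPlus i)).subgroupOf (M.vertexGroup v)) ∨
    (∃ i, C.o i = v ∧ H = (Subgroup.zpowers (M.gammaMinus i)).subgroupOf (M.vertexGroup v)) ∨
    ∃ j, M.side j = v ∧ H = (Subgroup.zpowers (M.zeta j)).subgroupOf (M.vertexGroup v)}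

/-- `S(Σ_q) = {Σ_v | Σ_q ≤ Σ_v}`, where `Σ_q ≤ Σ_v` if the path in the tree from the base vertex
to `Σ_v` goes through `Σ_q`. -/
def above (q : Fin l) : Set (Fin l) := {v | q ∈ (M.path v).support}

open Classical in
/-- For an edge of the tree, its end which is farther from the base vertex. -/
def far (i : Fin m) : Fin l := if C.o i ∈ (M.path (C.t i)).support then C.t i else C.o i

open Classical in
/-- For an edge of the tree, its end which is nearer to the base vertex. -/
def near (i : Fin m) : Fin l := if C.o i ∈ (M.path (C.t i)).support then C.o i else C.t i

variable {n : ℕ}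

/-- `H⁰(Γ_{ξ_i}; 𝔤) ⊆ 𝔤`, the elements fixed by `Ad ρ(γ)` for all `γ ∈ Γ_{ξ_i}^+`. -/
abbrev edgeH0 (ρ : M.Γ →* PSLn n) (i : Fin m) : Submodule ℝ (sln n) :=
  Representation.invariants
    ((adPSL n).comp (ρ.comp (Subgroup.zpowers (M.gammaPlus i)).subtype))

open Classical in
/-- `Φ` is the algebraic bending of `ρ` by `X` along `ξ_i`.  If `ξ_i` is an edge of the tree,
`exp tX` conjugates everything beyond `ξ_i`; the element `ξ_k^⊥`, whose ends are `o k` and `t k`,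
is multiplied by `exp tX` from the left if `o k` is beyond `ξ_i`, and by `exp (-tX)` from the right
if `t k` is beyond `ξ_i`.  If `ξ_i` is not an edge of the tree, only `ξ_i^⊥` changes. -/
def IsBending (ρ : M.Γ →* PSLn n) (i : Fin m) (X : sln n) (Φ : ℝ → M.Γ →* PSLn n) : Prop :=
  if i ∈ M.D then
    ∀ s : ℝ,
      (∀ v, ∀ γ ∈ M.vertexGroup v, Φ s γ =
        if v ∈ M.above (M.far i) then expPSL (s • X) * ρ γ * expPSL (-(s • X)) else ρ γ) ∧
      ∀ k ∉ M.D, Φ s (M.perp k) =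
        (if C.o k ∈ M.above (M.far i) then expPSL (s • X) else 1) * ρ (M.perp k) *
          (if C.t k ∈ M.above (M.far i) then expPSL (-(s • X)) else 1)
  else
    ∀ s : ℝ,
      (∀ v, ∀ γ ∈ M.vertexGroup v, Φ s γ = ρ γ) ∧
      ∀ k ∉ M.D, Φ s (M.perp k) = if k = i then ρ (M.perp k) * expPSL (s • X) else ρ (M.perp k)

/-- The cocycle `α` represents the image of `(X_i)` under the Mayer–Vietoris connecting
homomorphism: the restriction of `α` to each `Γ_{Σ_v}` is the coboundary of a 0-cochain `Y_v`, and
along each curve `ξ_i` the 0-cochains of the two sides differ by `X_i`.  The edges of the tree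
are directed away from the base vertex, and the other ones from `o i` to `t i`; for the latter
the 0-cochain on the side of `o i` is brought to the side of `t i` by means of `ξ_i^⊥`. -/
def IsConnecting (ρ : M.Γ →* PSLn n) (X : ∀ i, M.edgeH0 ρ i) (α : M.Γ → sln n) : Prop :=
  ∃ Y : Fin l → sln n,
    (∀ v, ∀ γ ∈ M.vertexGroup v, α γ = adPSL n (ρ γ) (Y v) - Y v) ∧
    (∀ i ∈ M.D, (X i : sln n) = Y (M.near i) - Y (M.far i)) ∧
    ∀ i ∉ M.D, (X i : sln n) =
      adPSL n (ρ (M.perp i)⁻¹) (α (M.perp i) + Y (C.o i)) - Y (C.t i)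

end CutSurface.Marking

end

/-! The sequence is the Mayer–Vietoris sequence of the graph of groups with fundamental group Γ,
vertex groups `Γ_{Σ_v}` and cyclic edge groups. A vector X fixed by a vertex group gives elements
exp(sX) of its trivial centralizer, so X = 0 (`IsGoodRep.eq_zero_of_invariant`); the vanishing of H⁰
on the vertex groups makes δ injective. Parabolic classes die on the edge groups, so there is no
obstruction to gluing parabolic classes of the pieces; this makes ι* surjective.

Everything rests on the universal property of Γ: it is generated by the vertex groups and the ξ_i^⊥
(`closure_vertexGroup_perp`), and homomorphisms on the vertex groups that are compatible along the
curves extend to Γ (`exists_hom`). This is van Kampen's theorem in groupoid form: a group-valued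
transport, defined on the paths inside members of an open cover, extends to all homotopy classes
(`LocalTransport.exists_functor`). The cover consists of the pieces and of evenly covered sectors of
the annuli. In an annulus, transport is the increment of a function on the universal covering ℝ × ℝ
(`IsFrame.exists_primitive`).

A cocycle α is the translation part of a homomorphism into the affine group of 𝔤 with linear part Ad
ρ, so cocycles are glued by `exists_hom` as well (`exists_glued_cocycle`). If T is a 0-cochain for
γ⁺, then -T is a fixed point of the affine map of γ⁺, and ξ_i^⊥ has to carry fixed points for γ⁺ to
fixed points for γ⁻. The freedom in choosing them is H⁰(Γ_{ξ_i}; 𝔤), which is the source of δ.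

Bendings come from `exists_hom` too. Both kinds have the common form `IsTwist`; its derivative on
the generators is a glued cocycle with Y_v = -ε_v, and the Leibniz rule propagates tangency from the
generators to Γ. -/

noncomputable section

open CategoryTheory

/-! ### Gluing functors on the fundamental groupoid -/

/-- A transport along the short paths of a space, i.e. along the paths in a member of an open
cover, with values in a group; transport along `p` followed by `q` is the product of the transport
along `q` with the transport along `p`. -/
structure LocalTransport {X J : Type*} [TopologicalSpace X] (U : J → Set X)
    (H : Type*) [Group H] where
  toFun : C(unitInterval, X) → H
  map_trans : ∀ (j : J) {x y z : X} (p : Path x y) (q : Path y z), (∀ s, p s ∈ U j) →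
    (∀ s, q s ∈ U j) → toFun (p.trans q).toContinuousMap =
      toFun q.toContinuousMap * toFun p.toContinuousMap
  map_homotopic : ∀ (j : J) {x y : X} (p q : Path x y), (∀ s, p s ∈ U j) →
    (∀ s, q s ∈ U j) → p.Homotopic q → toFun p.toContinuousMap = toFun q.toContinuousMap

/-- Induction on the subintervals of a compact interval: a property of intervals holds if it holds
for the intervals inside a member of an open cover and for unions of adjacent intervals. -/
theorem Icc_induction_of_open_cover {J : Type*} {c : J → Set ℝ} (hc : ∀ j, IsOpen (c j))
    {A B : ℝ} (hcov : Set.Icc A B ⊆ ⋃ j, c j) (Q : ℝ → ℝ → Prop)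
    (small : ∀ j a b, A ≤ a → a ≤ b → b ≤ B → Set.Icc a b ⊆ c j → Q a b)
    (glue : ∀ a b d, A ≤ a → a ≤ b → b ≤ d → d ≤ B → Q a b → Q b d → Q a d) :
    ∀ a b, A ≤ a → a ≤ b → b ≤ B → Q a b := by
  obtain ⟨δ, hδ, hball⟩ := lebesgue_number_lemma_of_metric isCompact_Icc hc hcov
  have key : ∀ (k : ℕ) (a b : ℝ), A ≤ a → a ≤ b → b ≤ B → b - a ≤ (k + 1) * (δ / 2) → Q a b := by
    intro k
    induction k with
    | zero =>
      intro a b ha hab hb hk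
      obtain ⟨j, hj⟩ := hball a ⟨ha, hab.trans hb⟩
      refine small j a b ha hab hb fun t ht => hj ?_
      rw [Metric.mem_ball, Real.dist_eq, abs_lt]
      push_cast at hk
      constructor <;> linarith [ht.1, ht.2]
    | succ k ih =>
      intro a b ha hab hb hk
      push_cast at hk
      have hk0 : (0 : ℝ) ≤ k := Nat.cast_nonneg k
      have h1 : a ≤ max a (b - δ / 2) := le_max_left _ _
      have h2 : max a (b - δ / 2) ≤ b := max_le hab (by linarith)
      have h3 : b - δ / 2 ≤ max a (b - δ / 2) := le_max_right _ _
      -- The last stretch has length at most δ / 2 and fits into one member of the cover; the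
      -- maximum keeps the cut inside the interval.
      refine glue a (max a (b - δ / 2)) b ha h1 h2 hb (ih _ _ ha h1 (h2.trans hb) ?_) ?_
      · rcases max_cases a (b - δ / 2) with ⟨h, -⟩ | ⟨h, -⟩ <;> rw [h] <;> nlinarith
      · obtain ⟨j, hj⟩ := hball (max a (b - δ / 2)) ⟨ha.trans h1, h2.trans hb⟩
        refine small j _ _ (ha.trans h1) h2 hb fun t ht => hj ?_
        rw [Metric.mem_ball, Real.dist_eq, abs_lt]
        constructor <;> linarith [ht.1, ht.2]
  intro a b ha hab hb
  obtain ⟨k, hk⟩ := exists_nat_ge ((b - a) / (δ / 2))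
  refine key k a b ha hab hb ?_
  rw [div_le_iff₀ (by linarith)] at hk
  linarith

/-! ### Continuation of a local transport along a path and across a square -/

namespace LocalTransport

variable {X J : Type*} [TopologicalSpace X] {U : J → Set X} {H : Type*} [Group H]
  (T : LocalTransport U H)

section Segments

variable {E : Type*} [NormedAddCommGroup E] [NormedSpace ℝ E]

/-- The transport along the image of a segment. -/
def seg (f : C(E, X)) (p q : E) : H :=
  T.toFun (f.comp (Path.segment p q).toContinuousMap)

/-- The space `E` is simply connected, so a segment is homotopic to the broken line through a third
point. Convexity of `W` keeps both inside one member of the cover, where transport is multiplicative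
and homotopy invariant. -/
theorem seg_trans (f : C(E, X)) {W : Set E} (hW : Convex ℝ W) {j : J} (hj : Set.MapsTo f W (U j))
    {p q r : E} (hp : p ∈ W) (hq : q ∈ W) (hr : r ∈ W) :
    T.seg f p r = T.seg f q r * T.seg f p q := by
  have mem : ∀ {x y : E}, x ∈ W → y ∈ W → ∀ s, Path.segment x y s ∈ W := by
    intro x y hx hy s
    have h : Path.segment x y s ∈ Set.range (Path.segment x y) := ⟨s, rfl⟩
    rw [Path.range_segment] at h
    exact hW.segment_subset hx hy h
  have h1 := T.map_trans j ((Path.segment p q).map f.continuous)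
    ((Path.segment q r).map f.continuous) (fun s => hj (mem hp hq s)) (fun s => hj (mem hq hr s))
  refine Eq.trans ?_ h1
  refine T.map_homotopic j ((Path.segment p r).map f.continuous) _ (fun s => hj (mem hp hr s))
    (fun s => ?_) ?_
  · have h : (((Path.segment p q).map f.continuous).trans
      ((Path.segment q r).map f.continuous)) s ∈ Set.range (((Path.segment p q).map
        f.continuous).trans ((Path.segment q r).map f.continuous)) := ⟨s, rfl⟩
    rw [Path.trans_range] at h
    rcases h with ⟨s', h⟩ | ⟨s', h⟩
    · exact h ▸ hj (mem hp hq s')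
    · exact h ▸ hj (mem hq hr s')
  · rw [← Path.map_trans]
    exact (SimplyConnectedSpace.paths_homotopic _ _).map f

theorem seg_self (f : C(E, X)) {j : J} {p : E} (hp : f p ∈ U j) : T.seg f p p = 1 := by
  have h := T.seg_trans f (convex_singleton (𝕜 := ℝ) p) (j := j) (by rintro _ rfl; exact hp)
    (Set.mem_singleton p) (Set.mem_singleton p) (Set.mem_singleton p)
  simpa using h

/-- Transport sees only the path in `X`. This compares segments in different parameter spaces, such
as a row of a square and the line. -/
theorem seg_congr {E' : Type*} [NormedAddCommGroup E'] [NormedSpace ℝ E'] {f : C(E, X)}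
    {f' : C(E', X)} {p q : E} {p' q' : E'}
    (h : ∀ s : unitInterval, f (AffineMap.lineMap p q (s : ℝ)) =
      f' (AffineMap.lineMap p' q' (s : ℝ))) :
    T.seg f p q = T.seg f' p' q' :=
  congrArg T.toFun (ContinuousMap.ext h)

end Segments

/-- `g t` is a transport along `f` from some point to `t`. -/
def IsTransport (f : C(ℝ, X)) (g : ℝ → H) (a b : ℝ) : Prop :=
  ∀ t₀ ∈ Set.Icc a b, ∃ ε > 0, ∀ s ∈ Set.Icc a b, ∀ t ∈ Set.Icc a b,
    |s - t₀| < ε → |t - t₀| < ε → g t = T.seg f s t * g s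

/-- `h` is the transport along `f` from `a` to `b`. -/
def Rel (f : C(ℝ, X)) (a b : ℝ) (h : H) : Prop :=
  ∃ g : ℝ → H, T.IsTransport f g a b ∧ g a = 1 ∧ g b = h

variable {T}

/-- The quotient of two transports along the same path is locally constant, hence constant on the
interval. -/
theorem IsTransport.eq {f : C(ℝ, X)} {g g' : ℝ → H} {a b : ℝ} (hab : a ≤ b)
    (hg : T.IsTransport f g a b) (hg' : T.IsTransport f g' a b) (h : g a = g' a) :
    g b = g' b := by
  -- For the discrete topology on `H`, continuity means local constancy.
  let _ : TopologicalSpace H := ⊥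
  have _ : DiscreteTopology H := ⟨rfl⟩
  have hc : ContinuousOn (fun t => (g' t)⁻¹ * g t) (Set.Icc a b) := by
    intro t₀ ht₀
    obtain ⟨ε, hε, h1⟩ := hg t₀ ht₀
    obtain ⟨ε', hε', h2⟩ := hg' t₀ ht₀
    have hev : ∀ᶠ t in nhdsWithin t₀ (Set.Icc a b),
        (g' t)⁻¹ * g t = (g' t₀)⁻¹ * g t₀ := by
      filter_upwards [self_mem_nhdsWithin, mem_nhdsWithin_of_mem_nhds (Metric.ball_mem_nhds t₀ hε),
        mem_nhdsWithin_of_mem_nhds (Metric.ball_mem_nhds t₀ hε')] with t ht hb hb'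
      rw [Metric.mem_ball, Real.dist_eq] at hb hb'
      rw [h1 t₀ ht₀ t ht (by simpa using hε) hb, h2 t₀ ht₀ t ht (by simpa using hε') hb']
      group
    exact (continuousWithinAt_const (b := (g' t₀)⁻¹ * g t₀)).congr_of_eventuallyEq hev rfl
  have h3 := isPreconnected_Icc.constant hc (Set.left_mem_Icc.2 hab) (Set.right_mem_Icc.2 hab)
  simp only [h, inv_mul_cancel] at h3
  exact (inv_mul_eq_one.1 h3.symm).symm

theorem Rel.unique {f : C(ℝ, X)} {a b : ℝ} {h h' : H} (hab : a ≤ b) (hh : T.Rel f a b h)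
    (hh' : T.Rel f a b h') : h = h' := by
  obtain ⟨g, hg, h1, rfl⟩ := hh
  obtain ⟨g', hg', h1', rfl⟩ := hh'
  exact hg.eq hab hg' (h1.trans h1'.symm)

theorem rel_of_mapsTo {f : C(ℝ, X)} {a b : ℝ} {j : J} (hab : a ≤ b)
    (hj : Set.MapsTo f (Set.Icc a b) (U j)) : T.Rel f a b (T.seg f a b) := by
  have ha : a ∈ Set.Icc a b := Set.left_mem_Icc.2 hab
  exact ⟨fun t => T.seg f a t, fun _ _ => ⟨1, one_pos, fun s hs t ht _ _ =>
    T.seg_trans f (convex_Icc a b) hj ha hs ht⟩, T.seg_self f (hj ha), rfl⟩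

/-- The second transport, which is 1 at `b`, is multiplied by the value of the first one there. The
delicate point is `b` itself: short segments across it are compared through `b`, inside one member
of the cover. -/
theorem Rel.trans (hU : ∀ j, IsOpen (U j)) (hcov : ∀ x, ∃ j, x ∈ U j) {f : C(ℝ, X)} {a b d : ℝ}
    (hab : a ≤ b) (hbd : b ≤ d) {h k : H}
    (h1 : T.Rel f a b h) (h2 : T.Rel f b d k) : T.Rel f a d (k * h) := by
  obtain ⟨g, hg, hg1, rfl⟩ := h1
  obtain ⟨g', hg', hg1', rfl⟩ := h2
  set G : ℝ → H := fun t => if t ≤ b then g t else g' t * g b with hG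
  have Gle : ∀ t ≤ b, G t = g t := fun t ht => if_pos ht
  have Gge : ∀ t, b ≤ t → G t = g' t * g b := by
    intro t ht
    rcases ht.eq_or_lt with rfl | ht
    · rw [Gle _ le_rfl, hg1', one_mul]
    · exact if_neg (not_le.2 ht)
  refine ⟨G, ?_, by rw [Gle a hab, hg1], Gge d hbd⟩
  intro t₀ ht₀
  rcases lt_trichotomy t₀ b with hlt | rfl | hgt
  · obtain ⟨ε, hε, H1⟩ := hg t₀ ⟨ht₀.1, hlt.le⟩
    refine ⟨min ε (b - t₀), lt_min hε (by linarith), fun s hs t ht hs' ht' => ?_⟩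
    have hsb : s ≤ b := by linarith [(abs_lt.1 (lt_min_iff.1 hs').2).2]
    have htb : t ≤ b := by linarith [(abs_lt.1 (lt_min_iff.1 ht').2).2]
    rw [Gle s hsb, Gle t htb]
    exact H1 s ⟨hs.1, hsb⟩ t ⟨ht.1, htb⟩ (lt_min_iff.1 hs').1 (lt_min_iff.1 ht').1
  · obtain ⟨ε, hε, H1⟩ := hg t₀ ⟨hab, le_rfl⟩
    obtain ⟨ε', hε', H2⟩ := hg' t₀ ⟨le_rfl, hbd⟩
    obtain ⟨j, hj⟩ := hcov (f t₀)
    obtain ⟨ε'', hε'', H3⟩ := Metric.isOpen_iff.1 ((hU j).preimage f.continuous) t₀ hj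
    have ht₀' : |t₀ - t₀| = 0 := by simp
    have hball : t₀ ∈ Metric.ball t₀ ε'' := Metric.mem_ball_self hε''
    -- transport to and from the junction
    have base : ∀ t ∈ Set.Icc a d, |t - t₀| < min (min ε ε') ε'' →
        G t = T.seg f t₀ t * g t₀ := by
      intro t ht h
      simp only [lt_min_iff] at h
      rcases le_total t t₀ with hle | hle
      · rw [Gle t hle]
        exact H1 t₀ ⟨hab, le_rfl⟩ t ⟨ht.1, hle⟩ (by rw [ht₀']; exact hε) h.1.1
      · rw [Gge t hle, H2 t₀ ⟨le_rfl, hbd⟩ t ⟨hle, ht.2⟩ (by rw [ht₀']; exact hε') h.1.2, hg1',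
          mul_one]
    refine ⟨min (min ε ε') ε'', lt_min (lt_min hε hε') hε'', fun s hs t ht hs' ht' => ?_⟩
    rw [base s hs hs', base t ht ht', ← mul_assoc, ← T.seg_trans f (convex_ball t₀ ε'') (j := j) H3
      hball]
    · exact (lt_min_iff.1 hs').2
    · exact (lt_min_iff.1 ht').2
  · obtain ⟨ε, hε, H1⟩ := hg' t₀ ⟨hgt.le, ht₀.2⟩
    refine ⟨min ε (t₀ - b), lt_min hε (by linarith), fun s hs t ht hs' ht' => ?_⟩
    have hsb : b ≤ s := by linarith [(abs_lt.1 (lt_min_iff.1 hs').2).1]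
    have htb : b ≤ t := by linarith [(abs_lt.1 (lt_min_iff.1 ht').2).1]
    rw [Gge s hsb, Gge t htb, ← mul_assoc]
    exact congrArg (· * g b)
      (H1 s ⟨hsb, hs.2⟩ t ⟨htb, ht.2⟩ (lt_min_iff.1 hs').1 (lt_min_iff.1 ht').1)

theorem exists_rel (hU : ∀ j, IsOpen (U j)) (hcov : ∀ x, ∃ j, x ∈ U j) (f : C(ℝ, X)) {a b : ℝ}
    (hab : a ≤ b) : ∃ h, T.Rel f a b h := by
  refine Icc_induction_of_open_cover (fun j => (hU j).preimage f.continuous) (A := a) (B := b)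
    (fun t _ => Set.mem_iUnion.2 (hcov (f t))) (fun a b => ∃ h, T.Rel f a b h) ?_ ?_ a b le_rfl hab
    le_rfl
  · exact fun j a b _ hab _ hj => ⟨_, rel_of_mapsTo (j := j) hab hj⟩
  · rintro a b d - hab hbd - ⟨h, hh⟩ ⟨k, hk⟩
    exact ⟨_, hh.trans hU hcov hab hbd hk⟩

/-- Being a transport is a local condition, and increasing affine maps carry short segments to short
segments. This handles the two halves of a concatenation of paths. -/
theorem Rel.reparam {f f' : C(ℝ, X)} {a b k d : ℝ} (hk : 0 < k)
    (hf : ∀ t ∈ Set.Icc a b, f' t = f (k * t + d)) {h : H}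
    (hh : T.Rel f (k * a + d) (k * b + d) h) : T.Rel f' a b h := by
  obtain ⟨g, hg, hg1, rfl⟩ := hh
  have mem : ∀ t ∈ Set.Icc a b, k * t + d ∈ Set.Icc (k * a + d) (k * b + d) := fun t ht =>
    ⟨by nlinarith [ht.1], by nlinarith [ht.2]⟩
  refine ⟨fun t => g (k * t + d), fun t₀ ht₀ => ?_, hg1, rfl⟩
  obtain ⟨ε, hε, H1⟩ := hg _ (mem t₀ ht₀)
  have hlt : ∀ s : ℝ, |s - t₀| < ε / k → |k * s + d - (k * t₀ + d)| < ε := by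
    intro s hs
    rw [show k * s + d - (k * t₀ + d) = k * (s - t₀) by ring, abs_mul, abs_of_pos hk]
    rwa [lt_div_iff₀' hk] at hs
  refine ⟨ε / k, by positivity, fun s hs t ht hs' ht' => ?_⟩
  simp only
  rw [H1 _ (mem s hs) _ (mem t ht) (hlt s hs') (hlt t ht')]
  congr 1
  refine T.seg_congr fun u => ?_
  rw [hf _ ((convex_Icc a b).lineMap_mem hs ht u.2)]
  congr 1
  simp only [AffineMap.lineMap_apply_module, smul_eq_mul]
  ring

/-- Parallel rows of a map of a square, whose end points are fixed, have the same transport. -/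
theorem Rel.of_square (hU : ∀ j, IsOpen (U j)) (hcov : ∀ x, ∃ j, x ∈ U j) (f : C(ℝ × ℝ, X))
    (r : ℝ → C(ℝ, X)) (hr : ∀ s t, r s t = f (s, t)) (h0 : ∀ s, f (s, 0) = f (0, 0))
    (h1 : ∀ s, f (s, 1) = f (0, 1)) {h k : H} (hh : T.Rel (r 0) 0 1 h) (hk : T.Rel (r 1) 0 1 k) :
    h = k := by
  obtain ⟨δ, hδ, hball⟩ := lebesgue_number_lemma_of_metric
    (isCompact_Icc (a := ((0 : ℝ), (0 : ℝ))) (b := (1, 1)))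
    (fun j => (hU j).preimage f.continuous) (fun z _ => Set.mem_iUnion.2 (hcov (f z)))
  choose v hv using fun s => exists_rel (T := T) hU hcov (r s) (zero_le_one' ℝ)
  -- The sides t = 0 and t = 1 are mapped to points, and transport along a constant path is trivial.
  have hconst : ∀ t₁ ∈ ({0, 1} : Set ℝ), ∀ s s', T.seg f (s, t₁) (s', t₁) = 1 := by
    intro t₁ ht₁ s s'
    obtain ⟨j, hj⟩ := hcov (f (0, t₁))
    rw [← T.seg_self f hj]
    refine T.seg_congr fun u => ?_
    simp only [AffineMap.lineMap_apply_module, Prod.smul_mk, Prod.mk_add_mk, smul_eq_mul]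
    have e : (1 - (u : ℝ)) * t₁ + u * t₁ = t₁ := by ring
    rw [e]
    rcases ht₁ with rfl | rfl
    · rw [h0, h0 ((1 - (u : ℝ)) * 0 + u * 0)]
    · rw [h1, h1 ((1 - (u : ℝ)) * 0 + u * 0)]
  have near : ∀ s₀ ∈ Set.Icc (0 : ℝ) 1, ∀ s, |s - s₀| < δ → v s = v s₀ := by
    intro s₀ hs₀ s hs
    obtain ⟨g, hg, hg1, hg2⟩ := hv s₀
    -- Transport along row `s₀` followed by the short step across to row `s` is a transport along
    -- row `s`, because the two ways around a small rectangle agree.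
    refine (hv s).unique zero_le_one ⟨fun t => T.seg f (s₀, t) (s, t) * g t, ?_, ?_, ?_⟩
    · intro t₀ ht₀
      obtain ⟨ε, hε, H1⟩ := hg t₀ ht₀
      obtain ⟨j, hj⟩ := hball (s₀, t₀) ⟨⟨hs₀.1, ht₀.1⟩, ⟨hs₀.2, ht₀.2⟩⟩
      refine ⟨min ε δ, lt_min hε hδ, fun t ht t' ht' h3 h4 => ?_⟩
      rw [lt_min_iff] at h3 h4
      have mem : ∀ x y : ℝ, |x - s₀| < δ → |y - t₀| < δ → (x, y) ∈ Metric.ball (s₀, t₀) δ := by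
        intro x y hx hy
        rw [Metric.mem_ball, Prod.dist_eq, max_lt_iff]
        exact ⟨hx, hy⟩
      have m0 : |s₀ - s₀| < δ := by simpa using hδ
      have row : ∀ x, T.seg (r x) t t' = T.seg f (x, t) (x, t') := by
        intro x
        refine T.seg_congr fun u => ?_
        rw [hr]
        congr 1
        simp only [AffineMap.lineMap_apply_module, Prod.smul_mk, Prod.mk_add_mk, smul_eq_mul,
          Prod.mk.injEq, and_true]
        ring
      simp only
      rw [H1 t ht t' ht' h3.1 h4.1, row, row, ← mul_assoc, ← mul_assoc,
        ← T.seg_trans f (convex_ball _ δ) hj (mem _ _ m0 h3.2) (mem _ _ m0 h4.2)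
          (mem _ _ hs h4.2), ← T.seg_trans f (convex_ball _ δ) hj (mem _ _ m0 h3.2)
          (mem _ _ hs h3.2) (mem _ _ hs h4.2)]
    · simp only
      rw [hconst 0 (by simp), hg1, one_mul]
    · simp only
      rw [hconst 1 (by simp), hg2, one_mul]
  have hc : v 0 = v 1 := by
    let _ : TopologicalSpace H := ⊥
    have _ : DiscreteTopology H := ⟨rfl⟩
    refine isPreconnected_Icc.constant (s := Set.Icc (0 : ℝ) 1) ?_ (by simp) (by simp)
    intro s₀ hs₀
    refine (continuousWithinAt_const (b := v s₀)).congr_of_eventuallyEq ?_ rfl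
    filter_upwards [mem_nhdsWithin_of_mem_nhds (Metric.ball_mem_nhds s₀ hδ)] with s hs
    exact near s₀ hs₀ s hs
  rw [hh.unique zero_le_one (hv 0), hk.unique zero_le_one (hv 1), hc]

end LocalTransport

/-- A path as a map on the real line. -/
def Path.extendReal {X : Type*} [TopologicalSpace X] {x y : X} (p : Path x y) : C(ℝ, X) :=
  ⟨p.extend, p.continuous_extend⟩

theorem Path.extendReal_apply {X : Type*} [TopologicalSpace X] {x y : X} (p : Path x y)
    (s : unitInterval) : p.extendReal (s : ℝ) = p s :=
  p.extend_apply s.2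

/-- Groupoid van Kampen theorem, existence: a local transport extends to all homotopy classes of
paths. -/
theorem LocalTransport.exists_functor {X J : Type*} [TopologicalSpace X] {U : J → Set X}
    {H : Type*} [Group H] (T : LocalTransport U H) (hU : ∀ j, IsOpen (U j))
    (hcov : ∀ x, ∃ j, x ∈ U j) :
    ∃ Φ : ∀ {x y : X}, Path.Homotopic.Quotient x y → H,
      (∀ {x y z : X} (a : Path.Homotopic.Quotient x y) (b : Path.Homotopic.Quotient y z),
        Φ (a.trans b) = Φ b * Φ a) ∧
      ∀ (j : J) {x y : X} (p : Path x y), (∀ s, p s ∈ U j) →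
        Φ (Path.Homotopic.Quotient.mk p) = T.toFun p.toContinuousMap := by
  choose v hv using fun f => exists_rel (T := T) hU hcov f (zero_le_one' ℝ)
  have hom : ∀ {x y : X} (p q : Path x y), p.Homotopic q → v p.extendReal = v q.extendReal := by
    rintro x y p q ⟨K⟩
    -- The homotopy is extended to the plane by clamping both coordinates to the unit interval.
    have hcont : Continuous fun z : ℝ × ℝ => K (Set.projIcc 0 1 zero_le_one z.1,
        Set.projIcc 0 1 zero_le_one z.2) :=
      K.continuous.comp ((continuous_projIcc.comp continuous_fst).prodMk
        (continuous_projIcc.comp continuous_snd))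
    refine Rel.of_square (T := T) hU hcov ⟨_, hcont⟩
      (fun s => ⟨fun t => K (Set.projIcc 0 1 zero_le_one s, Set.projIcc 0 1 zero_le_one t),
        hcont.comp (Continuous.prodMk continuous_const continuous_id)⟩)
      (fun s t => rfl) (fun s => ?_) (fun s => ?_) (h := v p.extendReal) (k := v q.extendReal) ?_ ?_
    · simp
    · simp
    · convert hv p.extendReal using 1
      ext t
      simp [Path.extendReal, Path.extend, Set.IccExtend]
    · convert hv q.extendReal using 1
      ext t
      simp [Path.extendReal, Path.extend, Set.IccExtend]
  refine ⟨fun {x y} a => Quotient.lift (fun p : Path x y => v p.extendReal) hom a, ?_, ?_⟩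
  · intro x y z a b
    induction a, b using Path.Homotopic.Quotient.ind₂ with
    | mk p q =>
    change v (p.trans q).extendReal = v q.extendReal * v p.extendReal
    refine (hv _).unique zero_le_one (Rel.trans hU hcov (b := 1 / 2) (by norm_num) (by norm_num)
      (Rel.reparam (f := p.extendReal) (k := 2) (d := 0) two_pos ?_ ?_)
      (Rel.reparam (f := q.extendReal) (k := 2) (d := -1) two_pos ?_ ?_))
    · intro t ht
      have h1 : t ∈ Set.Icc (0 : ℝ) 1 := ⟨ht.1, by linarith [ht.2]⟩
      have h2 : 2 * t ∈ Set.Icc (0 : ℝ) 1 := ⟨by linarith [ht.1], by linarith [ht.2]⟩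
      rw [add_zero, p.extendReal_apply ⟨2 * t, h2⟩, (p.trans q).extendReal_apply ⟨t, h1⟩,
        Path.trans_apply, dif_pos ht.2]
    · norm_num
      exact hv _
    · intro t ht
      have h1 : t ∈ Set.Icc (0 : ℝ) 1 := ⟨by linarith [ht.1], ht.2⟩
      have h2 : 2 * t + -1 ∈ Set.Icc (0 : ℝ) 1 := ⟨by linarith [ht.1], by linarith [ht.2]⟩
      rw [q.extendReal_apply ⟨2 * t + -1, h2⟩, (p.trans q).extendReal_apply ⟨t, h1⟩,
        Path.trans_apply]
      split_ifs with h
      -- The midpoint belongs to both closed halves, and `Path.trans` assigns it to the first one.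
      · obtain rfl : t = 1 / 2 := le_antisymm h ht.1
        have e1 : (⟨2 * (1 / 2), (by norm_num)⟩ : unitInterval) = 1 := Subtype.ext (by norm_num)
        have e2 : (⟨2 * (1 / 2) + -1, h2⟩ : unitInterval) = 0 := Subtype.ext (by norm_num)
        rw [e2, q.source]
        exact (congrArg p e1).trans p.target
      · rfl
    · norm_num
      exact hv _
  · intro j x y p hp
    change v p.extendReal = _
    have hm : Set.MapsTo p.extendReal (Set.Icc 0 1) (U j) := fun t ht => by
      rw [p.extendReal_apply ⟨t, ht⟩]
      exact hp _
    rw [(hv _).unique zero_le_one (rel_of_mapsTo zero_le_one hm)]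
    refine congrArg T.toFun (ContinuousMap.ext fun s => ?_)
    change p.extendReal (AffineMap.lineMap 0 1 (s : ℝ)) = p s
    rw [AffineMap.lineMap_apply_module, smul_zero, zero_add, smul_eq_mul, mul_one,
        p.extendReal_apply]

/-- Induction on homotopy classes of paths: a property holds for all classes if it is compatible
with composition and holds for the paths in the members of an open cover. -/
theorem Path.Homotopic.Quotient.induction_of_open_cover {X J : Type*} [TopologicalSpace X]
    {U : J → Set X} (hU : ∀ j, IsOpen (U j)) (hcov : ∀ x, ∃ j, x ∈ U j)
    (P : ∀ x y : X, Path.Homotopic.Quotient x y → Prop)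
    (small : ∀ (j : J) {x y : X} (p : Path x y), (∀ s, p s ∈ U j) →
      P x y (Path.Homotopic.Quotient.mk p))
    (trans : ∀ {x y z : X} (a : Path.Homotopic.Quotient x y) (b : Path.Homotopic.Quotient y z),
      P x y a → P y z b → P x z (a.trans b))
    {x y : X} (a : Path.Homotopic.Quotient x y) : P x y a := by
  induction a using Path.Homotopic.Quotient.ind with
  | mk p =>
  have h := Icc_induction_of_open_cover (A := 0) (B := 1)
    (fun j => (hU j).preimage p.extendReal.continuous)
    (fun t _ => Set.mem_iUnion.2 (hcov (p.extendReal t)))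
    (fun a b => P _ _ (Path.Homotopic.Quotient.mk
      ((Path.segment a b).map p.extendReal.continuous))) ?_ ?_ 0 1 le_rfl zero_le_one le_rfl
  -- The end points of the restricted path are equal to `x` and `y` only propositionally.
  · have key : ∀ {x' y' : X} (q : Path x' y'), P x' y' (Path.Homotopic.Quotient.mk q) →
        ∀ (hx : x' = x) (hy : y' = y), (∀ s, q s = p s) →
        P x y (Path.Homotopic.Quotient.mk p) := by
      rintro x' y' q hq rfl rfl hs
      rwa [← Path.ext (funext hs)]
    refine key _ h ?_ ?_ ?_
    · simpa using p.extendReal_apply 0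
    · simpa using p.extendReal_apply 1
    · intro s
      change p.extendReal (AffineMap.lineMap 0 1 (s : ℝ)) = p s
      rw [AffineMap.lineMap_apply_module, smul_zero, zero_add, smul_eq_mul, mul_one,
        p.extendReal_apply]
  · intro j a b _ hab _ hj
    refine small j _ fun s => hj ?_
    have hs : Path.segment a b s ∈ Set.range (Path.segment a b) := ⟨s, rfl⟩
    rwa [Path.range_segment, segment_eq_Icc hab] at hs
  · intro a b d _ _ _ _ h1 h2
    have h3 := trans _ _ h1 h2
    rw [← Path.Homotopic.Quotient.mk_trans, ← Path.map_trans] at h3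
    rwa [Path.Homotopic.Quotient.eq.2
      ((SimplyConnectedSpace.paths_homotopic (Path.segment a d) _).map p.extendReal)]

/-! ### Walks in the maximal tree -/

namespace TreeWalk

variable {m l : ℕ} {o t : Fin m → Fin l} {D : Set (Fin m)} {r : Fin l}

/-- The edges of a walk are listed from its end back to the root, so stopping the walk early leaves
a suffix. -/
theorem exists_edges_suffix_of_mem_support {v : Fin l} (w : TreeWalk o t D r v) {q : Fin l}
    (hq : q ∈ w.support) : ∃ w' : TreeWalk o t D r q, w'.edges <:+ w.edges := by
  induction w with
  | nil =>
    obtain rfl : q = r := by simpa [support] using hq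
    exact ⟨nil, List.suffix_rfl⟩
  | fwd e he w ih =>
    rcases List.mem_cons.1 hq with rfl | hq
    · exact ⟨fwd e he w, List.suffix_rfl⟩
    · obtain ⟨w', hw'⟩ := ih hq
      exact ⟨w', hw'.trans (List.suffix_cons _ _)⟩
  | bwd e he w ih =>
    rcases List.mem_cons.1 hq with rfl | hq
    · exact ⟨bwd e he w, List.suffix_rfl⟩
    · obtain ⟨w', hw'⟩ := ih hq
      exact ⟨w', hw'.trans (List.suffix_cons _ _)⟩

/-- The walk is cut at a passage through `i`; the two cases are the two directions of that passage.
-/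
theorem exists_cons_suffix_of_mem_edges {v : Fin l} (w : TreeWalk o t D r v) {i : Fin m}
    (hi : i ∈ w.edges) :
    (∃ w' : TreeWalk o t D r (o i), i :: w'.edges <:+ w.edges ∧ t i ∈ w.support) ∨
      ∃ w' : TreeWalk o t D r (t i), i :: w'.edges <:+ w.edges ∧ o i ∈ w.support := by
  induction w with
  | nil => simp [edges] at hi
  | fwd e he w ih =>
    rcases List.mem_cons.1 hi with rfl | hi
    · exact Or.inl ⟨w, List.suffix_rfl, List.mem_cons_self⟩
    · rcases ih hi with ⟨w', h1, h2⟩ | ⟨w', h1, h2⟩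
      · exact Or.inl ⟨w', h1.trans (List.suffix_cons _ _), List.mem_cons_of_mem _ h2⟩
      · exact Or.inr ⟨w', h1.trans (List.suffix_cons _ _), List.mem_cons_of_mem _ h2⟩
  | bwd e he w ih =>
    rcases List.mem_cons.1 hi with rfl | hi
    · exact Or.inr ⟨w, List.suffix_rfl, List.mem_cons_self⟩
    · rcases ih hi with ⟨w', h1, h2⟩ | ⟨w', h1, h2⟩
      · exact Or.inl ⟨w', h1.trans (List.suffix_cons _ _), List.mem_cons_of_mem _ h2⟩
      · exact Or.inr ⟨w', h1.trans (List.suffix_cons _ _), List.mem_cons_of_mem _ h2⟩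

theorem mem_support_self {v : Fin l} (w : TreeWalk o t D r v) : v ∈ w.support := by
  cases w <;> simp [support]

end TreeWalk

namespace CutSurface.Marking

variable {X : Type} [TopologicalSpace X] [ChartedSpace HypHalf X] {b m l : ℕ}
  {C : CutSurface X b m l} (M : C.Marking)

theorem path_root : M.path M.root = .nil :=
  (M.path_unique _ .nil List.nodup_nil).symm

/-- A truncation of a walk without repeated edges has none either, so by uniqueness it is the tree
path of `q`. -/
theorem edges_suffix_of_mem_support {v q : Fin l} (h : q ∈ (M.path v).support) :
    (M.path q).edges <:+ (M.path v).edges := by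
  obtain ⟨w, hw⟩ := (M.path v).exists_edges_suffix_of_mem_support h
  rwa [← M.path_unique q w ((M.path_nodup v).sublist hw.sublist)]

/-- If the tree path of `o i` avoids `i`, it can be prolonged by `i`; otherwise uniqueness forces
`i` to be its last edge. -/
theorem path_fwd_or_bwd {i : Fin m} (hi : i ∈ M.D) :
    M.path (C.t i) = .fwd i hi (M.path (C.o i)) ∨ M.path (C.o i) = .bwd i hi (M.path (C.t i)) := by
  by_cases h : i ∈ (M.path (C.o i)).edges
  · right
    rcases (M.path (C.o i)).exists_cons_suffix_of_mem_edges h with ⟨w, hw, -⟩ | ⟨w, hw, -⟩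
    · have hn := (M.path_nodup (C.o i)).sublist hw.sublist
      have := M.path_unique _ w (List.nodup_cons.1 hn).2
      exact absurd (this ▸ h) (List.nodup_cons.1 hn).1
    · have hn := (M.path_nodup (C.o i)).sublist hw.sublist
      rw [← M.path_unique _ w (List.nodup_cons.1 hn).2]
      exact (M.path_unique _ (.bwd i hi w) hn).symm
  · left
    exact (M.path_unique _ (.fwd i hi (M.path (C.o i))) (List.nodup_cons.2 ⟨h, M.path_nodup _⟩)).symm

theorem near_far_cases {i : Fin m} (hi : i ∈ M.D) :
    (M.near i = C.o i ∧ M.far i = C.t i ∧ M.path (C.t i) = .fwd i hi (M.path (C.o i))) ∨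
      (M.near i = C.t i ∧ M.far i = C.o i ∧ M.path (C.o i) = .bwd i hi (M.path (C.t i))) := by
  rcases M.path_fwd_or_bwd hi with h | h
  · have : C.o i ∈ (M.path (C.t i)).support := by
      rw [h]
      exact List.mem_cons_of_mem _ (TreeWalk.mem_support_self _)
    exact Or.inl ⟨if_pos this, if_pos this, h⟩
  · have : C.o i ∉ (M.path (C.t i)).support := fun hs => by
      have hl := (M.edges_suffix_of_mem_support hs).length_le
      rw [h] at hl
      simp [TreeWalk.edges] at hl
    exact Or.inr ⟨if_neg this, if_neg this, h⟩

theorem edges_path_far {i : Fin m} (hi : i ∈ M.D) :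
    (M.path (M.far i)).edges = i :: (M.path (M.near i)).edges := by
  rcases M.near_far_cases hi with ⟨h1, h2, h⟩ | ⟨h1, h2, h⟩ <;> rw [h1, h2, h] <;> rfl

/-- Removing a tree edge separates the tree, so a tree path visits the far end exactly when it
crosses the edge. It cannot cross the edge starting from the far end, since reaching that end has
already used the edge. -/
theorem mem_above_far_iff {i : Fin m} (hi : i ∈ M.D) (v : Fin l) :
    v ∈ M.above (M.far i) ↔ i ∈ (M.path v).edges := by
  constructor
  · intro h
    refine (M.edges_suffix_of_mem_support h).subset ?_
    rw [M.edges_path_far hi]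
    exact List.mem_cons_self
  · intro h
    have key : ∀ w : TreeWalk C.o C.t M.D M.root (M.far i), ¬ i :: w.edges <:+ (M.path v).edges := by
      intro w hw
      have hn := (M.path_nodup v).sublist hw.sublist
      refine (List.nodup_cons.1 hn).1 ?_
      rw [M.path_unique _ w (List.nodup_cons.1 hn).2, M.edges_path_far hi]
      exact List.mem_cons_self
    change M.far i ∈ (M.path v).support
    rcases M.near_far_cases hi with ⟨-, h2, -⟩ | ⟨-, h2, -⟩ <;> rw [h2] at key ⊢ <;>
      rcases (M.path v).exists_cons_suffix_of_mem_edges h with ⟨w, hw, hs⟩ | ⟨w, hw, hs⟩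
    · exact hs
    · exact absurd hw (key w)
    · exact absurd hw (key w)
    · exact hs

theorem far_mem_above_far (i : Fin m) : M.far i ∈ M.above (M.far i) :=
  TreeWalk.mem_support_self _

theorem near_notMem_above_far {i : Fin m} (hi : i ∈ M.D) : M.near i ∉ M.above (M.far i) := by
  rw [M.mem_above_far_iff hi]
  have h := M.path_nodup (M.far i)
  rw [M.edges_path_far hi] at h
  exact (List.nodup_cons.1 h).1

/-- The two ends of an edge of the tree are on the same side of every other edge of the tree. -/
theorem o_mem_above_far_iff {i k : Fin m} (hi : i ∈ M.D) (hk : k ∈ M.D) (h : k ≠ i) :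
    C.o k ∈ M.above (M.far i) ↔ C.t k ∈ M.above (M.far i) := by
  have e : M.far k ∈ M.above (M.far i) ↔ M.near k ∈ M.above (M.far i) := by
    rw [M.mem_above_far_iff hi, M.mem_above_far_iff hi, M.edges_path_far hk, List.mem_cons]
    exact or_iff_right (Ne.symm h)
  rcases M.near_far_cases hk with ⟨h1, h2, -⟩ | ⟨h1, h2, -⟩ <;> rw [h1, h2] at e
  · exact e.symm
  · exact e

/-- A potential on the vertices of the tree with given differences along the edges. -/
theorem exists_potential {A : Type*} [AddCommGroup A] (x : Fin m → A) :
    ∃ Y : Fin l → A, ∀ i ∈ M.D, x i = Y (M.near i) - Y (M.far i) := by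
  -- The tree path of the far end has exactly the edge `i` more than that of the near end; the sign
  -- makes near minus far positive.
  refine ⟨fun v => -((M.path v).edges.map x).sum, fun i hi => ?_⟩
  simp only [M.edges_path_far hi, List.map_cons, List.sum_cons]
  abel

/-- The tree path of the far end is that of the near end followed by the crossing, so the loop
backtracks along itself. -/
theorem perp_eq_one {i : Fin m} (hi : i ∈ M.D) : M.perp i = 1 := by
  have key : M.treePath (C.t i) = (M.treePath (C.o i)).trans (M.cross i) ∨
      M.treePath (C.o i) = (M.treePath (C.t i)).trans (M.cross i).symm := by
    rcases M.path_fwd_or_bwd hi with h | h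
    · exact Or.inl (by simp only [treePath, h]; rfl)
    · exact Or.inr (by simp only [treePath, h]; rfl)
  change ((M.treePath (C.t i)).trans (M.cross i).symm).trans (M.treePath (C.o i)).symm =
    Path.Homotopic.Quotient.refl _
  rcases key with h | h
  · rw [h, Path.Homotopic.Quotient.trans_assoc (M.treePath (C.o i)),
      Path.Homotopic.Quotient.trans_symm, Path.Homotopic.Quotient.trans_refl,
      Path.Homotopic.Quotient.trans_symm]
  · rw [← h, Path.Homotopic.Quotient.trans_symm]

end CutSurface.Marking

/-! ### The fundamental group of a cut surface -/

/-- Folding along Re z = 0 retracts the upper half-plane onto the closed half, which is thus a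
quotient of a locally path connected space. -/
instance : LocallyPathConnectedSpace HypHalf := by
  have hr : Continuous fun z : UpperHalfPlane =>
      (⟨⟨⟨|z.re|, z.im⟩, z.im_pos⟩, abs_nonneg _⟩ : HypHalf) := by
    refine Continuous.subtype_mk (UpperHalfPlane.isEmbedding_coe.continuous_iff.2 ?_) _
    exact Complex.equivRealProdCLM.symm.continuous.comp
      (UpperHalfPlane.continuous_re.abs.prodMk UpperHalfPlane.continuous_im)
  refine (Topology.IsQuotientMap.of_inverse continuous_subtype_val hr
    fun z => ?_).locallyPathConnectedSpace
  refine Subtype.ext (UpperHalfPlane.ext ?_)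
  exact Complex.ext (abs_of_nonneg z.2) rfl

namespace CutSurface

variable {X : Type} [TopologicalSpace X] [ChartedSpace HypHalf X] {b m l : ℕ}

theorem piece_isPathConnected (C : CutSurface X b m l) (v : Fin l) :
    IsPathConnected (C.piece v) :=
  have : LocallyPathConnectedSpace X := ChartedSpace.locallyPathConnectedSpace HypHalf X
  (C.piece_open v).isConnected_iff_isPathConnected.1 (C.piece_connected v)

theorem piece_eq_of_mem (C : CutSurface X b m l) {v w : Fin l} {x : X} (hv : x ∈ C.piece v)
    (hw : x ∈ C.piece w) : v = w :=
  by_contra fun h => Set.disjoint_left.1 (C.piece_disjoint h) hv hw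

/-- The universal covering of the annulus around `ξ_i`. -/
def cover (C : CutSurface X b m l) (i : Fin m) : C(ℝ × ℝ, X) where
  toFun e := C.collar i (Circle.exp e.1, e.2)
  continuous_toFun := by fun_prop

variable (C : CutSurface X b m l) (i : Fin m)

theorem cover_eq_iff {e e' : ℝ × ℝ} :
    C.cover i e = C.cover i e' ↔ ∃ k : ℤ, e = (e'.1 + k * (2 * Real.pi), e'.2) := by
  constructor
  · intro h
    have h' := (C.collar_open i).injective h
    rw [Prod.mk.injEq, Circle.exp_eq_exp] at h'
    obtain ⟨⟨k, hk⟩, h2⟩ := h'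
    exact ⟨k, Prod.ext hk h2⟩
  · rintro ⟨k, rfl⟩
    have : Circle.exp (e'.1 + k * (2 * Real.pi)) = Circle.exp e'.1 := Circle.exp_eq_exp.2 ⟨k, rfl⟩
    simp [cover, this]

theorem cover_mem_pos {e : ℝ × ℝ} (he : 0 < e.2) : C.cover i e ∈ C.piece (C.t i) :=
  C.collar_pos i _ _ he

theorem cover_mem_neg {e : ℝ × ℝ} (he : e.2 < 0) : C.cover i e ∈ C.piece (C.o i) :=
  C.collar_neg i _ _ he

theorem cover_zero_notMem (v : Fin l) (a : ℝ) : C.cover i (a, 0) ∉ C.piece v := by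
  intro h
  have h1 : C.cover i (a, 0) ∈ (⋃ i, Set.range fun z : Circle => C.collar i (z, 0))ᶜ := by
    rw [← C.piece_union]
    exact Set.mem_iUnion.2 ⟨v, h⟩
  exact h1 (Set.mem_iUnion.2 ⟨i, _, rfl⟩)

theorem exists_mem_piece_or_cover (x : X) :
    (∃ v, x ∈ C.piece v) ∨ ∃ i a, x = C.cover i (a, 0) := by
  by_cases h : ∃ v, x ∈ C.piece v
  · exact Or.inl h
  · right
    rw [← Set.mem_iUnion, C.piece_union, Set.notMem_compl_iff, Set.mem_iUnion] at h
    obtain ⟨i, z, rfl⟩ := h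
    refine ⟨i, Complex.arg z, ?_⟩
    simp [cover]

theorem eq_of_cover_eq {i k : Fin m} {e e' : ℝ × ℝ} (h : C.cover i e = C.cover k e') : i = k :=
  by_contra fun hne => Set.disjoint_left.1 (C.collar_disjoint hne) ⟨_, rfl⟩ ⟨_, h.symm⟩

/-- A path in a piece that lifts to the universal covering of an annulus stays on one side. -/
theorem lift_side {v : Fin l} (q : C(unitInterval, ℝ × ℝ))
    (hq : ∀ s, C.cover i (q s) ∈ C.piece v) :
    (v = C.t i ∧ ∀ s, 0 < (q s).2) ∨ (v = C.o i ∧ ∀ s, (q s).2 < 0) := by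
  have hne : ∀ s, (q s).2 ≠ 0 := fun s h => by
    refine C.cover_zero_notMem i v (q s).1 ?_
    rw [← h]
    exact hq s
  have hc : Continuous fun s => (q s).2 := by fun_prop
  rcases (hne 0).lt_or_gt with h0 | h0
  · refine Or.inr ⟨C.piece_eq_of_mem (hq 0) (C.cover_mem_neg i h0), fun s => ?_⟩
    by_contra hs
    obtain ⟨s', hs'⟩ := mem_range_of_exists_le_of_exists_ge hc ⟨0, h0.le⟩ ⟨s, not_lt.1 hs⟩
    exact hne s' hs'
  · refine Or.inl ⟨C.piece_eq_of_mem (hq 0) (C.cover_mem_pos i h0), fun s => ?_⟩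
    by_contra hs
    obtain ⟨s', hs'⟩ := mem_range_of_exists_le_of_exists_ge hc ⟨s, not_lt.1 hs⟩ ⟨0, h0.le⟩
    exact hne s' hs'

/-- Two lifts of a path to the universal covering of an annulus differ by a deck translation. -/
theorem lift_unique (q q' : C(unitInterval, ℝ × ℝ)) (h : ∀ s, C.cover i (q s) = C.cover i (q' s)) :
    ∃ k : ℤ, ∀ s, q s = ((q' s).1 + k * (2 * Real.pi), (q' s).2) := by
  obtain ⟨k, hk⟩ := (C.cover_eq_iff i).1 (h 0)
  refine ⟨k, fun s => ?_⟩
  have h2 : ∀ s, (q s).2 = (q' s).2 := fun s => by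
    obtain ⟨j, hj⟩ := (C.cover_eq_iff i).1 (h s)
    rw [hj]
  have h1 : (fun s => (q s).1) = fun s => (q' s).1 + k * (2 * Real.pi) := by
    -- Both sides lift the same path in the circle and agree at time 0.
    refine Circle.isCoveringMap_exp.eq_of_comp_eq (by fun_prop) (by fun_prop) ?_ 0 (by rw [hk])
    funext s
    obtain ⟨j, hj⟩ := (C.cover_eq_iff i).1 (h s)
    exact Circle.exp_eq_exp.2 ⟨j - k, by simp only [hj]; push_cast; ring⟩
  exact Prod.ext (congrFun h1 s) (h2 s)

/-- The domain of a local inverse of the covering of the annulus. -/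
def sheet (e : OpenPartialHomeomorph ℝ Circle) : Set X :=
  C.collar i '' (e.target ×ˢ Set.univ)

theorem sheet_open (e : OpenPartialHomeomorph ℝ Circle) : IsOpen (C.sheet i e) :=
  (C.collar_open i).isOpenMap _ (e.open_target.prod isOpen_univ)

/-- The local inverse of the covering of the annulus. -/
def sheetLift (e : OpenPartialHomeomorph ℝ Circle) (x : X) : ℝ × ℝ :=
  have z := Function.invFun (C.collar i) x
  (e.symm z.1, z.2)

theorem cover_sheetLift {e : OpenPartialHomeomorph ℝ Circle} (he : ⇑Circle.exp = e) {x : X}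
    (hx : x ∈ C.sheet i e) : C.cover i (C.sheetLift i e x) = x := by
  obtain ⟨z, ⟨hz, -⟩, rfl⟩ := hx
  simp only [cover, sheetLift, ContinuousMap.coe_mk,
    Function.leftInverse_invFun (C.collar_open i).injective z]
  rw [he, e.right_inv hz]

theorem continuousOn_sheetLift (e : OpenPartialHomeomorph ℝ Circle) :
    ContinuousOn (C.sheetLift i e) (C.sheet i e) := by
  rw [sheet, (C.collar_open i).isInducing.continuousOn_image_iff]
  have h : ContinuousOn (fun z : Circle × ℝ => (e.symm z.1, z.2)) (e.target ×ˢ Set.univ) :=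
    (e.continuousOn_symm.comp continuousOn_fst fun z hz => hz.1).prodMk continuousOn_snd
  refine h.congr fun z _ => ?_
  simp only [Function.comp_apply, sheetLift,
    Function.leftInverse_invFun (C.collar_open i).injective z]

theorem exists_mem_cover (x : X) : (∃ v, x ∈ C.piece v) ∨
    ∃ (i : Fin m) (e : OpenPartialHomeomorph ℝ Circle), ⇑Circle.exp = e ∧ x ∈ C.sheet i e := by
  rcases C.exists_mem_piece_or_cover x with h | ⟨i, a, rfl⟩
  · exact Or.inl h
  · obtain ⟨e, h1, h2⟩ := isLocalHomeomorph_circleExp a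
    refine Or.inr ⟨i, e, h2, (Circle.exp a, 0), ⟨?_, trivial⟩, rfl⟩
    rw [h2]
    exact e.map_source h1

end CutSurface

theorem Path.trans_mem {X : Type*} [TopologicalSpace X] {x y z : X} {p : Path x y} {q : Path y z}
    {S : Set X} (hp : ∀ s, p s ∈ S) (hq : ∀ s, q s ∈ S) (s : unitInterval) : p.trans q s ∈ S := by
  have h : p.trans q s ∈ Set.range (p.trans q) := ⟨s, rfl⟩
  rw [Path.trans_range] at h
  rcases h with ⟨s', h⟩ | ⟨s', h⟩
  · exact h ▸ hp s'
  · exact h ▸ hq s'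

/-! ### Holonomy of arbitrary paths in Γ, relative to a frame -/

namespace CutSurface.Marking

variable {X : Type} [TopologicalSpace X] [ChartedSpace HypHalf X] {b m l : ℕ}
  {C : CutSurface X b m l} (M : C.Marking)

/-- The homotopy class of a path as an element of `Γ`, the base point being joined to the end
points of the path by the paths `τ`. -/
def hol (τ : ∀ x, Path.Homotopic.Quotient (M.pt M.root) x) {x y : X}
    (a : Path.Homotopic.Quotient x y) : M.Γ :=
  FundamentalGroup.fromPath (((τ x).trans a).trans (τ y).symm)

/-- The paths `τ` from the base point follow the tree up to the piece of their end points. -/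
structure IsFrame (τ : ∀ x, Path.Homotopic.Quotient (M.pt M.root) x) : Prop where
  base : ∀ v, τ (M.pt v) = M.treePath v
  mem : ∀ v {x y : X} (p : Path x y), (∀ s, p s ∈ C.piece v) →
    M.hol τ (Path.Homotopic.Quotient.mk p) ∈ M.vertexGroup v

section

variable (τ : ∀ x, Path.Homotopic.Quotient (M.pt M.root) x)

theorem hol_trans {x y z : X} (p : Path.Homotopic.Quotient x y)
    (q : Path.Homotopic.Quotient y z) : M.hol τ (p.trans q) = M.hol τ q * M.hol τ p := by
  change _ = Path.Homotopic.Quotient.trans (M.hol τ p) (M.hol τ q)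
  simp only [hol, Path.Homotopic.Quotient.trans_assoc]
  rw [← Path.Homotopic.Quotient.trans_assoc (τ y).symm,
    Path.Homotopic.Quotient.symm_trans, Path.Homotopic.Quotient.refl_trans]

theorem hol_refl (x : X) : M.hol τ (Path.Homotopic.Quotient.refl x) = 1 := by
  simp only [hol, Path.Homotopic.Quotient.trans_refl, Path.Homotopic.Quotient.trans_symm]
  rfl

theorem hol_symm {x y : X} (p : Path.Homotopic.Quotient x y) :
    M.hol τ p.symm = (M.hol τ p)⁻¹ := by
  rw [eq_inv_iff_mul_eq_one, ← hol_trans, Path.Homotopic.Quotient.trans_symm, hol_refl]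

theorem hol_congr {x y x' y' : X} {p : Path x y} {p' : Path x' y'} (h : ∀ s, p s = p' s) :
    M.hol τ (Path.Homotopic.Quotient.mk p) = M.hol τ (Path.Homotopic.Quotient.mk p') := by
  obtain rfl : x = x' := by simpa using h 0
  obtain rfl : y = y' := by simpa using h 1
  rw [Path.ext (funext h)]

/-- The element of `Γ` given by the image of a segment in the universal covering of an annulus. -/
def edgeHol (i : Fin m) (e e' : ℝ × ℝ) : M.Γ :=
  M.hol τ (Path.Homotopic.Quotient.mk ((Path.segment e e').map (C.cover i).continuous))

/-- The plane is simply connected, so the holonomy of a path in an annulus depends only on the end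
points of a lift. -/
theorem hol_of_lift {i : Fin m} {x y : X} {p : Path x y} (q : C(unitInterval, ℝ × ℝ))
    (h : ∀ s, C.cover i (q s) = p s) :
    M.hol τ (Path.Homotopic.Quotient.mk p) = M.edgeHol τ i (q 0) (q 1) := by
  rw [edgeHol, Path.Homotopic.Quotient.eq.2 ((SimplyConnectedSpace.paths_homotopic
    (Path.segment (q 0) (q 1)) ⟨q, rfl, rfl⟩).map (C.cover i))]
  exact (M.hol_congr τ h).symm

theorem edgeHol_trans (i : Fin m) (e e' e'' : ℝ × ℝ) :
    M.edgeHol τ i e e'' = M.edgeHol τ i e' e'' * M.edgeHol τ i e e' := by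
  simp only [edgeHol]
  rw [← hol_trans, ← Path.Homotopic.Quotient.mk_trans, ← Path.map_trans,
    Path.Homotopic.Quotient.eq.2 ((SimplyConnectedSpace.paths_homotopic
    (Path.segment e e'') _).map (C.cover i))]

theorem edgeHol_self (i : Fin m) (e : ℝ × ℝ) : M.edgeHol τ i e e = 1 := by
  exact left_eq_mul.1 (M.edgeHol_trans τ i e e e)

theorem edgeHol_inv (i : Fin m) (e e' : ℝ × ℝ) :
    (M.edgeHol τ i e e')⁻¹ = M.edgeHol τ i e' e := by
  rw [inv_eq_iff_mul_eq_one, ← edgeHol_trans, edgeHol_self]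

/-- A deck translation does not change the image of a segment in the surface. -/
theorem edgeHol_translate (i : Fin m) (e e' : ℝ × ℝ) (k : ℤ) :
    M.edgeHol τ i (e.1 + k * (2 * Real.pi), e.2) (e'.1 + k * (2 * Real.pi), e'.2) =
      M.edgeHol τ i e e' := by
  refine M.hol_congr τ fun s => (C.cover_eq_iff i).2 ⟨k, ?_⟩
  refine Prod.ext ?_ ?_
  · change (AffineMap.lineMap (e.1 + k * (2 * Real.pi), e.2) (e'.1 + k * (2 * Real.pi), e'.2)
      (s : ℝ)).1 = (AffineMap.lineMap e e' (s : ℝ)).1 + _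
    simp only [AffineMap.lineMap_apply_module, Prod.fst_add, Prod.smul_fst, smul_eq_mul]
    ring
  · change (AffineMap.lineMap (e.1 + k * (2 * Real.pi), e.2) (e'.1 + k * (2 * Real.pi), e'.2)
      (s : ℝ)).2 = (AffineMap.lineMap e e' (s : ℝ)).2
    simp only [AffineMap.lineMap_apply_module, Prod.snd_add, Prod.smul_snd, smul_eq_mul]

end

theorem exists_isFrame : ∃ τ, M.IsFrame τ := by
  have h : ∀ x, ∃ q : Path.Homotopic.Quotient (M.pt M.root) x,
      (∀ v (h : x = M.pt v), q = (M.treePath v).cast rfl h) ∧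
      ∀ v, x ∈ C.piece v → ∃ p : Path (M.pt v) x, (∀ s, p s ∈ C.piece v) ∧
        q = (M.treePath v).trans (Path.Homotopic.Quotient.mk p) := by
    intro x
    by_cases hx : ∃ v, x = M.pt v
    · obtain ⟨v, rfl⟩ := hx
      refine ⟨M.treePath v, fun w hw => ?_, fun w hw => ?_⟩
      · obtain rfl : v = w := C.piece_eq_of_mem (M.pt_mem v) (hw ▸ M.pt_mem w)
        rw [Path.Homotopic.Quotient.cast_rfl_rfl]
      · obtain rfl : v = w := C.piece_eq_of_mem (M.pt_mem v) hw
        exact ⟨Path.refl _, fun _ => M.pt_mem v, by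
          rw [Path.Homotopic.Quotient.mk_refl, Path.Homotopic.Quotient.trans_refl]⟩
    · rcases C.exists_mem_piece_or_cover x with ⟨v, hv⟩ | ⟨i, a, rfl⟩
      · obtain ⟨p, hp⟩ := (C.piece_isPathConnected v).joinedIn _ (M.pt_mem v) _ hv
        refine ⟨(M.treePath v).trans (Path.Homotopic.Quotient.mk p), fun w hw => absurd ⟨w, hw⟩ hx,
          fun w hw => ?_⟩
        obtain rfl : v = w := C.piece_eq_of_mem hv hw
        exact ⟨p, hp, rfl⟩
      -- On the curves a frame is subject to no condition, so any path will do; this one comes down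
      -- from level 1.
      · obtain ⟨p, -⟩ := (C.piece_isPathConnected (C.t i)).joinedIn _ (M.pt_mem _) _
          (C.cover_mem_pos i (e := (a, 1)) one_pos)
        exact ⟨((M.treePath _).trans (Path.Homotopic.Quotient.mk p)).trans
          (Path.Homotopic.Quotient.mk ((Path.segment (a, 1) (a, 0)).map (C.cover i).continuous)),
          fun w hw => absurd ⟨w, hw⟩ hx, fun w hw => absurd hw (C.cover_zero_notMem i w a)⟩
  choose τ h1 h2 using h
  refine ⟨τ, fun v => by rw [h1 _ v rfl, Path.Homotopic.Quotient.cast_rfl_rfl],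
    fun v x y p hp => ?_⟩
  obtain ⟨p₁, hp₁, e₁⟩ := h2 x v (by simpa using hp 0)
  obtain ⟨p₂, hp₂, e₂⟩ := h2 y v (by simpa using hp 1)
  -- The two frame paths share the tree path of `v`, and what remains of them stays in the piece.
  refine ⟨(p₁.trans p).trans p₂.symm, Path.trans_mem (Path.trans_mem hp₁ hp) (fun s => hp₂ _), ?_⟩
  have e₃ : (τ y).symm = (Path.Homotopic.Quotient.mk p₂).symm.trans (M.treePath v).symm := by
    rw [e₂]
    induction M.treePath v using Path.Homotopic.Quotient.ind with
    | mk q =>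
    rw [← Path.Homotopic.Quotient.mk_trans, ← Path.Homotopic.Quotient.mk_symm,
      ← Path.Homotopic.Quotient.mk_symm, ← Path.Homotopic.Quotient.mk_symm,
      ← Path.Homotopic.Quotient.mk_trans, Path.trans_symm]
  simp only [hol, conj, e₁, e₃, Path.Homotopic.Quotient.mk_trans, Path.Homotopic.Quotient.mk_symm,
    Path.Homotopic.Quotient.trans_assoc]

variable {M}

namespace IsFrame

variable {τ : ∀ x, Path.Homotopic.Quotient (M.pt M.root) x}

theorem hol_eq_conj (hτ : M.IsFrame τ) (v : Fin l) (p : Path.Homotopic.Quotient (M.pt v) (M.pt v)) :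
    M.hol τ p = M.conj v p := by
  rw [hol, conj, hτ.base]

theorem hol_root (hτ : M.IsFrame τ) (γ : Path.Homotopic.Quotient (M.pt M.root) (M.pt M.root)) :
    M.hol τ γ = FundamentalGroup.fromPath γ := by
  have h : M.treePath M.root = Path.Homotopic.Quotient.refl _ := by
    rw [treePath, path_root]
    rfl
  have h' : (Path.Homotopic.Quotient.refl (M.pt M.root)).symm =
      Path.Homotopic.Quotient.refl (M.pt M.root) := by
    rw [← Path.Homotopic.Quotient.mk_refl, ← Path.Homotopic.Quotient.mk_symm, Path.refl_symm]
  rw [hol, hτ.base, h, h', Path.Homotopic.Quotient.refl_trans, Path.Homotopic.Quotient.trans_refl]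

theorem hol_armO_mem (hτ : M.IsFrame τ) (i : Fin m) :
    M.hol τ (Path.Homotopic.Quotient.mk (M.armO i)) ∈ M.vertexGroup (C.o i) :=
  hτ.mem _ _ (M.armO_mem i)

theorem hol_armT_mem (hτ : M.IsFrame τ) (i : Fin m) :
    M.hol τ (Path.Homotopic.Quotient.mk (M.armT i)) ∈ M.vertexGroup (C.t i) :=
  hτ.mem _ _ (M.armT_mem i)

theorem edgeHol_mem_pos (hτ : M.IsFrame τ) {i : Fin m} {e e' : ℝ × ℝ} (he : 0 < e.2) (he' : 0 < e'.2) :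
    M.edgeHol τ i e e' ∈ M.vertexGroup (C.t i) := by
  refine hτ.mem _ _ fun s => C.cover_mem_pos i ?_
  have hc : Convex ℝ {e : ℝ × ℝ | 0 < e.2} :=
    (convex_Ioi (0 : ℝ)).linear_preimage (LinearMap.snd ℝ ℝ ℝ)
  exact hc.lineMap_mem he he' s.2

theorem edgeHol_mem_neg (hτ : M.IsFrame τ) {i : Fin m} {e e' : ℝ × ℝ} (he : e.2 < 0) (he' : e'.2 < 0) :
    M.edgeHol τ i e e' ∈ M.vertexGroup (C.o i) := by
  refine hτ.mem _ _ fun s => C.cover_mem_neg i ?_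
  have hc : Convex ℝ {e : ℝ × ℝ | e.2 < 0} :=
    (convex_Iio (0 : ℝ)).linear_preimage (LinearMap.snd ℝ ℝ ℝ)
  exact hc.lineMap_mem he he' s.2

theorem hol_level (i : Fin m) (s : ℝ) :
    M.hol τ (Path.Homotopic.Quotient.mk (circleLoop (C.level i s))) =
      M.edgeHol τ i (0, s) (2 * Real.pi, s) := by
  have h := M.hol_of_lift τ (i := i) (p := circleLoop (C.level i s))
    ⟨fun u => (2 * Real.pi * (u : ℝ), s), by fun_prop⟩ (fun u => rfl)
  simpa using h

theorem gammaPlus_eq (hτ : M.IsFrame τ) (i : Fin m) : M.gammaPlus i =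
    (M.hol τ (Path.Homotopic.Quotient.mk (M.armT i)))⁻¹ *
      M.edgeHol τ i (0, 1) (2 * Real.pi, 1) *
        M.hol τ (Path.Homotopic.Quotient.mk (M.armT i)) := by
  rw [gammaPlus, ← hτ.hol_eq_conj, lasso, Path.Homotopic.Quotient.mk_trans,
    Path.Homotopic.Quotient.mk_trans, Path.Homotopic.Quotient.mk_symm, hol_trans, hol_trans,
    hol_symm, hol_level, mul_assoc]

theorem gammaMinus_eq (hτ : M.IsFrame τ) (i : Fin m) : M.gammaMinus i =
    (M.hol τ (Path.Homotopic.Quotient.mk (M.armO i)))⁻¹ *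
      M.edgeHol τ i (0, -1) (2 * Real.pi, -1) *
        M.hol τ (Path.Homotopic.Quotient.mk (M.armO i)) := by
  rw [gammaMinus, ← hτ.hol_eq_conj, lasso, Path.Homotopic.Quotient.mk_trans,
    Path.Homotopic.Quotient.mk_trans, Path.Homotopic.Quotient.mk_symm, hol_trans, hol_trans,
    hol_symm, hol_level, mul_assoc]

theorem hol_segment (i : Fin m) :
    M.hol τ (Path.Homotopic.Quotient.mk (C.segment i)) = M.edgeHol τ i (0, -1) (0, 1) := by
  have h := M.hol_of_lift τ (i := i) (p := C.segment i)
    ⟨fun u => (0, 2 * (u : ℝ) - 1), by fun_prop⟩ (fun u => by simp [cover, segment]; rfl)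
  norm_num at h
  exact h

theorem hol_cross (hτ : M.IsFrame τ) (i : Fin m) : M.hol τ (M.cross i) = (M.perp i)⁻¹ := by
  rw [eq_comm, inv_eq_iff_eq_inv, ← hol_symm, perp, hol, hτ.base, hτ.base]

/-- The crossing of the annulus differs from ξ_i^⊥ only by the holonomies of the two arcs, which lie
in the vertex groups. -/
theorem perp_eq (hτ : M.IsFrame τ) (i : Fin m) : M.perp i =
    (M.hol τ (Path.Homotopic.Quotient.mk (M.armO i)))⁻¹ * M.edgeHol τ i (0, 1) (0, -1) *
      M.hol τ (Path.Homotopic.Quotient.mk (M.armT i)) := by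
  have h := hτ.hol_cross i
  rw [cross, Path.Homotopic.Quotient.mk_trans, Path.Homotopic.Quotient.mk_trans,
    Path.Homotopic.Quotient.mk_symm, hol_trans, hol_trans, hol_symm, hol_segment] at h
  rw [← inv_inj, ← h, ← edgeHol_inv]
  group

end IsFrame

variable (M)

/-- The rectangle [0, 2π] × [-1, 1] in the universal covering of the annulus has trivial boundary
holonomy, and its two vertical sides are exchanged by a deck translation. -/
theorem perp_mul_gammaPlus (i : Fin m) :
    M.perp i * M.gammaPlus i * (M.perp i)⁻¹ = M.gammaMinus i := by
  obtain ⟨τ, hτ⟩ := M.exists_isFrame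
  have h : M.edgeHol τ i (0, 1) (0, -1) * M.edgeHol τ i (0, 1) (2 * Real.pi, 1) *
      (M.edgeHol τ i (0, 1) (0, -1))⁻¹ = M.edgeHol τ i (0, -1) (2 * Real.pi, -1) := by
    rw [mul_inv_eq_iff_eq_mul, ← edgeHol_trans]
    have h1 := M.edgeHol_translate τ i (0, 1) (0, -1) 1
    simp only [Int.cast_one, one_mul, zero_add] at h1
    rw [← h1, ← edgeHol_trans]
  rw [hτ.perp_eq, hτ.gammaPlus_eq, hτ.gammaMinus_eq, ← h]
  group

theorem conj_lasso_mem {v : Fin l} {q : X} {a : Path (M.pt v) q} {c : Path q q}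
    (ha : ∀ s, a s ∈ C.piece v) (hc : ∀ s, c s ∈ C.piece v) :
    M.conj v (lasso a c) ∈ M.vertexGroup v :=
  ⟨_, Path.trans_mem (Path.trans_mem ha hc) (fun _ => ha _), rfl⟩

theorem gammaPlus_mem (i : Fin m) : M.gammaPlus i ∈ M.vertexGroup (C.t i) :=
  M.conj_lasso_mem (M.armT_mem i) fun _ => C.collar_pos i _ _ one_pos

theorem gammaMinus_mem (i : Fin m) : M.gammaMinus i ∈ M.vertexGroup (C.o i) :=
  M.conj_lasso_mem (M.armO_mem i) fun _ => C.collar_neg i _ _ (by norm_num)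

theorem zeta_mem (j : Fin b) : M.zeta j ∈ M.vertexGroup (M.side j) :=
  M.conj_lasso_mem (M.armB_mem j) fun _ => M.side_mem j _

/-- An open cover of the surface: the pieces and the domains of the local inverses of the coverings
of the annuli. -/
def openCover (C : CutSurface X b m l) :
    (Fin l ⊕ Fin m × {e : OpenPartialHomeomorph ℝ Circle // ⇑Circle.exp = e}) → Set X
  | .inl v => C.piece v
  | .inr (i, e) => C.sheet i e.1

theorem openCover_open (C : CutSurface X b m l) : ∀ j, IsOpen (openCover C j)
  | .inl v => C.piece_open v
  | .inr (i, e) => C.sheet_open i e.1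

theorem exists_mem_openCover (C : CutSurface X b m l) (x : X) : ∃ j, x ∈ openCover C j := by
  rcases C.exists_mem_cover x with ⟨v, hv⟩ | ⟨i, e, he, hx⟩
  · exact ⟨.inl v, hv⟩
  · exact ⟨.inr (i, ⟨e, he⟩), hx⟩

/-- A path in a sheet lifts to the universal covering of the annulus, the end points of the lift
being determined by the end points of the path. -/
theorem exists_lift {i : Fin m} {e : OpenPartialHomeomorph ℝ Circle} (he : ⇑Circle.exp = e)
    (p : C(unitInterval, X)) (hp : ∀ s, p s ∈ C.sheet i e) :
    ∃ q : C(unitInterval, ℝ × ℝ), (∀ s, C.cover i (q s) = p s) ∧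
      ∀ s, q s = C.sheetLift i e (p s) :=
  ⟨⟨fun s => C.sheetLift i e (p s),
    (C.continuousOn_sheetLift i e).comp_continuous p.continuous hp⟩,
    fun s => C.cover_sheetLift i he (hp s), fun _ => rfl⟩

/-- `Γ` is generated by the vertex groups and by the elements `ξ_i^⊥`. -/
theorem closure_vertexGroup_perp :
    Subgroup.closure ((⋃ v, (M.vertexGroup v : Set M.Γ)) ∪ M.perp '' M.Dᶜ) = ⊤ := by
  obtain ⟨τ, hτ⟩ := M.exists_isFrame
  set K := Subgroup.closure ((⋃ v, (M.vertexGroup v : Set M.Γ)) ∪ M.perp '' M.Dᶜ) with hK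
  have hV : ∀ v, M.vertexGroup v ≤ K := fun v x hx =>
    Subgroup.subset_closure (Or.inl (Set.mem_iUnion.2 ⟨v, hx⟩))
  have hP : ∀ i, M.perp i ∈ K := fun i => by
    by_cases hi : i ∈ M.D
    · rw [M.perp_eq_one hi]
      exact K.one_mem
    · exact Subgroup.subset_closure (Or.inr ⟨i, hi, rfl⟩)
  -- the points of the curves are moved into the pieces
  have hu : ∀ x, ∃ u : M.Γ, (∀ v, x ∈ C.piece v → u = 1) ∧
      ∀ i a, x = C.cover i (a, 0) → u = M.edgeHol τ i (a, 0) (a, 1) := by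
    intro x
    rcases C.exists_mem_piece_or_cover x with ⟨v, hv⟩ | ⟨i, a, rfl⟩
    · exact ⟨1, fun _ _ => rfl, fun i a h => absurd (h ▸ hv) (C.cover_zero_notMem i v a)⟩
    · refine ⟨M.edgeHol τ i (a, 0) (a, 1), fun v hv => absurd hv (C.cover_zero_notMem i v a), ?_⟩
      intro i' a' h
      obtain rfl := C.eq_of_cover_eq h
      obtain ⟨k, hk⟩ := (C.cover_eq_iff i).1 h
      obtain rfl : a = a' + k * (2 * Real.pi) := congrArg Prod.fst hk
      exact M.edgeHol_translate τ i (a', 0) (a', 1) k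
  choose u hu1 hu2 using hu
  -- All points of the annulus are compared with the reference point (0, 1). Below the curve the
  -- comparison path goes through (0, -1), and its crossing contributes the factor ξ_i^⊥.
  have hW : ∀ (i : Fin m) (e : ℝ × ℝ), ∃ κ ∈ K,
      u (C.cover i e) * M.edgeHol τ i (0, 1) e = κ := by
    intro i e
    refine ⟨_, ?_, rfl⟩
    rcases lt_trichotomy e.2 0 with h | h | h
    · rw [hu1 _ _ (C.cover_mem_neg i h), one_mul, M.edgeHol_trans τ i _ (0, -1)]
      refine mul_mem (hV _ (hτ.edgeHol_mem_neg (by norm_num) h)) ?_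
      have h1 : M.edgeHol τ i (0, 1) (0, -1) =
          M.hol τ (Path.Homotopic.Quotient.mk (M.armO i)) * M.perp i *
            (M.hol τ (Path.Homotopic.Quotient.mk (M.armT i)))⁻¹ := by
        rw [hτ.perp_eq]
        group
      rw [h1]
      exact mul_mem (mul_mem (hV _ (hτ.hol_armO_mem i)) (hP i)) (inv_mem (hV _ (hτ.hol_armT_mem i)))
    · obtain ⟨a, s⟩ := e
      obtain rfl : s = 0 := h
      rw [hu2 _ i a rfl, ← edgeHol_trans]
      exact hV _ (hτ.edgeHol_mem_pos one_pos one_pos)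
    · rw [hu1 _ _ (C.cover_mem_pos i h), one_mul]
      exact hV _ (hτ.edgeHol_mem_pos one_pos h)
  -- The correction `u` is multiplicatively compatible with composition, and it is 1 at the base
  -- point, so loops there lie in `K`.
  have key : ∀ {x y : X} (p : Path.Homotopic.Quotient x y), u y * M.hol τ p * (u x)⁻¹ ∈ K := by
    intro x y p
    refine Path.Homotopic.Quotient.induction_of_open_cover (openCover_open C)
      (exists_mem_openCover C) (fun x y p => u y * M.hol τ p * (u x)⁻¹ ∈ K) ?_ ?_ p
    · rintro (v | ⟨i, e, he⟩) x y p hp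
      · have h0 := hp 0
        have h1 := hp 1
        rw [p.source] at h0
        rw [p.target] at h1
        rw [hu1 x v h0, hu1 y v h1, one_mul, inv_one, mul_one]
        exact hV v (hτ.mem v p hp)
      · obtain ⟨q, hq, -⟩ := exists_lift he p.toContinuousMap hp
        rw [M.hol_of_lift τ q hq, M.edgeHol_trans τ i _ (0, 1), ← M.edgeHol_inv τ i (0, 1) (q 0)]
        have e0 : C.cover i (q 0) = x := (hq 0).trans p.source
        have e1 : C.cover i (q 1) = y := (hq 1).trans p.target
        obtain ⟨κ, hκ, h0⟩ := hW i (q 0)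
        obtain ⟨κ', hκ', h1⟩ := hW i (q 1)
        rw [e0] at h0
        rw [e1] at h1
        have := mul_mem hκ' (inv_mem hκ)
        rw [← h0, ← h1] at this
        convert this using 1
        group
    · intro x y z p q hp hq
      rw [hol_trans]
      convert mul_mem hq hp using 1
      group
  rw [eq_top_iff]
  intro γ _
  have h := key (x := M.pt M.root) (y := M.pt M.root) γ
  rw [hu1 _ _ (M.pt_mem _), hτ.hol_root, one_mul, inv_one, mul_one] at h
  exact h

end CutSurface.Marking

/-! ### The universal property of Γ -/

namespace CutSurface.Marking

variable {X : Type} [TopologicalSpace X] [ChartedSpace HypHalf X] {b m l : ℕ}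
  {C : CutSurface X b m l} {M : C.Marking}

/-- Given homomorphisms `f v` on the vertex groups that are compatible along the curves, the
annuli carry a function whose increments extend the homomorphisms. -/
theorem IsFrame.exists_primitive {τ : ∀ x, Path.Homotopic.Quotient (M.pt M.root) x}
    (hτ : M.IsFrame τ) {H : Type*} [Group H] (f : Fin l → M.Γ → H)
    (f_mul : ∀ v, ∀ x ∈ M.vertexGroup v, ∀ y ∈ M.vertexGroup v, f v (x * y) = f v x * f v y)
    (f_inv : ∀ v, ∀ x ∈ M.vertexGroup v, f v x⁻¹ = (f v x)⁻¹) (i : Fin m) (h : H)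
    (compat : h * f (C.t i) (M.gammaPlus i) * h⁻¹ = f (C.o i) (M.gammaMinus i)) :
    ∃ W : ℝ × ℝ → H,
      (∀ e e' : ℝ × ℝ, 0 < e.2 → 0 < e'.2 →
        W e' * (W e)⁻¹ = f (C.t i) (M.edgeHol τ i e e')) ∧
      (∀ e e' : ℝ × ℝ, e.2 < 0 → e'.2 < 0 →
        W e' * (W e)⁻¹ = f (C.o i) (M.edgeHol τ i e e')) ∧
      (∀ (e e' : ℝ × ℝ) (k : ℤ), W (e'.1 + k * (2 * Real.pi), e'.2) *
        (W (e.1 + k * (2 * Real.pi), e.2))⁻¹ = W e' * (W e)⁻¹) ∧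
      W (0, 1) * (W (0, -1))⁻¹ = f (C.t i) (M.hol τ (Path.Homotopic.Quotient.mk (M.armT i))) *
        h⁻¹ * (f (C.o i) (M.hol τ (Path.Homotopic.Quotient.mk (M.armO i))))⁻¹ := by
  set aT := M.hol τ (Path.Homotopic.Quotient.mk (M.armT i)) with haT
  set aO := M.hol τ (Path.Homotopic.Quotient.mk (M.armO i)) with haO
  have mT : aT ∈ M.vertexGroup (C.t i) := hτ.hol_armT_mem i
  have mO : aO ∈ M.vertexGroup (C.o i) := hτ.hol_armO_mem i
  have m1 : ∀ {e e' : ℝ × ℝ}, 0 < e.2 → 0 < e'.2 →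
    M.edgeHol τ i e e' ∈ M.vertexGroup (C.t i) := hτ.edgeHol_mem_pos
  have m0 : ∀ {e e' : ℝ × ℝ}, e.2 < 0 → e'.2 < 0 →
    M.edgeHol τ i e e' ∈ M.vertexGroup (C.o i) := hτ.edgeHol_mem_neg
  have p1 : (0 : ℝ) < ((0 : ℝ), (1 : ℝ)).2 := one_pos
  have p0 : ((0 : ℝ), (-1 : ℝ)).2 < (0 : ℝ) := by norm_num
  have f_one : ∀ v, f v 1 = 1 := fun v => by
    have := f_mul v 1 (one_mem _) 1 (one_mem _)
    rw [mul_one] at this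
    exact left_eq_mul.1 this
  -- The intended image of the crossing from (0, 1) to (0, -1), which by `perp_eq` is ξ_i^⊥ framed
  -- by the two arcs.
  set w : H := f (C.o i) aO * h * (f (C.t i) aT)⁻¹ with hw
  set g : H := f (C.t i) (M.edgeHol τ i (0, 1) (2 * Real.pi, 1)) with hg
  have p2 : (0 : ℝ) < ((2 * Real.pi : ℝ), (1 : ℝ)).2 := one_pos
  have p3 : ((2 * Real.pi : ℝ), (-1 : ℝ)).2 < (0 : ℝ) := by norm_num
  -- This is `compat` freed from the arcs: the monodromies on the two sides of the curve are
  -- conjugate by `w`.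
  have hwg : f (C.o i) (M.edgeHol τ i (0, -1) (2 * Real.pi, -1)) * w = w * g := by
    rw [hτ.gammaPlus_eq, hτ.gammaMinus_eq, ← haT, ← haO,
      f_mul _ _ (mul_mem (inv_mem mT) (m1 p1 p2)) _ mT, f_mul _ _ (inv_mem mT) _ (m1 p1 p2),
      f_mul _ _ (mul_mem (inv_mem mO) (m0 p0 p3)) _ mO, f_mul _ _ (inv_mem mO) _ (m0 p0 p3),
      f_inv _ _ mT, f_inv _ _ mO] at compat
    rw [← hg] at compat
    rw [hw]
    calc _ = f (C.o i) aO * ((f (C.o i) aO)⁻¹ *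
            f (C.o i) (M.edgeHol τ i (0, -1) (2 * Real.pi, -1)) * f (C.o i) aO) * h *
            (f (C.t i) aT)⁻¹ := by group
      _ = _ := by rw [← compat]; group
  -- On the curve itself the value need only acquire the factor `g` under translation by 2π; it is
  -- borrowed from level 1.
  set W : ℝ × ℝ → H := fun e => if 0 < e.2 then f (C.t i) (M.edgeHol τ i (0, 1) e) else
    if e.2 < 0 then f (C.o i) (M.edgeHol τ i (0, -1) e) * w else
      f (C.t i) (M.edgeHol τ i (0, 1) (e.1, 1)) with hW
  have Wpos : ∀ e : ℝ × ℝ, 0 < e.2 → W e = f (C.t i) (M.edgeHol τ i (0, 1) e) :=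
    fun e he => if_pos he
  have Wneg : ∀ e : ℝ × ℝ, e.2 < 0 → W e = f (C.o i) (M.edgeHol τ i (0, -1) e) * w :=
    fun e he => by simp only [hW]; rw [if_neg he.le.not_gt, if_pos he]
  have Wzero : ∀ a : ℝ, W (a, 0) = f (C.t i) (M.edgeHol τ i (0, 1) (a, 1)) :=
    fun a => by simp only [hW]; rw [if_neg (lt_irrefl _), if_neg (lt_irrefl _)]
  have shift : ∀ (s : ℝ) (e : ℝ × ℝ), M.edgeHol τ i (0, s) (e.1 + 2 * Real.pi, e.2) =
      M.edgeHol τ i (0, s) e * M.edgeHol τ i (0, s) (2 * Real.pi, s) := by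
    intro s e
    have h1 := M.edgeHol_translate τ i (0, s) e 1
    simp only [Int.cast_one, one_mul, zero_add] at h1
    rw [M.edgeHol_trans τ i _ (2 * Real.pi, s), h1]
  -- Translation multiplies `W` by `g` from the right, which cancels in the increments `W e' * (W
  -- e)⁻¹`.
  have Wshift : ∀ e : ℝ × ℝ, W (e.1 + 2 * Real.pi, e.2) = W e * g := by
    intro e
    rcases lt_trichotomy e.2 0 with h' | h' | h'
    · rw [Wneg _ h', Wneg (e.1 + 2 * Real.pi, e.2) h', shift, f_mul _ _ (m0 p0 h') _ (m0 p0 p3),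
        mul_assoc _ _ w, hwg, ← mul_assoc]
    · obtain ⟨a, s⟩ := e
      obtain rfl : s = 0 := h'
      have h1 := shift 1 (a, 1)
      simp only at h1 ⊢
      rw [Wzero, Wzero, h1, f_mul _ _ (m1 p1 one_pos) _ (m1 p1 p2)]
    · rw [Wpos _ h', Wpos (e.1 + 2 * Real.pi, e.2) h', shift, f_mul _ _ (m1 p1 h') _ (m1 p1 p2)]
  have Wper : ∀ (k : ℤ) (e : ℝ × ℝ), W (e.1 + k * (2 * Real.pi), e.2) = W e * g ^ k := by
    intro k e
    induction k with
    | zero => simp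
    | succ k ih =>
      have h1 := Wshift (e.1 + (k : ℤ) * (2 * Real.pi), e.2)
      simp only at h1
      rw [ih, mul_assoc, ← zpow_add_one] at h1
      rw [← h1]
      push_cast
      congr 2
      ring
    | pred k ih =>
      have h1 := Wshift (e.1 + ((-(k : ℤ) - 1 : ℤ) : ℝ) * (2 * Real.pi), e.2)
      simp only at h1
      rw [show e.1 + ((-(k : ℤ) - 1 : ℤ) : ℝ) * (2 * Real.pi) + 2 * Real.pi =
        e.1 + ((-(k : ℤ) : ℤ) : ℝ) * (2 * Real.pi) by push_cast; ring, ih] at h1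
      rw [← mul_inv_eq_iff_eq_mul] at h1
      rw [← h1, zpow_sub_one, mul_assoc]
  refine ⟨W, fun e e' he he' => ?_, fun e e' he he' => ?_, fun e e' k => ?_, ?_⟩
  · rw [Wpos e he, Wpos e' he', M.edgeHol_trans τ i (0, 1) e e', f_mul _ _ (m1 he he') _ (m1 p1 he)]
    group
  · rw [Wneg e he, Wneg e' he', M.edgeHol_trans τ i (0, -1) e e',
      f_mul _ _ (m0 he he') _ (m0 p0 he)]
    group
  · rw [Wper, Wper]
    group
  · rw [Wpos _ p1, Wneg _ p0, edgeHol_self, edgeHol_self, f_one, f_one, hw]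
    group

variable (M)

/-- `Γ` is the fundamental group of a graph of groups: compatible homomorphisms on the vertex
groups, with given values on the elements `ξ_i^⊥`, extend to `Γ`. -/
theorem exists_hom {H : Type*} [Group H] (φ : ∀ v, M.vertexGroup v →* H) (h : Fin m → H)
    (hD : ∀ i ∈ M.D, h i = 1)
    (compat : ∀ i, h i * φ (C.t i) ⟨M.gammaPlus i, M.gammaPlus_mem i⟩ * (h i)⁻¹ =
      φ (C.o i) ⟨M.gammaMinus i, M.gammaMinus_mem i⟩) :
    ∃ Φ : M.Γ →* H, (∀ v (γ : M.vertexGroup v), Φ γ = φ v γ) ∧ ∀ i, Φ (M.perp i) = h i := by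
  classical
  obtain ⟨τ, hτ⟩ := M.exists_isFrame
  set f : Fin l → M.Γ → H := fun v γ => if hγ : γ ∈ M.vertexGroup v then φ v ⟨γ, hγ⟩ else 1
  have f_eq : ∀ v γ (hγ : γ ∈ M.vertexGroup v), f v γ = φ v ⟨γ, hγ⟩ := fun v γ hγ => dif_pos hγ
  have f_mul : ∀ v, ∀ x ∈ M.vertexGroup v, ∀ y ∈ M.vertexGroup v, f v (x * y) = f v x * f v y := by
    intro v x hx y hy
    rw [f_eq v x hx, f_eq v y hy, f_eq v _ (mul_mem hx hy), ← map_mul]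
    rfl
  have f_inv : ∀ v, ∀ x ∈ M.vertexGroup v, f v x⁻¹ = (f v x)⁻¹ := by
    intro v x hx
    rw [f_eq v x hx, f_eq v _ (inv_mem hx), ← map_inv]
    rfl
  choose W W_pos W_neg W_per W_cross using fun i => hτ.exists_primitive f f_mul f_inv i (h i) (by
    rw [f_eq _ _ (M.gammaPlus_mem i), f_eq _ _ (M.gammaMinus_mem i), compat])
  -- the transport along a path in a piece or in an annulus
  set F : C(unitInterval, X) → H → Prop := fun p y =>
    (∃ v, (∀ s, p s ∈ C.piece v) ∧
      y = f v (M.hol τ (Path.Homotopic.Quotient.mk ⟨p, rfl, rfl⟩))) ∨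
    ∃ i, ∃ q : C(unitInterval, ℝ × ℝ), (∀ s, C.cover i (q s) = p s) ∧
      y = W i (q 1) * (W i (q 0))⁻¹ with hF
  -- A path in a piece that lifts to an annulus stays on one side of the curve, where the increments
  -- of `W` are values of `f`.
  have mixed : ∀ (p : C(unitInterval, X)) v (i) (q : C(unitInterval, ℝ × ℝ)),
      (∀ s, p s ∈ C.piece v) → (∀ s, C.cover i (q s) = p s) →
      f v (M.hol τ (Path.Homotopic.Quotient.mk ⟨p, rfl, rfl⟩)) = W i (q 1) * (W i (q 0))⁻¹ := by
    intro p v i q hp hq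
    rw [M.hol_of_lift τ q hq]
    rcases C.lift_side i q (fun s => (hq s).symm ▸ hp s) with ⟨rfl, hs⟩ | ⟨rfl, hs⟩
    · exact (W_pos i _ _ (hs 0) (hs 1)).symm
    · exact (W_neg i _ _ (hs 0) (hs 1)).symm
  have F_unique : ∀ p y y', F p y → F p y' → y = y' := by
    rintro p y y' (⟨v, hp, rfl⟩ | ⟨i, q, hq, rfl⟩) (⟨v', hp', rfl⟩ | ⟨i', q', hq', rfl⟩)
    · rw [C.piece_eq_of_mem (hp 0) (hp' 0)]
    · exact mixed p v i' q' hp hq'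
    · exact (mixed p v' i q hp' hq).symm
    · obtain rfl := C.eq_of_cover_eq ((hq 0).trans (hq' 0).symm)
      obtain ⟨k, hk⟩ := C.lift_unique i q q' fun s => (hq s).trans (hq' s).symm
      rw [hk 0, hk 1, W_per]
  set T : C(unitInterval, X) → H := fun p => if hp : ∃ y, F p y then hp.choose else 1 with hT
  have T_eq : ∀ p y, F p y → T p = y := fun p y hy => by
    have hp : ∃ y, F p y := ⟨y, hy⟩
    rw [hT]
    simp only
    rw [dif_pos hp]
    exact F_unique _ _ _ hp.choose_spec hy
  have T_piece : ∀ v {x y : X} (p : Path x y), (∀ s, p s ∈ C.piece v) →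
      T p.toContinuousMap = f v (M.hol τ (Path.Homotopic.Quotient.mk p)) := by
    intro v x y p hp
    rw [T_eq _ _ (Or.inl ⟨v, hp, rfl⟩)]
    exact congrArg (f v) (M.hol_congr τ fun s => rfl)
  -- In a sheet, transport depends on the end points only, hence is multiplicative and homotopy
  -- invariant.
  have T_sheet : ∀ i (e : OpenPartialHomeomorph ℝ Circle), ⇑Circle.exp = e → ∀ {x y : X}
      (p : Path x y), (∀ s, p s ∈ C.sheet i e) →
      T p.toContinuousMap = W i (C.sheetLift i e y) * (W i (C.sheetLift i e x))⁻¹ := by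
    intro i e he x y p hp
    obtain ⟨q, hq, hq'⟩ := exists_lift he p.toContinuousMap hp
    rw [T_eq _ _ (Or.inr ⟨i, q, hq, rfl⟩), hq', hq']
    have h0 : p.toContinuousMap 0 = x := p.source
    have h1 : p.toContinuousMap 1 = y := p.target
    rw [h0, h1]
  obtain ⟨Ψ, Ψ_trans, Ψ_small⟩ := LocalTransport.exists_functor (U := openCover C) (H := H)
    { toFun := T
      map_trans := by
        rintro (v | ⟨i, e, he⟩) x y z p q hp hq
        · rw [T_piece v p hp, T_piece v q hq, T_piece v _ (Path.trans_mem hp hq),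
            Path.Homotopic.Quotient.mk_trans, hol_trans, f_mul _ _ (hτ.mem v q hq) _
            (hτ.mem v p hp)]
        · rw [T_sheet i e he p hp, T_sheet i e he q hq, T_sheet i e he _ (Path.trans_mem hp hq)]
          group
      map_homotopic := by
        rintro (v | ⟨i, e, he⟩) x y p q hp hq hpq
        · rw [T_piece v p hp, T_piece v q hq, Path.Homotopic.Quotient.eq.2 hpq]
        · rw [T_sheet i e he p hp, T_sheet i e he q hq] }
    (openCover_open C) (exists_mem_openCover C)
  have Ψ_refl : ∀ x, Ψ (Path.Homotopic.Quotient.refl x) = 1 := fun x => by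
    have := Ψ_trans (Path.Homotopic.Quotient.refl x) (Path.Homotopic.Quotient.refl x)
    rw [Path.Homotopic.Quotient.trans_refl] at this
    exact left_eq_mul.1 this
  have Ψ_symm : ∀ {x y : X} (a : Path.Homotopic.Quotient x y), Ψ a.symm = (Ψ a)⁻¹ := by
    intro x y a
    rw [eq_inv_iff_mul_eq_one, ← Ψ_trans, Path.Homotopic.Quotient.trans_symm, Ψ_refl]
  have Ψ_piece : ∀ v {x y : X} (p : Path x y), (∀ s, p s ∈ C.piece v) →
      Ψ (Path.Homotopic.Quotient.mk p) = f v (M.hol τ (Path.Homotopic.Quotient.mk p)) :=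
    fun v x y p hp => (Ψ_small (.inl v) p hp).trans (T_piece v p hp)
  have Ψ_segment : ∀ i, Ψ (Path.Homotopic.Quotient.mk (C.segment i)) =
      W i (0, 1) * (W i (0, -1))⁻¹ := by
    intro i
    obtain ⟨e, h1, he⟩ := isLocalHomeomorph_circleExp 0
    have hseg : ∀ s, C.segment i s ∈ C.sheet i e := fun s =>
      ⟨(1, 2 * (s : ℝ) - 1), ⟨by
        rw [← Circle.exp_zero, he]
        exact e.map_source h1, trivial⟩, rfl⟩
    rw [Ψ_small (.inr (i, ⟨e, he⟩)) (C.segment i) hseg]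
    refine T_eq _ _ (Or.inr ⟨i, ⟨fun u => (0, 2 * (u : ℝ) - 1), by fun_prop⟩, fun u => ?_, ?_⟩)
    · simp [cover, segment]
    · norm_num
  have Ψ_cross : ∀ i, Ψ (M.cross i) = (h i)⁻¹ := by
    intro i
    rw [cross, Path.Homotopic.Quotient.mk_trans, Path.Homotopic.Quotient.mk_trans,
      Path.Homotopic.Quotient.mk_symm, Ψ_trans, Ψ_trans, Ψ_symm, Ψ_segment,
      Ψ_piece _ _ (M.armO_mem i), Ψ_piece _ _ (M.armT_mem i), W_cross]
    group
  -- Since `h` is 1 on the tree, tree paths have trivial transport, and conjugation by them has no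
  -- effect on values.
  have Ψ_walk : ∀ {v} (w : TreeWalk C.o C.t M.D M.root v), Ψ (M.walkPath w) = 1 := by
    intro v w
    induction w with
    | nil => exact Ψ_refl _
    | fwd e he w ih => rw [walkPath, Ψ_trans, ih, Ψ_cross, hD e he, inv_one, mul_one]
    | bwd e he w ih => rw [walkPath, Ψ_trans, ih, Ψ_symm, Ψ_cross, hD e he, inv_one, inv_one,
        mul_one]
  refine ⟨MonoidHom.mk' (fun γ : M.Γ => Ψ (FundamentalGroup.toPath γ)) fun x y =>
    Ψ_trans (FundamentalGroup.toPath y) (FundamentalGroup.toPath x), ?_, fun i => ?_⟩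
  · rintro v ⟨_, p, hp, rfl⟩
    change Ψ (((M.treePath v).trans (Path.Homotopic.Quotient.mk p)).trans (M.treePath v).symm) = _
    rw [Ψ_trans, Ψ_trans, Ψ_symm, treePath, Ψ_walk, inv_one, one_mul, mul_one, Ψ_piece v p hp,
      hτ.hol_eq_conj, f_eq _ _ ⟨p, hp, rfl⟩]
  · change Ψ (((M.treePath (C.t i)).trans (M.cross i).symm).trans (M.treePath (C.o i)).symm) = _
    rw [Ψ_trans, Ψ_trans, Ψ_symm, Ψ_symm, treePath, treePath, Ψ_walk, Ψ_walk, Ψ_cross, inv_inv,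
      inv_one, one_mul, mul_one]

/-- Homomorphisms on `Γ` are determined by their values on the vertex groups and on the elements
`ξ_i^⊥`. -/
theorem hom_ext {H : Type*} [Group H] {Φ Φ' : M.Γ →* H}
    (hV : ∀ v, ∀ γ ∈ M.vertexGroup v, Φ γ = Φ' γ) (hP : ∀ i ∉ M.D, Φ (M.perp i) = Φ' (M.perp i)) :
    Φ = Φ' := by
  refine MonoidHom.eq_of_eqOn_dense M.closure_vertexGroup_perp ?_
  rintro γ (hγ | ⟨i, hi, rfl⟩)
  · obtain ⟨v, hv⟩ := Set.mem_iUnion.1 hγ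
    exact hV v γ hv
  · exact hP i hi

end CutSurface.Marking

/-! ### The exponential map and tangent vectors of `PSL_n(ℝ)` -/

section Matrices

variable {n : ℕ}

theorem hasDerivAt_matrix_congr {A : ℝ → Matrix (Fin n) (Fin n) ℝ}
    {A' A'' : Matrix (Fin n) (Fin n) ℝ} {t : ℝ} (hA : HasDerivAt A A' t) (h : A'' = A') :
    HasDerivAt A A'' t :=
  h ▸ hA

/-- Derivatives are taken with respect to the topology of the matrix space; a compatible algebra
norm is chosen only inside the proof, to have the product rule. -/
theorem hasDerivAt_matrix_mul {A B : ℝ → Matrix (Fin n) (Fin n) ℝ}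
    {A' B' : Matrix (Fin n) (Fin n) ℝ} {t : ℝ} (hA : HasDerivAt A A' t) (hB : HasDerivAt B B' t) :
    HasDerivAt (fun s => A s * B s) (A' * B t + A t * B') t := by
  let _ : NormedRing (Matrix (Fin n) (Fin n) ℝ) := Matrix.linftyOpNormedRing
  let _ : NormedAlgebra ℝ (Matrix (Fin n) (Fin n) ℝ) := Matrix.linftyOpNormedAlgebra
  exact HasDerivAt.fun_mul hA hB

theorem hasDerivAt_matrix_const (A : Matrix (Fin n) (Fin n) ℝ) :
    HasDerivAt (fun _ : ℝ => A) 0 0 := by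
  let _ : NormedRing (Matrix (Fin n) (Fin n) ℝ) := Matrix.linftyOpNormedRing
  let _ : NormedAlgebra ℝ (Matrix (Fin n) (Fin n) ℝ) := Matrix.linftyOpNormedAlgebra
  exact hasDerivAt_const (0 : ℝ) A

theorem hasDerivAt_matrix_exp (X : Matrix (Fin n) (Fin n) ℝ) :
    HasDerivAt (fun t : ℝ => NormedSpace.exp (t • X)) X 0 := by
  let _ : NormedRing (Matrix (Fin n) (Fin n) ℝ) := Matrix.linftyOpNormedRing
  let _ : NormedAlgebra ℝ (Matrix (Fin n) (Fin n) ℝ) := Matrix.linftyOpNormedAlgebra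
  have h : HasDerivAt (fun t : ℝ => NormedSpace.exp (t • X))
      (NormedSpace.exp ((0 : ℝ) • X) * X) 0 := hasDerivAt_exp_smul_const X 0
  rwa [zero_smul, NormedSpace.exp_zero, one_mul] at h

theorem hasDerivAt_specialLinear_inv {A : ℝ → Matrix.SpecialLinearGroup (Fin n) ℝ} (h0 : A 0 = 1)
    {A' : Matrix (Fin n) (Fin n) ℝ}
    (hA : HasDerivAt (fun t => (A t : Matrix (Fin n) (Fin n) ℝ)) A' 0) :
    HasDerivAt (fun t => ((A t)⁻¹ : Matrix.SpecialLinearGroup (Fin n) ℝ).1) (-A') 0 := by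
  let _ : NormedRing (Matrix (Fin n) (Fin n) ℝ) := Matrix.linftyOpNormedRing
  let _ : NormedAlgebra ℝ (Matrix (Fin n) (Fin n) ℝ) := Matrix.linftyOpNormedAlgebra
  have _ : CompleteSpace (Matrix (Fin n) (Fin n) ℝ) := FiniteDimensional.complete ℝ _
  have h1 : HasFDerivAt Ring.inverse (-ContinuousLinearMap.mulLeftRight ℝ
      (Matrix (Fin n) (Fin n) ℝ) ((1 : (Matrix (Fin n) (Fin n) ℝ)ˣ)⁻¹ : (Matrix _ _ ℝ)ˣ)
      ((1 : (Matrix (Fin n) (Fin n) ℝ)ˣ)⁻¹ : (Matrix _ _ ℝ)ˣ))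
      ((A 0 : Matrix (Fin n) (Fin n) ℝ)) := by
    rw [h0]
    exact hasFDerivAt_ringInverse (𝕜 := ℝ) (1 : (Matrix (Fin n) (Fin n) ℝ)ˣ)
  have h2 := h1.comp_hasDerivAt 0 hA
  have e : (fun t => ((A t)⁻¹ : Matrix.SpecialLinearGroup (Fin n) ℝ).1) =
      Ring.inverse ∘ fun t => (A t : Matrix (Fin n) (Fin n) ℝ) := by
    funext t
    rw [Function.comp_apply, ← Matrix.nonsing_inv_eq_ringInverse, Matrix.inv_def, (A t).2,
      Ring.inverse_one, one_smul]
    exact Matrix.SpecialLinearGroup.coe_inv _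
  have e' : (-ContinuousLinearMap.mulLeftRight ℝ
      (Matrix (Fin n) (Fin n) ℝ) ((1 : (Matrix (Fin n) (Fin n) ℝ)ˣ)⁻¹ : (Matrix _ _ ℝ)ˣ)
      ((1 : (Matrix (Fin n) (Fin n) ℝ)ˣ)⁻¹ : (Matrix _ _ ℝ)ˣ)) A' = -A' := by simp
  rw [e'] at h2
  rw [e]
  exact h2

theorem toPSL_surjective (n : ℕ) : Function.Surjective (toPSL n) :=
  QuotientGroup.mk'_surjective _

/-- The exponential map `𝔰𝔩_n(ℝ) → SL_n(ℝ)`. -/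
def expSL (X : sln n) : Matrix.SpecialLinearGroup (Fin n) ℝ :=
  ⟨NormedSpace.exp X.1, det_exp_of_trace_eq_zero X.1 X.2⟩

theorem expPSL_eq (X : sln n) : expPSL X = toPSL n (expSL X) :=
  rfl

theorem expSL_zero : expSL (0 : sln n) = 1 :=
  Subtype.ext NormedSpace.exp_zero

theorem adPSL_toPSL (A : Matrix.SpecialLinearGroup (Fin n) ℝ) (X : sln n) :
    (adPSL n (toPSL n A) X).1 = (A : Matrix (Fin n) (Fin n) ℝ) * X.1 *
      ((A⁻¹ : Matrix.SpecialLinearGroup (Fin n) ℝ) : Matrix (Fin n) (Fin n) ℝ) :=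
  rfl

theorem adPSL_mul_apply (g h : PSLn n) (X : sln n) :
    adPSL n (g * h) X = adPSL n g (adPSL n h X) := by
  rw [map_mul, Module.End.mul_apply]

theorem adPSL_one_apply (X : sln n) : adPSL n 1 X = X := by
  rw [map_one, Module.End.one_apply]

theorem adPSL_inv_apply (g : PSLn n) (X : sln n) : adPSL n g⁻¹ (adPSL n g X) = X := by
  rw [← adPSL_mul_apply, inv_mul_cancel, adPSL_one_apply]

theorem adPSL_apply_inv (g : PSLn n) (X : sln n) : adPSL n g (adPSL n g⁻¹ X) = X := by
  rw [← adPSL_mul_apply, mul_inv_cancel, adPSL_one_apply]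

theorem expPSL_zero : expPSL (0 : sln n) = 1 := by
  rw [expPSL_eq, expSL_zero, map_one]

theorem expPSL_neg (X : sln n) : expPSL (-X) = (expPSL X)⁻¹ := by
  rw [eq_inv_iff_mul_eq_one, ← map_one (toPSL n), expPSL_eq, expPSL_eq, ← map_mul]
  refine congrArg (toPSL n) (Subtype.ext ?_)
  change NormedSpace.exp (-X.1) * NormedSpace.exp X.1 = 1
  rw [← Matrix.exp_add_of_commute _ _ (Commute.refl X.1).neg_left, neg_add_cancel,
    NormedSpace.exp_zero]

/-- A lift of `g` to SL_n that fixes `X` under conjugation commutes with `X`, hence with its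
exponential. -/
theorem commute_expPSL {g : PSLn n} {X : sln n} (h : adPSL n g X = X) (s : ℝ) :
    Commute g (expPSL (s • X)) := by
  obtain ⟨A, rfl⟩ := toPSL_surjective n g
  have h1 := congrArg Subtype.val h
  rw [adPSL_toPSL] at h1
  have h2 : (A : Matrix (Fin n) (Fin n) ℝ) * X.1 = X.1 * A := by
    conv_rhs => rw [← h1]
    rw [mul_assoc, ← Matrix.SpecialLinearGroup.coe_mul, inv_mul_cancel,
      Matrix.SpecialLinearGroup.coe_one, mul_one]
  have h3 : Commute (A : Matrix (Fin n) (Fin n) ℝ) (NormedSpace.exp (s • X.1)) := by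
    let _ : NormedRing (Matrix (Fin n) (Fin n) ℝ) := Matrix.linftyOpNormedRing
    exact Commute.exp_right (Commute.smul_right h2 s)
  change toPSL n A * toPSL n (expSL (s • X)) = toPSL n (expSL (s • X)) * toPSL n A
  rw [← map_mul, ← map_mul]
  exact congrArg (toPSL n) (Subtype.ext h3)

/-- The centralizer of a good representation being trivial, `H⁰(Γ; 𝔤_ρ) = 0`. -/
theorem IsGoodRep.eq_zero_of_invariant {Γ : Type} [Group Γ] {ρ : Γ →* PSLn n} (hρ : IsGoodRep ρ)
    {X : sln n} (hX : ∀ γ, adPSL n (ρ γ) X = X) : X = 0 := by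
  have h1 : ∀ s : ℝ, expPSL (s • X) = 1 := by
    intro s
    rw [← Subgroup.mem_bot, ← hρ.2, Subgroup.mem_centralizer_iff]
    rintro _ ⟨γ, rfl⟩
    exact (commute_expPSL (hX γ) s).eq
  -- Being trivial in PSL_n, exp(sX) is central in SL_n, hence scalar. Its derivative X at 0 then
  -- has no off-diagonal entries and equal diagonal ones.
  have h2 : ∀ s : ℝ, ∃ r : ℝ, Matrix.scalar (Fin n) r = NormedSpace.exp (s • X.1) := by
    intro s
    have h3 := (QuotientGroup.eq_one_iff _).1 (h1 s)
    obtain ⟨r, -, hr⟩ := Matrix.SpecialLinearGroup.mem_center_iff.1 h3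
    exact ⟨r, hr⟩
  choose r hr using h2
  have hd : ∀ i j, HasDerivAt (fun t : ℝ => (NormedSpace.exp (t • X.1) : Matrix _ _ ℝ) i j)
      (X.1 i j) 0 := fun i j =>
    hasDerivAt_pi.1 (hasDerivAt_pi.1 (hasDerivAt_matrix_exp X.1) i) j
  have hoff : ∀ i j, i ≠ j → X.1 i j = 0 := by
    intro i j hij
    refine (hd i j).unique ?_
    simp only [← hr, Matrix.scalar_apply, Matrix.diagonal_apply_ne _ hij]
    exact hasDerivAt_const _ _
  have hdiag : ∀ i j, X.1 i i = X.1 j j := by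
    intro i j
    refine (hd i i).unique ?_
    have := hd j j
    simp only [← hr, Matrix.scalar_apply, Matrix.diagonal_apply_eq] at this ⊢
    exact this
  have htr : Matrix.trace X.1 = 0 := X.2
  have i₀ : Fin n := ⟨0, hρ.1.1⟩
  -- The trace, which is 0, is n times the common diagonal entry, and n > 0 is part of
  -- irreducibility.
  have h0 : X.1 i₀ i₀ = 0 := by
    have : Matrix.trace X.1 = n * X.1 i₀ i₀ := by
      change ∑ i, X.1 i i = _
      rw [Finset.sum_congr rfl fun i _ => hdiag i i₀]
      simp
    rw [this] at htr
    exact (mul_eq_zero.1 htr).resolve_left (Nat.cast_ne_zero.2 hρ.1.1.ne')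
  refine Subtype.ext (Matrix.ext fun i j => ?_)
  by_cases hij : i = j
  · subst hij
    exact (hdiag i i₀).trans h0
  · exact hoff i j hij

end Matrices

/-! ### Tangent vectors of paths of representations -/

section Tangent

variable {Γ : Type} [Group Γ] {n : ℕ} (Φ : ℝ → Γ →* PSLn n)

/-- `u` is the derivative at `0` of `Φ t γ (Φ 0 γ)⁻¹`. -/
def IsTangentAt (γ : Γ) (u : sln n) : Prop :=
  ∃ A : ℝ → Matrix.SpecialLinearGroup (Fin n) ℝ, A 0 = 1 ∧
    (∀ t, Φ t γ * (Φ 0 γ)⁻¹ = toPSL n (A t)) ∧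
    HasDerivAt (fun t => (A t : Matrix (Fin n) (Fin n) ℝ)) u.1 0

variable {Φ}

/-- The Leibniz rule for right-trivialised derivatives is the cocycle identity. The second path is
conjugated by a lift of Φ 0 γ, whose choice is immaterial. -/
theorem IsTangentAt.mul {γ η : Γ} {u v : sln n} (hγ : IsTangentAt Φ γ u)
    (hη : IsTangentAt Φ η v) : IsTangentAt Φ (γ * η) (adPSL n (Φ 0 γ) v + u) := by
  obtain ⟨A, A0, hA, dA⟩ := hγ
  obtain ⟨B, B0, hB, dB⟩ := hη
  obtain ⟨P, hP⟩ := toPSL_surjective n (Φ 0 γ)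
  refine ⟨fun t => A t * (P * B t * P⁻¹), by simp [A0, B0], fun t => ?_, ?_⟩
  · simp only [map_mul, map_inv, ← hA, ← hB, hP]
    group
  · have h := hasDerivAt_matrix_mul dA (hasDerivAt_matrix_mul (hasDerivAt_matrix_mul
      (hasDerivAt_matrix_const (P : Matrix (Fin n) (Fin n) ℝ)) dB)
      (hasDerivAt_matrix_const ((P⁻¹ : Matrix.SpecialLinearGroup (Fin n) ℝ).1)))
    refine hasDerivAt_matrix_congr h ?_
    rw [← hP, A0, B0]
    change (adPSL n (toPSL n P) v).1 + u.1 = _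
    rw [adPSL_toPSL]
    simp only [Matrix.SpecialLinearGroup.coe_one, zero_add, mul_zero, mul_one,
      add_zero, one_mul]
    rw [← Matrix.SpecialLinearGroup.coe_mul, mul_inv_cancel, Matrix.SpecialLinearGroup.coe_one,
      mul_one, add_comm]

theorem IsTangentAt.inv {γ : Γ} {u : sln n} (hγ : IsTangentAt Φ γ u) :
    IsTangentAt Φ γ⁻¹ (-adPSL n (Φ 0 γ)⁻¹ u) := by
  obtain ⟨A, A0, hA, dA⟩ := hγ
  obtain ⟨P, hP⟩ := toPSL_surjective n (Φ 0 γ)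
  refine ⟨fun t => P⁻¹ * (A t)⁻¹ * P, by simp [A0], fun t => ?_, ?_⟩
  · simp only [map_mul, map_inv, ← hA, hP]
    group
  · have h := hasDerivAt_matrix_mul (hasDerivAt_matrix_mul
      (hasDerivAt_matrix_const ((P⁻¹ : Matrix.SpecialLinearGroup (Fin n) ℝ).1))
      (hasDerivAt_specialLinear_inv A0 dA))
      (hasDerivAt_matrix_const (P : Matrix (Fin n) (Fin n) ℝ))
    refine hasDerivAt_matrix_congr h ?_
    rw [← hP, ← map_inv]
    change -(adPSL n (toPSL n P⁻¹) u).1 = _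
    rw [adPSL_toPSL, inv_inv]
    simp

/-- The right factor, moved past Φ 0 γ, becomes its conjugate and contributes -Ad X₂. The case X₁ =
X₂ serves for vertex groups, the general one for ξ_k^⊥. -/
theorem isTangentAt_of_exp {γ : Γ} {X₁ X₂ : sln n}
    (h : ∀ t : ℝ, Φ t γ = expPSL (t • X₁) * Φ 0 γ * expPSL (-(t • X₂))) :
    IsTangentAt Φ γ (X₁ - adPSL n (Φ 0 γ) X₂) := by
  obtain ⟨P, hP⟩ := toPSL_surjective n (Φ 0 γ)
  set E : sln n → ℝ → Matrix.SpecialLinearGroup (Fin n) ℝ := fun X t => expSL (t • X) with hE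
  have E0 : ∀ X, E X 0 = 1 := fun X => by simp only [hE, zero_smul, expSL_zero]
  have dE : ∀ X : sln n, HasDerivAt (fun t => (E X t : Matrix (Fin n) (Fin n) ℝ)) X.1 0 :=
    fun X => hasDerivAt_matrix_exp X.1
  refine ⟨fun t => E X₁ t * (P * E (-X₂) t * P⁻¹), by simp [E0], fun t => ?_, ?_⟩
  · rw [h t, ← smul_neg]
    simp only [map_mul, map_inv, hP, hE, ← expPSL_eq]
    group
  · have h := hasDerivAt_matrix_mul (dE X₁) (hasDerivAt_matrix_mul (hasDerivAt_matrix_mul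
      (hasDerivAt_matrix_const (P : Matrix (Fin n) (Fin n) ℝ)) (dE (-X₂)))
      (hasDerivAt_matrix_const ((P⁻¹ : Matrix.SpecialLinearGroup (Fin n) ℝ).1)))
    refine hasDerivAt_matrix_congr h ?_
    rw [← hP, E0, E0]
    change X₁.1 - (adPSL n (toPSL n P) X₂).1 = _
    rw [adPSL_toPSL]
    change _ = X₁.1 * _ + _ * ((0 * _ + _ * (-X₂.1)) * _ + _)
    simp only [Matrix.SpecialLinearGroup.coe_one, zero_add, mul_zero, mul_one,
      add_zero, one_mul]
    rw [← Matrix.SpecialLinearGroup.coe_mul, mul_inv_cancel, Matrix.SpecialLinearGroup.coe_one,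
      mul_one, mul_neg, neg_mul, sub_eq_add_neg]

end Tangent

/-! ### Cocycles with values in the adjoint representation -/

section Cocycles

variable {Γ : Type} [Group Γ] {n : ℕ} {ρ : Γ →* PSLn n}

/-- The cocycles of `Γ` with values in `𝔤_ρ`. -/
def IsAdCocycle (ρ : Γ →* PSLn n) (β : Γ → sln n) : Prop :=
  ∀ x y, β (x * y) = adPSL n (ρ x) (β y) + β x

theorem mem_cocycles₁_iff_isAdCocycle {β : Γ → sln n} :
    β ∈ groupCohomology.cocycles₁ (gRep ρ) ↔ IsAdCocycle ρ β :=
  groupCohomology.mem_cocycles₁_iff (A := gRep ρ) β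

theorem isAdCocycle_coe (α : groupCohomology.cocycles₁ (gRep ρ)) : IsAdCocycle ρ α :=
  mem_cocycles₁_iff_isAdCocycle.1 α.2

theorem H1π_eq_iff_exists {α β : groupCohomology.cocycles₁ (gRep ρ)} :
    groupCohomology.H1π (gRep ρ) α = groupCohomology.H1π (gRep ρ) β ↔
      ∃ W : sln n, ∀ x, α x = β x + (adPSL n (ρ x) W - W) := by
  rw [groupCohomology.H1π_eq_iff]
  constructor
  · rintro ⟨W, hW⟩
    refine ⟨W, fun x => ?_⟩
    have h : adPSL n (ρ x) W - W = α x - β x := congrFun hW x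
    rw [h, add_sub_cancel]
  · rintro ⟨W, hW⟩
    refine ⟨W, funext fun x => ?_⟩
    change adPSL n (ρ x) W - W = α x - β x
    rw [hW, add_sub_cancel_left]

theorem IsAdCocycle.apply_one {β : Γ → sln n} (hβ : IsAdCocycle ρ β) : β 1 = 0 := by
  have h := hβ 1 1
  rw [mul_one, map_one ρ, adPSL_one_apply] at h
  exact left_eq_add.1 h

theorem IsAdCocycle.apply_inv {β : Γ → sln n} (hβ : IsAdCocycle ρ β) (x : Γ) :
    β x⁻¹ = -adPSL n (ρ x)⁻¹ (β x) := by
  have h := hβ x⁻¹ x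
  rw [inv_mul_cancel, hβ.apply_one, map_inv ρ] at h
  exact eq_neg_of_add_eq_zero_right h.symm

theorem isAdCocycle_coboundary (ρ : Γ →* PSLn n) (W : sln n) :
    IsAdCocycle ρ fun x => adPSL n (ρ x) W - W := by
  intro x y
  simp only [map_mul ρ, adPSL_mul_apply, map_sub]
  abel

theorem IsAdCocycle.sub {β β' : Γ → sln n} (hβ : IsAdCocycle ρ β) (hβ' : IsAdCocycle ρ β') :
    IsAdCocycle ρ fun x => β x - β' x := by
  intro x y
  simp only [hβ x y, hβ' x y, map_sub]
  abel

/-- The elements that fix a vector of the Lie algebra. -/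
def adStabilizer (X : sln n) : Subgroup (PSLn n) where
  carrier := {g | adPSL n g X = X}
  one_mem' := adPSL_one_apply X
  mul_mem' := fun {g h} hg hh => by
    change adPSL n (g * h) X = X
    rw [adPSL_mul_apply, show adPSL n h X = X from hh, show adPSL n g X = X from hg]
  inv_mem' := fun {g} hg => by
    change adPSL n g⁻¹ X = X
    conv_lhs => rw [← show adPSL n g X = X from hg]
    exact adPSL_inv_apply g X

/-- The affine transformation of the Lie algebra with linear part `Ad g` and translation part
`a`. -/
def adAffine (g : PSLn n) (a : sln n) : Equiv.Perm (sln n) where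
  toFun Z := adPSL n g Z + a
  invFun Z := adPSL n g⁻¹ (Z - a)
  left_inv Z := by simp only [add_sub_cancel_right, adPSL_inv_apply]
  right_inv Z := by simp only [adPSL_apply_inv, sub_add_cancel]

theorem adAffine_apply (g : PSLn n) (a Z : sln n) : adAffine g a Z = adPSL n g Z + a :=
  rfl

theorem adAffine_mul (g h : PSLn n) (a c : sln n) :
    adAffine g a * adAffine h c = adAffine (g * h) (adPSL n g c + a) := by
  ext1 Z
  simp only [Equiv.Perm.mul_apply, adAffine_apply, adPSL_mul_apply, map_add, add_assoc]

theorem adAffine_one : adAffine (1 : PSLn n) 0 = 1 := by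
  ext1 Z
  simp only [adAffine_apply, adPSL_one_apply, add_zero, Equiv.Perm.one_apply]

theorem adAffine_inv (g : PSLn n) (a : sln n) :
    (adAffine g a)⁻¹ = adAffine g⁻¹ (-adPSL n g⁻¹ a) := by
  rw [inv_eq_iff_mul_eq_one, adAffine_mul, mul_inv_cancel, map_neg, adPSL_apply_inv,
    neg_add_cancel, adAffine_one]

end Cocycles

/-! ### Gluing cocycles over the graph of groups -/

namespace CutSurface.Marking

variable {X : Type} [TopologicalSpace X] [ChartedSpace HypHalf X] {b m l : ℕ}
  {C : CutSurface X b m l} (M : C.Marking) {n : ℕ} (ρ : M.Γ →* PSLn n)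

theorem induction_on_generators {P : M.Γ → Prop} (γ : M.Γ)
    (vertex : ∀ v, ∀ γ ∈ M.vertexGroup v, P γ) (perp : ∀ i ∉ M.D, P (M.perp i))
    (mul : ∀ x y, P x → P y → P (x * y)) (inv : ∀ x, P x → P x⁻¹) : P γ := by
  have h : γ ∈ Subgroup.closure ((⋃ v, (M.vertexGroup v : Set M.Γ)) ∪ M.perp '' M.Dᶜ) := by
    rw [M.closure_vertexGroup_perp]
    exact Subgroup.mem_top γ
  induction h using Subgroup.closure_induction with
  | mem x hx =>
    rcases hx with hx | ⟨i, hi, rfl⟩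
    · obtain ⟨v, hv⟩ := Set.mem_iUnion.1 hx
      exact vertex v x hv
    · exact perp i hi
  | one => exact vertex M.root 1 (one_mem _)
  | mul x y _ _ hx hy => exact mul x y hx hy
  | inv x _ hx => exact inv x hx

theorem gammaMinus_mul_perp (i : Fin m) :
    M.gammaMinus i * M.perp i = M.perp i * M.gammaPlus i := by
  rw [← M.perp_mul_gammaPlus i, inv_mul_cancel_right]

variable {ρ}

theorem cocycle_ext {β β' : M.Γ → sln n} (hβ : IsAdCocycle ρ β) (hβ' : IsAdCocycle ρ β')
    (hV : ∀ v, ∀ γ ∈ M.vertexGroup v, β γ = β' γ) (hP : ∀ i ∉ M.D, β (M.perp i) = β' (M.perp i)) :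
    β = β' := by
  funext γ
  refine M.induction_on_generators γ hV hP (fun x y hx hy => ?_) fun x hx => ?_
  · rw [hβ, hβ', hx, hy]
  · rw [hβ.apply_inv, hβ'.apply_inv, hx]

/-- Cocycles on the vertex groups, that restrict to coboundaries on the edge groups, can be glued;
the value of the resulting cocycle on `ξ_i^⊥` depends on the chosen 0-cochains. -/
theorem exists_glued_cocycle (α : Fin l → M.Γ → sln n)
    (hα : ∀ v, ∀ x ∈ M.vertexGroup v, ∀ y ∈ M.vertexGroup v,
      α v (x * y) = adPSL n (ρ x) (α v y) + α v x) (S T : Fin m → sln n)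
    (hT : ∀ i, α (C.t i) (M.gammaPlus i) = adPSL n (ρ (M.gammaPlus i)) (T i) - T i)
    (hS : ∀ i, α (C.o i) (M.gammaMinus i) = adPSL n (ρ (M.gammaMinus i)) (S i) - S i)
    (hD : ∀ i ∈ M.D, S i = T i) :
    ∃ β, IsAdCocycle ρ β ∧ (∀ v, ∀ γ ∈ M.vertexGroup v, β γ = α v γ) ∧
      ∀ i, β (M.perp i) = adPSL n (ρ (M.perp i)) (T i) - S i := by
  obtain ⟨Φ, hV, hP⟩ := M.exists_hom
    -- A cocycle is encoded as the homomorphism γ ↦ (Z ↦ Ad ρ(γ) Z + α(γ)).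
    (fun v => MonoidHom.mk' (fun γ : M.vertexGroup v => adAffine (ρ γ) (α v γ)) fun x y => by
      rw [adAffine_mul, ← map_mul, ← hα v x x.2 y y.2]
      rfl)
    -- By `hT` and `hS`, -T and -S are fixed by the affine maps of γ⁺ and γ⁻. The translation part
    -- is the one for which ξ_i^⊥ carries -T to -S.
    (fun i => adAffine (ρ (M.perp i)) (adPSL n (ρ (M.perp i)) (T i) - S i))
    (fun i hi => by
      rw [M.perp_eq_one hi, map_one ρ, adPSL_one_apply, hD i hi, sub_self, adAffine_one])
    (fun i => by
      rw [mul_inv_eq_iff_eq_mul]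
      change adAffine _ _ * adAffine _ _ = adAffine _ _ * adAffine _ _
      rw [adAffine_mul, adAffine_mul, ← map_mul, ← map_mul]
      simp only [gammaMinus_mul_perp]
      congr 1
      have e : adPSL n (ρ (M.gammaMinus i)) (adPSL n (ρ (M.perp i)) (T i)) =
          adPSL n (ρ (M.perp i)) (adPSL n (ρ (M.gammaPlus i)) (T i)) := by
        rw [← adPSL_mul_apply, ← adPSL_mul_apply, ← map_mul, ← map_mul, gammaMinus_mul_perp]
      rw [hT, hS, map_sub, map_sub, e]
      abel)
  -- `Φ` takes values in all permutations of 𝔤; on generators, hence everywhere, they are affine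
  -- with linear part Ad ρ(γ), and the translation part is the cocycle.
  have hlin : ∀ γ, ∃ a, Φ γ = adAffine (ρ γ) a := by
    intro γ
    refine M.induction_on_generators (P := fun γ => ∃ a, Φ γ = adAffine (ρ γ) a) γ
      (fun v γ hγ => ⟨_, hV v ⟨γ, hγ⟩⟩) (fun i _ => ⟨_, hP i⟩) ?_ ?_
    · rintro x y ⟨a, ha⟩ ⟨c, hc⟩
      exact ⟨_, by rw [map_mul, ha, hc, adAffine_mul, ← map_mul]⟩
    · rintro x ⟨a, ha⟩
      exact ⟨_, by rw [map_inv, ha, adAffine_inv, ← map_inv ρ]⟩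
  choose β hβ using hlin
  have hinj : ∀ {g : PSLn n} {a c : sln n}, adAffine g a = adAffine g c → a = c := by
    intro g a c h
    have := congrArg (fun e : Equiv.Perm (sln n) => e 0) h
    simpa [adAffine_apply] using this
  refine ⟨β, fun x y => ?_, fun v γ hγ => ?_, fun i => ?_⟩
  · refine hinj (g := ρ (x * y)) ?_
    rw [← hβ, map_mul, hβ x, hβ y, adAffine_mul, ← map_mul]
  · exact hinj ((hβ γ).symm.trans (hV v ⟨γ, hγ⟩))
  · exact hinj ((hβ _).symm.trans (hP i))

variable (ρ) in
theorem mem_edgeH0_iff {i : Fin m} {Z : sln n} :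
    Z ∈ M.edgeH0 ρ i ↔ adPSL n (ρ (M.gammaPlus i)) Z = Z := by
  constructor
  · exact fun h => h ⟨M.gammaPlus i, Subgroup.mem_zpowers _⟩
  · rintro h ⟨γ, hγ⟩
    have : Subgroup.zpowers (M.gammaPlus i) ≤ (adStabilizer Z).comap ρ :=
      Subgroup.zpowers_le.2 h
    exact this hγ

/-! ### The connecting homomorphism -/

theorem exists_isConnecting (Z : ∀ i, M.edgeH0 ρ i) :
    ∃ β, IsAdCocycle ρ β ∧ M.IsConnecting ρ Z β := by
  classical
  obtain ⟨Y, hY⟩ := M.exists_potential fun i => (Z i : sln n)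
  have hZ : ∀ i, adPSL n (ρ (M.gammaPlus i)) (Z i) = Z i := fun i =>
    (M.mem_edgeH0_iff ρ).1 (Z i).2
  -- Next to Y (t i), this is a second 0-cochain for γ⁺: the two differ by ± Z i, which γ⁺ fixes. On
  -- the tree it must equal Y (o i); elsewhere the difference is prescribed to be Z i.
  set T : Fin m → sln n := fun i => if i ∈ M.D then Y (C.o i) else Z i + Y (C.t i) with hT
  have hfix : ∀ i, adPSL n (ρ (M.gammaPlus i)) (T i - Y (C.t i)) = T i - Y (C.t i) := by
    intro i
    by_cases hi : i ∈ M.D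
    · simp only [hT, if_pos hi]
      rcases M.near_far_cases hi with ⟨h1, h2, -⟩ | ⟨h1, h2, -⟩
      · rw [← h1, ← h2, ← hY i hi, hZ]
      · rw [← h1, ← h2, ← neg_sub, ← hY i hi, map_neg, hZ]
    · simp only [hT, if_neg hi, add_sub_cancel_right, hZ]
  obtain ⟨β, hβ, hV, hP⟩ := M.exists_glued_cocycle (ρ := ρ)
    (fun v γ => adPSL n (ρ γ) (Y v) - Y v) (fun v x _ y _ => isAdCocycle_coboundary ρ (Y v) x y)
    (fun i => Y (C.o i)) T (fun i => by
      have h := hfix i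
      rw [map_sub, sub_eq_sub_iff_add_eq_add] at h
      rw [sub_eq_sub_iff_add_eq_add, add_comm, ← h, add_comm]) (fun _ => rfl)
    (fun i hi => by simp only [hT, if_pos hi])
  refine ⟨β, hβ, Y, hV, hY, fun i hi => ?_⟩
  rw [hP, sub_add_cancel, map_inv ρ, adPSL_inv_apply]
  simp only [hT, if_neg hi, add_sub_cancel_right]

/-- Shifting all the `Y v` by the same `W` absorbs the coboundary and leaves the jumps across the
curves unchanged. -/
theorem IsConnecting.add_coboundary {Z : ∀ i, M.edgeH0 ρ i} {β β' : M.Γ → sln n}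
    (h : M.IsConnecting ρ Z β) (W : sln n) (hW : ∀ x, β' x = β x + (adPSL n (ρ x) W - W)) :
    M.IsConnecting ρ Z β' := by
  obtain ⟨Y, hV, hD, hP⟩ := h
  refine ⟨fun v => Y v + W, fun v γ hγ => ?_, fun i hi => ?_, fun i hi => ?_⟩
  · rw [hW, hV v γ hγ, map_add]
    beta_reduce
    abel
  · rw [hD i hi]
    beta_reduce
    abel
  · beta_reduce
    rw [hP i hi, hW, show β (M.perp i) + (adPSL n (ρ (M.perp i)) W - W) + (Y (C.o i) + W) =
      β (M.perp i) + Y (C.o i) + adPSL n (ρ (M.perp i)) W by abel, map_add _ _ (adPSL n _ W),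
      map_inv ρ, adPSL_inv_apply]
    abel

theorem IsConnecting.add {Z Z' : ∀ i, M.edgeH0 ρ i} {β β' : M.Γ → sln n}
    (h : M.IsConnecting ρ Z β) (h' : M.IsConnecting ρ Z' β') :
    M.IsConnecting ρ (Z + Z') (β + β') := by
  obtain ⟨Y, hV, hD, hP⟩ := h
  obtain ⟨Y', hV', hD', hP'⟩ := h'
  refine ⟨Y + Y', fun v γ hγ => ?_, fun i hi => ?_, fun i hi => ?_⟩
  · simp only [Pi.add_apply, hV v γ hγ, hV' v γ hγ, map_add]
    abel
  · simp only [Pi.add_apply, Submodule.coe_add, hD i hi, hD' i hi]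
    abel
  · simp only [Pi.add_apply, Submodule.coe_add, hP i hi, hP' i hi, map_add]
    abel

theorem IsConnecting.smul {Z : ∀ i, M.edgeH0 ρ i} {β : M.Γ → sln n} (c : ℝ)
    (h : M.IsConnecting ρ Z β) : M.IsConnecting ρ (c • Z) (c • β) := by
  obtain ⟨Y, hV, hD, hP⟩ := h
  refine ⟨c • Y, fun v γ hγ => ?_, fun i hi => ?_, fun i hi => ?_⟩
  · simp only [Pi.smul_apply, hV v γ hγ, map_smul, smul_sub]
  · simp only [Pi.smul_apply, Submodule.coe_smul, hD i hi, smul_sub]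
  · simp only [Pi.smul_apply, Submodule.coe_smul, hP i hi, ← smul_add, map_smul, smul_sub]

theorem IsConnecting.sub {Z Z' : ∀ i, M.edgeH0 ρ i} {β β' : M.Γ → sln n}
    (h : M.IsConnecting ρ Z β) (h' : M.IsConnecting ρ Z' β') :
    M.IsConnecting ρ (Z - Z') (β - β') := by
  have := h.add M (h'.smul M (-1))
  rwa [neg_smul, neg_smul, one_smul, one_smul, ← sub_eq_add_neg, ← sub_eq_add_neg] at this

/-- The connecting homomorphism is well defined. -/
theorem IsConnecting.exists_coboundary {β : M.Γ → sln n} (hβ : IsAdCocycle ρ β)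
    (h : M.IsConnecting ρ 0 β) : ∃ W, ∀ x, β x = adPSL n (ρ x) W - W := by
  obtain ⟨Y, hV, hD, hP⟩ := h
  have hedge : ∀ i ∈ M.D, Y (C.o i) = Y (C.t i) := by
    intro i hi
    have h0 : (0 : sln n) = _ := hD i hi
    rcases M.near_far_cases hi with ⟨h1, h2, -⟩ | ⟨h1, h2, -⟩ <;> rw [h1, h2] at h0
    · exact sub_eq_zero.1 h0.symm
    · exact (sub_eq_zero.1 h0.symm).symm
  -- Without jumps along the tree, `Y` is constant, and its value is a 0-cochain for all of Γ.
  have hwalk : ∀ {v} (w : TreeWalk C.o C.t M.D M.root v), Y v = Y M.root := by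
    intro v w
    induction w with
    | nil => rfl
    | fwd e he w ih => rw [← hedge e he, ih]
    | bwd e he w ih => rw [hedge e he, ih]
  refine ⟨Y M.root, fun x => congrFun (M.cocycle_ext hβ (isAdCocycle_coboundary ρ (Y M.root))
    (fun v γ hγ => by rw [hV v γ hγ, hwalk (M.path v)]) fun i hi => ?_) x⟩
  have h0 : (0 : sln n) = _ := hP i hi
  rw [hwalk (M.path (C.o i)), hwalk (M.path (C.t i)), eq_comm, sub_eq_zero] at h0
  have h1 := congrArg (adPSL n (ρ (M.perp i))) h0
  rw [map_inv ρ, adPSL_apply_inv] at h1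
  exact eq_sub_of_add_eq h1

/-- The connecting homomorphism is injective. -/
theorem IsConnecting.eq_zero {Z : ∀ i, M.edgeH0 ρ i} {β : M.Γ → sln n}
    (hρ : ∀ v, IsGoodRep (ρ.comp (M.vertexGroup v).subtype)) (h : M.IsConnecting ρ Z β)
    {W : sln n} (hW : ∀ x, β x = adPSL n (ρ x) W - W) : Z = 0 := by
  obtain ⟨Y, hV, hD, hP⟩ := h
  -- Two 0-cochains of the same cocycle on a vertex group differ by an invariant vector, which
  -- vanishes.
  have hY : ∀ v, Y v = W := by
    intro v
    rw [← sub_eq_zero]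
    refine (hρ v).eq_zero_of_invariant fun γ => ?_
    have h1 := (hW γ).symm.trans (hV v γ γ.2)
    change adPSL n (ρ γ) (Y v - W) = _
    rw [map_sub, sub_eq_sub_iff_sub_eq_sub, ← h1]
  funext i
  refine Subtype.ext ?_
  by_cases hi : i ∈ M.D
  · rw [hD i hi, hY, hY, sub_self]
    rfl
  · rw [hP i hi, hY, hY, hW, sub_add_cancel, map_inv ρ, adPSL_inv_apply, sub_self]
    rfl

/-- A cocycle whose restrictions to the vertex groups are coboundaries is in the image of the
connecting homomorphism. -/
theorem exists_isConnecting_of_coboundary {β : M.Γ → sln n} (hβ : IsAdCocycle ρ β)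
    (h : ∀ v, ∃ Y, ∀ γ ∈ M.vertexGroup v, β γ = adPSL n (ρ γ) Y - Y) :
    ∃ Z, M.IsConnecting ρ Z β := by
  choose Y hY using h
  -- Brought to the side of `t i` by ξ_i^⊥, the 0-cochain of `o i` is one for γ⁺; its difference
  -- from Y (t i) is therefore fixed by γ⁺.
  have hfix : ∀ i, adPSL n (ρ (M.perp i)⁻¹) (β (M.perp i) + Y (C.o i)) - Y (C.t i) ∈
      M.edgeH0 ρ i := by
    intro i
    rw [mem_edgeH0_iff]
    have h1 := hβ (M.gammaMinus i) (M.perp i)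
    rw [gammaMinus_mul_perp, hβ, hY _ _ (M.gammaPlus_mem i), hY _ _ (M.gammaMinus_mem i),
      map_sub] at h1
    set p := ρ (M.perp i)
    set V := β (M.perp i) + Y (C.o i)
    have h2 : adPSL n (ρ (M.gammaMinus i)) V = adPSL n p
        (adPSL n (ρ (M.gammaPlus i)) (Y (C.t i))) - adPSL n p (Y (C.t i)) + V := by
      simp only [V, map_add]
      rw [← add_assoc, h1]
      abel
    have h3 : ρ (M.gammaPlus i) * p⁻¹ = p⁻¹ * ρ (M.gammaMinus i) := by
      rw [mul_inv_eq_iff_eq_mul, mul_assoc, eq_inv_mul_iff_mul_eq, ← map_mul, ← map_mul,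
        gammaMinus_mul_perp]
    rw [map_inv ρ, map_sub, ← adPSL_mul_apply, h3, adPSL_mul_apply, h2, map_add, map_sub,
      adPSL_inv_apply, adPSL_inv_apply]
    abel
  have hD : ∀ i ∈ M.D, Y (M.near i) - Y (M.far i) ∈ M.edgeH0 ρ i := by
    intro i hi
    have h1 := hfix i
    -- On the tree ξ_i^⊥ = 1, and the same statement is about Y (o i) - Y (t i), up to sign the
    -- required difference.
    rw [M.perp_eq_one hi, inv_one, map_one ρ, adPSL_one_apply, hβ.apply_one, zero_add] at h1
    rcases M.near_far_cases hi with ⟨h2, h3, -⟩ | ⟨h2, h3, -⟩ <;> rw [h2, h3]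
    · exact h1
    · rw [← neg_sub]
      exact neg_mem h1
  classical
  refine ⟨fun i => if hi : i ∈ M.D then ⟨_, hD i hi⟩ else ⟨_, hfix i⟩, Y, hY,
    fun i hi => congrArg Subtype.val (dif_pos hi), fun i hi => congrArg Subtype.val (dif_neg hi)⟩

/-- The zero-cochains for `γ⁻` that correspond to those for `γ⁺`. -/
theorem coboundary_gammaMinus {β : M.Γ → sln n} (hβ : IsAdCocycle ρ β) {i : Fin m} {W : sln n}
    (hW : ∀ γ ∈ Subgroup.zpowers (M.gammaPlus i), β γ = adPSL n (ρ γ) W - W) :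
    ∃ W', ∀ γ ∈ Subgroup.zpowers (M.gammaMinus i), β γ = adPSL n (ρ γ) W' - W' := by
  -- In terms of affine maps, -W is a fixed point for γ⁺, and ξ_i^⊥ carries it to the negative of
  -- this vector.
  refine ⟨adPSL n (ρ (M.perp i)) W - β (M.perp i), fun γ hγ => ?_⟩
  obtain ⟨k, rfl⟩ := Subgroup.mem_zpowers_iff.1 hγ
  have e : M.gammaMinus i ^ k = M.perp i * M.gammaPlus i ^ k * (M.perp i)⁻¹ := by
    rw [← M.perp_mul_gammaPlus i, conj_zpow]
  have h1 := hW _ (Subgroup.mem_zpowers_iff.2 ⟨k, rfl⟩)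
  rw [e, hβ, hβ, hβ.apply_inv, h1, map_neg, ← adPSL_mul_apply, map_mul ρ (_ * _), map_inv ρ,
    map_sub, map_sub, ← adPSL_mul_apply _ _ W, ← adPSL_mul_apply _ _ W, inv_mul_cancel_right,
    ← map_mul]
  abel

end CutSurface.Marking

namespace CutSurface.Marking

variable {X : Type} [TopologicalSpace X] [ChartedSpace HypHalf X] {b m l : ℕ}
  {C : CutSurface X b m l} (M : C.Marking) {n : ℕ} {ρ : M.Γ →* PSLn n}

/-! ### Bending -/

/-- `Φ s` conjugates the vertex groups by `exp (s ε_v)`, and multiplies the elements `ξ_k^⊥` from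
the left by `exp (s ε_v)`, where `v = o k`, and from the right by `exp (-s r_k)`. -/
def IsTwist (ρ : M.Γ →* PSLn n) (ε : Fin l → sln n) (r : Fin m → sln n)
    (Φ : ℝ → M.Γ →* PSLn n) : Prop :=
  ∀ s : ℝ, (∀ v, ∀ γ ∈ M.vertexGroup v,
      Φ s γ = expPSL (s • ε v) * ρ γ * expPSL (-(s • ε v))) ∧
    ∀ k ∉ M.D, Φ s (M.perp k) =
      expPSL (s • ε (C.o k)) * ρ (M.perp k) * expPSL (-(s • r k))

theorem IsTwist.unique {ε : Fin l → sln n} {r : Fin m → sln n} {Φ Φ' : ℝ → M.Γ →* PSLn n}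
    (h : M.IsTwist ρ ε r Φ) (h' : M.IsTwist ρ ε r Φ') : Φ = Φ' :=
  funext fun s => M.hom_ext (fun v γ hγ => ((h s).1 v γ hγ).trans ((h' s).1 v γ hγ).symm)
    fun k hk => ((h s).2 k hk).trans ((h' s).2 k hk).symm

theorem IsTwist.zero {ε : Fin l → sln n} {r : Fin m → sln n} {Φ : ℝ → M.Γ →* PSLn n}
    (h : M.IsTwist ρ ε r Φ) : Φ 0 = ρ := by
  refine M.hom_ext (fun v γ hγ => ?_) fun k hk => ?_
  · rw [(h 0).1 v γ hγ, zero_smul, neg_zero, expPSL_zero, one_mul, mul_one]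
  · rw [(h 0).2 k hk, zero_smul, zero_smul, neg_zero, expPSL_zero, one_mul, mul_one]

/-- The hypotheses are those of `exists_hom`: `hD` makes the value on tree crossings 1, and `hcomm`
is the compatibility along ξ_k after the factors exp(s ε) at `o k` are cancelled. -/
theorem exists_isTwist {ε : Fin l → sln n} {r : Fin m → sln n}
    (hD : ∀ k ∈ M.D, r k = ε (C.o k))
    (hcomm : ∀ k (s : ℝ), Commute (expPSL (-(s • r k)) * expPSL (s • ε (C.t k)))
      (ρ (M.gammaPlus k))) : ∃ Φ, M.IsTwist ρ ε r Φ := by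
  have h : ∀ s : ℝ, ∃ Φ : M.Γ →* PSLn n, (∀ v, ∀ γ ∈ M.vertexGroup v,
      Φ γ = expPSL (s • ε v) * ρ γ * expPSL (-(s • ε v))) ∧
      ∀ k, Φ (M.perp k) = expPSL (s • ε (C.o k)) * ρ (M.perp k) * expPSL (-(s • r k)) := by
    intro s
    obtain ⟨Φ, hV, hP⟩ := M.exists_hom
      (fun v => ((MulAut.conj (expPSL (s • ε v))).toMonoidHom.comp ρ).comp
        (M.vertexGroup v).subtype)
      (fun k => expPSL (s • ε (C.o k)) * ρ (M.perp k) * expPSL (-(s • r k)))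
      (fun k hk => by
        rw [M.perp_eq_one hk, map_one ρ, hD k hk, expPSL_neg, mul_one, mul_inv_cancel])
      (fun k => by
        change _ * (expPSL (s • ε (C.t k)) * ρ (M.gammaPlus k) * (expPSL (s • ε (C.t k)))⁻¹) * _ =
          expPSL (s • ε (C.o k)) * ρ (M.gammaMinus k) * (expPSL (s • ε (C.o k)))⁻¹
        have hc := (hcomm k s).eq
        rw [← M.perp_mul_gammaPlus k, map_mul, map_mul, map_inv ρ]
        rw [← mul_inv_eq_iff_eq_mul, expPSL_neg] at hc
        rw [expPSL_neg]
        conv_rhs => rw [← hc]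
        group)
    refine ⟨Φ, fun v γ hγ => ?_, hP⟩
    rw [hV v ⟨γ, hγ⟩, expPSL_neg]
    rfl
  choose Φ hΦ using h
  exact ⟨Φ, fun s => ⟨(hΦ s).1, fun k _ => (hΦ s).2 k⟩⟩

/-- Differentiating a twist gives ε_v - Ad ε_v on the vertex groups, the coboundary of Y_v = -ε_v,
and ε_{o k} - Ad r_k on ξ_k^⊥. The jumps of -ε across the curves are then the Z_k. -/
theorem exists_tangent_cocycle {ε : Fin l → sln n} {r : Fin m → sln n} (Z : ∀ k, M.edgeH0 ρ k)
    (hD : ∀ k ∈ M.D, r k = ε (C.o k) ∧ (Z k : sln n) = ε (M.far k) - ε (M.near k))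
    (hD' : ∀ k ∉ M.D, (Z k : sln n) = ε (C.t k) - r k) :
    ∃ u, IsAdCocycle ρ u ∧ M.IsConnecting ρ Z u ∧
      ∀ Φ, M.IsTwist ρ ε r Φ → IsTangentTo Φ u := by
  have hfix : ∀ k, adPSL n (ρ (M.gammaPlus k)) (ε (C.t k) - r k) = ε (C.t k) - r k := by
    intro k
    have hZ := (M.mem_edgeH0_iff ρ).1 (Z k).2
    by_cases hk : k ∈ M.D
    · rw [(hD k hk).2] at hZ
      rw [(hD k hk).1]
      rcases M.near_far_cases hk with ⟨h1, h2, -⟩ | ⟨h1, h2, -⟩ <;> rw [h1, h2] at hZ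
      · exact hZ
      · rw [← neg_sub, map_neg, hZ]
    · rwa [hD' k hk] at hZ
  obtain ⟨u, hu, hV, hP⟩ := M.exists_glued_cocycle (ρ := ρ)
    (fun v γ => adPSL n (ρ γ) (-ε v) - -ε v) (fun v x _ y _ => isAdCocycle_coboundary ρ (-ε v) x y)
    (fun k => -ε (C.o k)) (fun k => -r k) (fun k => by
      have h := hfix k
      rw [map_sub, sub_eq_sub_iff_sub_eq_sub] at h
      rw [map_neg, map_neg, sub_neg_eq_add, sub_neg_eq_add, neg_add_eq_sub, neg_add_eq_sub,
        ← neg_sub, h, neg_sub]) (fun _ => rfl) (fun k hk => by rw [(hD k hk).1])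
  refine ⟨u, hu, ⟨fun v => -ε v, hV, fun k hk => ?_, fun k hk => ?_⟩, fun Φ hΦ γ => ?_⟩
  · rw [(hD k hk).2]
    beta_reduce
    abel
  · rw [hD' k hk, hP, sub_add_cancel, map_inv ρ, adPSL_inv_apply]
    beta_reduce
    rw [sub_neg_eq_add, neg_add_eq_sub]
  · have h0 := hΦ.zero
    change IsTangentAt Φ γ (u γ)
    refine M.induction_on_generators (P := fun γ => IsTangentAt Φ γ (u γ)) γ (fun v γ hγ => ?_)
      (fun k hk => ?_) (fun x y hx hy => ?_) fun x hx => ?_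
    · have h := isTangentAt_of_exp (Φ := Φ) (γ := γ) (X₁ := ε v) (X₂ := ε v) (fun t => by
        rw [(hΦ t).1 v γ hγ, h0])
      rw [h0] at h
      rw [hV v γ hγ, map_neg, sub_neg_eq_add, neg_add_eq_sub]
      exact h
    · have h := isTangentAt_of_exp (Φ := Φ) (γ := M.perp k) (X₁ := ε (C.o k)) (X₂ := r k)
        (fun t => by rw [(hΦ t).2 k hk, h0])
      rw [h0] at h
      rw [hP, map_neg, sub_neg_eq_add, neg_add_eq_sub]
      exact h
    · rw [hu x y, ← h0]
      exact hx.mul hy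
    · rw [hu.apply_inv, ← h0]
      exact hx.inv

/-- The algebraic bending along `ξ_i` is a twist. -/
theorem exists_twist_data (i : Fin m) (Z : M.edgeH0 ρ i) (Z' : ∀ k, M.edgeH0 ρ k)
    (hZ : Z' i = Z) (hZ' : ∀ k, k ≠ i → Z' k = 0) :
    ∃ (ε : Fin l → sln n) (r : Fin m → sln n),
      (∀ Φ, M.IsBending ρ i Z Φ ↔ M.IsTwist ρ ε r Φ) ∧
      (∀ k ∈ M.D, r k = ε (C.o k) ∧ (Z' k : sln n) = ε (M.far k) - ε (M.near k)) ∧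
      (∀ k ∉ M.D, (Z' k : sln n) = ε (C.t k) - r k) ∧
      ∀ k (s : ℝ), Commute (expPSL (-(s • r k)) * expPSL (s • ε (C.t k)))
        (ρ (M.gammaPlus k)) := by
  classical
  have hcomm : ∀ s : ℝ, Commute (expPSL (s • (Z : sln n))) (ρ (M.gammaPlus i)) := fun s =>
    (commute_expPSL ((M.mem_edgeH0_iff ρ).1 Z.2) s).symm
  have hcomm' : ∀ s : ℝ, Commute (expPSL (-(s • (Z : sln n)))) (ρ (M.gammaPlus i)) := fun s => by
    rw [expPSL_neg]
    exact (hcomm s).inv_left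
  have exp_ite : ∀ (s : ℝ) (p : Prop) [Decidable p],
      (if p then expPSL (s • (Z : sln n)) else 1) = expPSL (s • if p then (Z : sln n) else 0) := by
    intro s p _
    split_ifs
    · rfl
    · rw [smul_zero, expPSL_zero]
  have exp_ite' : ∀ (s : ℝ) (p : Prop) [Decidable p],
      (if p then expPSL (-(s • (Z : sln n))) else 1) =
        expPSL (-(s • if p then (Z : sln n) else 0)) := by
    intro s p _
    split_ifs
    · rfl
    · rw [smul_zero, neg_zero, expPSL_zero]
  by_cases hi : i ∈ M.D
  -- Tree edge: `ε` is Z on the far side and 0 on the near side, so it jumps only across ξ_i.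
  · set ε : Fin l → sln n := fun v => if v ∈ M.above (M.far i) then (Z : sln n) else 0 with hε
    have hfar : ε (M.far i) = Z := if_pos (M.far_mem_above_far i)
    have hnear : ε (M.near i) = 0 := if_neg (M.near_notMem_above_far hi)
    have hother : ∀ k ∈ M.D, k ≠ i → ε (C.o k) = ε (C.t k) := fun k hk hki => by
      simp only [hε, M.o_mem_above_far_iff hi hk hki]
    -- On tree edges `r` must be ε (o k), to keep ξ_k^⊥ = 1 trivial; on the others it is ε (t k), so
    -- that nothing jumps there.
    refine ⟨ε, fun k => if k ∈ M.D then ε (C.o k) else ε (C.t k), fun Φ => ?_, fun k hk => ?_,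
      fun k hk => ?_, fun k s => ?_⟩
    · rw [IsBending, if_pos hi]
      refine forall_congr' fun s => and_congr (forall_congr' fun v => forall_congr' fun γ =>
        forall_congr' fun _ => ?_) (forall_congr' fun k => forall_congr' fun hk => ?_)
      · by_cases hv : v ∈ M.above (M.far i)
        · simp only [hε, if_pos hv]
        · simp only [hε, if_neg hv, smul_zero, neg_zero, expPSL_zero, one_mul, mul_one]
      · beta_reduce
        rw [if_neg hk, exp_ite, exp_ite']
    · beta_reduce
      rw [if_pos hk]
      refine ⟨rfl, ?_⟩
      by_cases hki : k = i
      · subst hki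
        rw [hZ, hfar, hnear, sub_zero]
      · rw [hZ' k hki]
        rcases M.near_far_cases hk with ⟨h1, h2, -⟩ | ⟨h1, h2, -⟩ <;>
          rw [h1, h2, hother k hk hki, sub_self] <;> rfl
    · beta_reduce
      rw [if_neg hk, sub_self, hZ' k fun h => hk (h ▸ hi)]
      rfl
    · beta_reduce
      by_cases hki : k = i
      · subst hki
        rw [if_pos hi]
        rcases M.near_far_cases hi with ⟨h1, h2, -⟩ | ⟨h1, h2, -⟩ <;> rw [h1] at hnear <;>
          rw [h2] at hfar <;> rw [hnear, hfar, smul_zero]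
        · rw [neg_zero, expPSL_zero, one_mul]
          exact hcomm s
        · rw [expPSL_zero, mul_one]
          exact hcomm' s
      · have h : (if k ∈ M.D then ε (C.o k) else ε (C.t k)) = ε (C.t k) := by
          split_ifs with hk
          · exact hother k hk hki
          · rfl
        rw [h, expPSL_neg, inv_mul_cancel]
        exact Commute.one_left _
  -- Off the tree no vertex group moves. The right factor of a twist is exp(-s r), whence the sign
  -- of r_i = -Z.
  · refine ⟨fun _ => 0, fun k => if k = i then -(Z : sln n) else 0, fun Φ => ?_, fun k hk => ?_,
      fun k hk => ?_, fun k s => ?_⟩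
    · rw [IsBending, if_neg hi]
      refine forall_congr' fun s => and_congr (forall_congr' fun v => forall_congr' fun γ =>
        forall_congr' fun _ => ?_) (forall_congr' fun k => forall_congr' fun hk => ?_)
      · rw [smul_zero, neg_zero, expPSL_zero, one_mul, mul_one]
      · beta_reduce
        by_cases hki : k = i
        · rw [if_pos hki, if_pos hki, smul_zero, expPSL_zero, one_mul, smul_neg, neg_neg]
        · rw [if_neg hki, if_neg hki, smul_zero, neg_zero, expPSL_zero, one_mul, mul_one]
    · have hki : k ≠ i := fun h => hi (h ▸ hk)
      beta_reduce
      rw [if_neg hki, hZ' k hki, sub_zero]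
      exact ⟨rfl, rfl⟩
    · beta_reduce
      by_cases hki : k = i
      · subst hki
        rw [if_pos rfl, hZ, zero_sub, neg_neg]
      · rw [if_neg hki, hZ' k hki, sub_zero]
        rfl
    · beta_reduce
      rw [smul_zero, expPSL_zero, mul_one]
      by_cases hki : k = i
      · subst hki
        rw [if_pos rfl, smul_neg, neg_neg]
        exact hcomm s
      · rw [if_neg hki, smul_zero, neg_zero, expPSL_zero]
        exact Commute.one_left _

end CutSurface.Marking

/-! ### Restriction to subgroups -/

section Restriction

variable {Γ : Type} [Group Γ] {n : ℕ} (ρ : Γ →* PSLn n) (Δ : Subgroup Γ)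

/-- The restriction of a cocycle to a subgroup. -/
def resCocycle (α : groupCohomology.cocycles₁ (gRep ρ)) :
    groupCohomology.cocycles₁ (gRep (ρ.comp Δ.subtype)) :=
  ⟨fun x => α (x : Γ), mem_cocycles₁_iff_isAdCocycle.2 fun x y => isAdCocycle_coe α x y⟩

theorem resH1_H1π (α : groupCohomology.cocycles₁ (gRep ρ)) :
    resH1 ρ Δ (groupCohomology.H1π (gRep ρ) α) =
      groupCohomology.H1π (gRep (ρ.comp Δ.subtype)) (resCocycle ρ Δ α) := by
  have h := groupCohomology.H1π_comp_map_apply (A := gRep ρ) (B := gRep (ρ.comp Δ.subtype))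
    Δ.subtype (𝟙 (gRep (ρ.comp Δ.subtype))) α
  refine h.trans (congrArg _ ?_)
  refine groupCohomology.cocycles₁_ext fun x => ?_
  rw [groupCohomology.coe_mapCocycles₁]
  rfl

end Restriction

/-! ### The homomorphisms δ and ι* on parabolic cohomology -/

namespace CutSurface.Marking

variable {X : Type} [TopologicalSpace X] [ChartedSpace HypHalf X] {b m l : ℕ}
  {C : CutSurface X b m l} (M : C.Marking) {n : ℕ} {ρ : M.Γ →* PSLn n}

theorem mem_parCocycles_of_vertex {α : groupCohomology.cocycles₁ (gRep ρ)}
    (hP : ∀ i, ∃ Y : sln n, ∀ γ ∈ Subgroup.zpowers (M.gammaPlus i), α γ = adPSL n (ρ γ) Y - Y)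
    (hB : ∀ j, ∃ Y : sln n, ∀ γ ∈ Subgroup.zpowers (M.zeta j), α γ = adPSL n (ρ γ) Y - Y) :
    α ∈ parCocycles (gRep ρ) M.peripheral := by
  rintro _ (⟨i, rfl⟩ | ⟨j, rfl⟩)
  · exact hP i
  · exact hB j

theorem resCocycle_mem_parCocycles {α : groupCohomology.cocycles₁ (gRep ρ)}
    (hα : α ∈ parCocycles (gRep ρ) M.peripheral) (v : Fin l) :
    resCocycle ρ (M.vertexGroup v) α ∈
      parCocycles (gRep (ρ.comp (M.vertexGroup v).subtype)) (M.vertexPeripheral v) := by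
  rintro _ (⟨i, -, rfl⟩ | ⟨i, -, rfl⟩ | ⟨j, -, rfl⟩)
  · obtain ⟨Y, hY⟩ := hα _ (Or.inl ⟨i, rfl⟩)
    exact ⟨Y, fun γ hγ => hY γ hγ⟩
  · obtain ⟨Y, hY⟩ := hα _ (Or.inl ⟨i, rfl⟩)
    obtain ⟨Y', hY'⟩ := M.coboundary_gammaMinus (isAdCocycle_coe α) hY
    exact ⟨Y', fun γ hγ => hY' γ hγ⟩
  · obtain ⟨Y, hY⟩ := hα _ (Or.inr ⟨j, rfl⟩)
    exact ⟨Y, fun γ hγ => hY γ hγ⟩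

theorem IsConnecting.mem_parCocycles {Z : ∀ i, M.edgeH0 ρ i}
    {α : groupCohomology.cocycles₁ (gRep ρ)} (h : M.IsConnecting ρ Z α) :
    α ∈ parCocycles (gRep ρ) M.peripheral := by
  obtain ⟨Y, hV, -, -⟩ := h
  exact M.mem_parCocycles_of_vertex
    (fun i => ⟨Y (C.t i), fun γ hγ => hV _ γ (Subgroup.zpowers_le.2 (M.gammaPlus_mem i) hγ)⟩)
    (fun j => ⟨Y (M.side j), fun γ hγ => hV _ γ (Subgroup.zpowers_le.2 (M.zeta_mem j) hγ)⟩)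

/-- Parabolic cocycles on the vertex groups are the restrictions of a parabolic cocycle of `Γ`, up
to coboundaries. -/
theorem exists_parCocycle_res
    (α : ∀ v, groupCohomology.cocycles₁ (gRep (ρ.comp (M.vertexGroup v).subtype)))
    (hα : ∀ v, α v ∈ parCocycles (gRep (ρ.comp (M.vertexGroup v).subtype))
      (M.vertexPeripheral v)) :
    ∃ β ∈ parCocycles (gRep ρ) M.peripheral, ∀ v, ∃ Y : sln n, ∀ γ : M.vertexGroup v,
      β (γ : M.Γ) = α v γ + (adPSL n (ρ γ) Y - Y) := by
  classical
  have hT : ∀ i, ∃ T : sln n, ∀ γ (hγ : γ ∈ M.vertexGroup (C.t i)),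
      γ ∈ Subgroup.zpowers (M.gammaPlus i) →
      α (C.t i) ⟨γ, hγ⟩ = adPSL n (ρ γ) T - T := fun i => by
    obtain ⟨T, hT⟩ := hα (C.t i) _ (Or.inl ⟨i, rfl, rfl⟩)
    exact ⟨T, fun γ hγ h => hT ⟨γ, hγ⟩ h⟩
  have hS : ∀ i, ∃ S : sln n, ∀ γ (hγ : γ ∈ M.vertexGroup (C.o i)),
      γ ∈ Subgroup.zpowers (M.gammaMinus i) →
      α (C.o i) ⟨γ, hγ⟩ = adPSL n (ρ γ) S - S := fun i => by
    obtain ⟨S, hS⟩ := hα (C.o i) _ (Or.inr (Or.inl ⟨i, rfl, rfl⟩))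
    exact ⟨S, fun γ hγ h => hS ⟨γ, hγ⟩ h⟩
  have hB : ∀ j, ∃ B : sln n, ∀ γ (hγ : γ ∈ M.vertexGroup (M.side j)),
      γ ∈ Subgroup.zpowers (M.zeta j) →
      α (M.side j) ⟨γ, hγ⟩ = adPSL n (ρ γ) B - B := fun j => by
    obtain ⟨B, hB⟩ := hα (M.side j) _ (Or.inr (Or.inr ⟨j, rfl, rfl⟩))
    exact ⟨B, fun γ hγ h => hB ⟨γ, hγ⟩ h⟩
  choose T hT using hT
  choose S hS using hS
  choose B hB using hB
  -- The cocycles of the pieces are changed by the coboundaries of `Y v`, so that the 0-cochains `S`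
  -- and `T` of the two sides match along the tree, as gluing requires. The case distinction orients
  -- the tree edge.
  obtain ⟨Y, hY⟩ := M.exists_potential fun i =>
    if M.near i = C.o i ∧ M.far i = C.t i then T i - S i else S i - T i
  have hD : ∀ i ∈ M.D, S i + Y (C.o i) = T i + Y (C.t i) := by
    intro i hi
    have h := hY i hi
    by_cases hc : M.near i = C.o i ∧ M.far i = C.t i
    · rw [if_pos hc, hc.1, hc.2, sub_eq_sub_iff_add_eq_add] at h
      rw [h, add_comm]
    · rw [if_neg hc] at h
      rcases M.near_far_cases hi with ⟨h1, h2, -⟩ | ⟨h1, h2, -⟩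
      · exact absurd ⟨h1, h2⟩ hc
      · rw [h1, h2, sub_eq_sub_iff_add_eq_add] at h
        rw [h, add_comm]
  set f : Fin l → M.Γ → sln n := fun v γ =>
    if hγ : γ ∈ M.vertexGroup v then α v ⟨γ, hγ⟩ + (adPSL n (ρ γ) (Y v) - Y v) else 0 with hf
  have f_eq : ∀ v γ (hγ : γ ∈ M.vertexGroup v),
      f v γ = α v ⟨γ, hγ⟩ + (adPSL n (ρ γ) (Y v) - Y v) := fun v γ hγ => dif_pos hγ
  have add_cob : ∀ (g : PSLn n) (a c : sln n), adPSL n g a - a + (adPSL n g c - c) =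
      adPSL n g (a + c) - (a + c) := fun g a c => by
    rw [map_add]
    abel
  obtain ⟨β, hβ, hV, -⟩ := M.exists_glued_cocycle (ρ := ρ) f
    (fun v x hx y hy => by
      rw [f_eq v x hx, f_eq v y hy, f_eq v _ (mul_mem hx hy)]
      have h1 : α v ⟨x * y, mul_mem hx hy⟩ = adPSL n (ρ x) (α v ⟨y, hy⟩) + α v ⟨x, hx⟩ :=
        isAdCocycle_coe (α v) ⟨x, hx⟩ ⟨y, hy⟩
      have h2 := isAdCocycle_coboundary ρ (Y v) x y
      beta_reduce at h2
      rw [h1, h2, map_add]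
      abel)
    (fun i => S i + Y (C.o i)) (fun i => T i + Y (C.t i))
    (fun i => by
      rw [f_eq _ _ (M.gammaPlus_mem i), hT i _ _ (Subgroup.mem_zpowers _), add_cob])
    (fun i => by
      rw [f_eq _ _ (M.gammaMinus_mem i), hS i _ _ (Subgroup.mem_zpowers _), add_cob])
    hD
  refine ⟨⟨β, mem_cocycles₁_iff_isAdCocycle.2 hβ⟩, M.mem_parCocycles_of_vertex
    (fun i => ⟨T i + Y (C.t i), fun γ hγ => ?_⟩)
    (fun j => ⟨B j + Y (M.side j), fun γ hγ => ?_⟩), fun v => ⟨Y v, fun γ => ?_⟩⟩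
  · have hγ' := Subgroup.zpowers_le.2 (M.gammaPlus_mem i) hγ
    exact (hV _ γ hγ').trans (by rw [f_eq _ _ hγ', hT i γ hγ' hγ, add_cob])
  · have hγ' := Subgroup.zpowers_le.2 (M.zeta_mem j) hγ
    exact (hV _ γ hγ').trans (by rw [f_eq _ _ hγ', hB j γ hγ' hγ, add_cob])
  · exact (hV v γ γ.2).trans (f_eq v γ γ.2)

/-- The characterisation by `IsConnecting` determines the class: the relation is linear, invariant
under coboundaries, and relates 0 only to coboundaries. Hence arbitrarily chosen representatives `β
Z` give a linear map. -/
theorem exists_connectingHom (ρ : M.Γ →* PSLn n) :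
    ∃ δ : DirectSum (Fin m) (fun i => M.edgeH0 ρ i) →ₗ[ℝ] parH1 (gRep ρ) M.peripheral,
      ∀ (Z : DirectSum (Fin m) fun i => M.edgeH0 ρ i) (α : groupCohomology.cocycles₁ (gRep ρ)),
        (δ Z : groupCohomology.H1 (gRep ρ)) = groupCohomology.H1π (gRep ρ) α ↔
          M.IsConnecting ρ (fun i => Z i) α := by
  choose β₀ hβ₀ hconn₀ using fun Z : DirectSum (Fin m) fun i => M.edgeH0 ρ i =>
    M.exists_isConnecting (ρ := ρ) fun i => Z i
  set β : DirectSum (Fin m) (fun i => M.edgeH0 ρ i) → groupCohomology.cocycles₁ (gRep ρ) :=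
    fun Z => ⟨β₀ Z, mem_cocycles₁_iff_isAdCocycle.2 (hβ₀ Z)⟩ with hβ
  have hconn : ∀ Z, M.IsConnecting ρ (fun i => Z i) (β Z) := hconn₀
  have key : ∀ Z α, groupCohomology.H1π (gRep ρ) (β Z) = groupCohomology.H1π (gRep ρ) α ↔
      M.IsConnecting ρ (fun i => Z i) α := by
    intro Z α
    constructor
    · intro h
      obtain ⟨W, hW⟩ := H1π_eq_iff_exists.1 h.symm
      exact (hconn Z).add_coboundary M W hW
    · intro h
      have h0 := (hconn Z).sub M h
      rw [sub_self] at h0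
      obtain ⟨W, hW⟩ := h0.exists_coboundary M ((isAdCocycle_coe (β Z)).sub (isAdCocycle_coe α))
      exact H1π_eq_iff_exists.2 ⟨W, fun x => by rw [← hW]; simp⟩
  refine ⟨⟨⟨fun Z => ⟨groupCohomology.H1π (gRep ρ) (β Z), β Z, (hconn Z).mem_parCocycles M, rfl⟩,
    fun Z Z' => Subtype.ext ?_⟩, fun c Z => Subtype.ext ?_⟩, key⟩
  · change groupCohomology.H1π (gRep ρ) (β (Z + Z')) =
      groupCohomology.H1π (gRep ρ) (β Z) + groupCohomology.H1π (gRep ρ) (β Z')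
    rw [← map_add]
    exact (key _ _).2 ((hconn Z).add M (hconn Z'))
  · change groupCohomology.H1π (gRep ρ) (β (c • Z)) = c • groupCohomology.H1π (gRep ρ) (β Z)
    rw [← map_smul]
    exact (key _ _).2 ((hconn Z).smul M c)

theorem exists_restrictionHom (ρ : M.Γ →* PSLn n) :
    ∃ ι : parH1 (gRep ρ) M.peripheral →ₗ[ℝ] DirectSum (Fin l) fun v =>
        parH1 (gRep (ρ.comp (M.vertexGroup v).subtype)) (M.vertexPeripheral v),
      ∀ (c : parH1 (gRep ρ) M.peripheral) (v : Fin l),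
        (ι c v : groupCohomology.H1 (gRep (ρ.comp (M.vertexGroup v).subtype))) =
          resH1 ρ (M.vertexGroup v) c := by
  have hmem : ∀ v, ∀ c ∈ parH1 (gRep ρ) M.peripheral, resH1 ρ (M.vertexGroup v) c ∈
      parH1 (gRep (ρ.comp (M.vertexGroup v).subtype)) (M.vertexPeripheral v) := by
    rintro v _ ⟨α, hα, rfl⟩
    exact ⟨_, M.resCocycle_mem_parCocycles hα v, (resH1_H1π ρ (M.vertexGroup v) α).symm⟩
  set e := DirectSum.linearEquivFunOnFintype ℝ (Fin l) fun v =>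
    parH1 (gRep (ρ.comp (M.vertexGroup v).subtype)) (M.vertexPeripheral v)
  refine ⟨e.symm.toLinearMap.comp
    (LinearMap.pi fun v => (resH1 ρ (M.vertexGroup v)).restrict (hmem v)), fun c v => ?_⟩
  exact congrArg Subtype.val (congrFun (e.apply_symm_apply
    (fun v => (resH1 ρ (M.vertexGroup v)).restrict (hmem v) c)) v)

end CutSurface.Marking

end

/-! ### The exact sequence and the bending classes -/

theorem proposition4p2 {X : Type} [TopologicalSpace X] [ChartedSpace HypHalf X]
    (hX : IsHyperbolicSurface X) {b m l : ℕ} (C : CutSurface X b m l) (hC : C.IsEssential)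
    (M : C.Marking) {n : ℕ} (ρ : M.Γ →* PSLn n) (hρ : IsGoodRep ρ)
    (hρ' : ∀ v, IsGoodRep (ρ.comp (M.vertexGroup v).subtype)) :
    ∃ (δ : DirectSum (Fin m) (fun i => M.edgeH0 ρ i) →ₗ[ℝ] parH1 (gRep ρ) M.peripheral)
      (ι : parH1 (gRep ρ) M.peripheral →ₗ[ℝ] DirectSum (Fin l) fun v =>
        parH1 (gRep (ρ.comp (M.vertexGroup v).subtype)) (M.vertexPeripheral v)),
      (Function.Injective δ ∧ Function.Exact δ ι ∧ Function.Surjective ι) ∧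
      (∀ (Z : DirectSum (Fin m) fun i => M.edgeH0 ρ i)
        (α : groupCohomology.cocycles₁ (gRep ρ)),
        (δ Z : groupCohomology.H1 (gRep ρ)) = groupCohomology.H1π (gRep ρ) α ↔
          M.IsConnecting ρ (fun i => Z i) α) ∧
      (∀ (i : Fin m) (Z : M.edgeH0 ρ i),
        (∃! Φ : ℝ → M.Γ →* PSLn n, M.IsBending ρ i Z Φ) ∧
        ∀ Φ : ℝ → M.Γ →* PSLn n, M.IsBending ρ i Z Φ →
          Φ 0 = ρ ∧ ∃ u : groupCohomology.cocycles₁ (gRep ρ), IsTangentTo Φ u ∧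
            (δ (DirectSum.lof ℝ (Fin m) (fun i => M.edgeH0 ρ i) i Z) :
              groupCohomology.H1 (gRep ρ)) = groupCohomology.H1π (gRep ρ) u) ∧
      ∀ (c : parH1 (gRep ρ) M.peripheral) (v : Fin l),
        (ι c v : groupCohomology.H1 (gRep (ρ.comp (M.vertexGroup v).subtype))) =
          resH1 ρ (M.vertexGroup v) c := by
  obtain ⟨δ, hδ⟩ := M.exists_connectingHom ρ
  obtain ⟨ι, hι⟩ := M.exists_restrictionHom ρ
  set e := DirectSum.linearEquivFunOnFintype ℝ (Fin m) fun i => M.edgeH0 ρ i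
  refine ⟨δ, ι, ⟨?_, fun c => ?_, fun d => ?_⟩, hδ, fun i Z => ?_, hι⟩
  · refine (injective_iff_map_eq_zero δ).2 fun Z hZ => ?_
    have h : M.IsConnecting ρ (fun i => Z i) (0 : groupCohomology.cocycles₁ (gRep ρ)) :=
      (hδ Z 0).1 (by rw [hZ, map_zero]; rfl)
    have h0 := h.eq_zero M hρ' (W := 0) fun x => by rw [map_zero, sub_zero]; rfl
    exact DFinsupp.ext fun i => congrFun h0 i
  · obtain ⟨_, α, hα, rfl⟩ := c
    -- The kernel of ι consists of the classes that are coboundaries on each vertex group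
    -- separately; the jumps of the 0-cochains across the curves are the preimage under δ.
    have key : ι ⟨_, α, hα, rfl⟩ = 0 ↔ ∀ v, ∃ Y : sln n, ∀ γ ∈ M.vertexGroup v,
        α γ = adPSL n (ρ γ) Y - Y := by
      have h : ∀ v, ι ⟨_, α, hα, rfl⟩ v = 0 ↔ ∃ Y : sln n, ∀ γ ∈ M.vertexGroup v,
          α γ = adPSL n (ρ γ) Y - Y := fun v => by
        rw [← Subtype.coe_inj, hι]
        change resH1 ρ (M.vertexGroup v) (groupCohomology.H1π (gRep ρ) α) = 0 ↔ _
        rw [resH1_H1π, ← map_zero (groupCohomology.H1π (gRep (ρ.comp (M.vertexGroup v).subtype))).hom]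
        refine H1π_eq_iff_exists.trans (exists_congr fun Y => ?_)
        refine ⟨fun h γ hγ => (h ⟨γ, hγ⟩).trans (zero_add _),
          fun h γ => (h γ γ.2).trans (zero_add _).symm⟩
      exact ⟨fun h0 v => (h v).1 (by rw [h0]; rfl), fun h0 => DFinsupp.ext fun v => (h v).2 (h0 v)⟩
    rw [key]
    constructor
    · intro h
      obtain ⟨Z, hZ⟩ := M.exists_isConnecting_of_coboundary (isAdCocycle_coe α) h
      refine ⟨e.symm Z, Subtype.ext ((hδ _ _).2 ?_)⟩
      have he : (fun i => e.symm Z i) = Z := e.apply_symm_apply Z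
      rwa [he]
    · rintro ⟨Z, hZ⟩ v
      obtain ⟨Y, hY, -⟩ := (hδ Z α).1 (congrArg Subtype.val hZ)
      exact ⟨Y v, hY v⟩
  · choose α hα hαd using fun v => (d v).2
    obtain ⟨β, hβ, hY⟩ := M.exists_parCocycle_res α hα
    refine ⟨⟨_, β, hβ, rfl⟩, DFinsupp.ext fun v => Subtype.ext ?_⟩
    obtain ⟨Y, hY⟩ := hY v
    refine (hι _ v).trans ((resH1_H1π ρ (M.vertexGroup v) β).trans (Eq.trans ?_ (hαd v)))
    exact H1π_eq_iff_exists.2 ⟨Y, hY⟩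
  -- The family with Z in the i-th summand and 0 elsewhere: its twist is the bending, and the
  -- tangent cocycle of the twist represents its image under δ.
  · obtain ⟨ε, r, hΦ, hD, hD', hcomm⟩ := M.exists_twist_data i Z
      (fun k => DirectSum.lof ℝ (Fin m) (fun i => M.edgeH0 ρ i) i Z k)
      (DirectSum.lof_apply (M := fun i => M.edgeH0 ρ i) ℝ i Z) fun k hk => by
        rw [DirectSum.lof_eq_of]
        exact DirectSum.of_eq_of_ne (β := fun i => M.edgeH0 ρ i) i k Z hk
    obtain ⟨u, hu, hconn, htan⟩ := M.exists_tangent_cocycle _ hD hD'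
    obtain ⟨Φ, hΦ₀⟩ := M.exists_isTwist (fun k hk => (hD k hk).1) hcomm
    refine ⟨⟨Φ, (hΦ Φ).2 hΦ₀, fun Φ' h => ((hΦ Φ').1 h).unique M hΦ₀⟩, fun Φ' h => ?_⟩
    have h' := (hΦ Φ').1 h
    exact ⟨h'.zero M, ⟨u, mem_cocycles₁_iff_isAdCocycle.2 hu⟩, htan Φ' h', (hδ _ _).2 hconn⟩
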